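/- Let $\log$ and complex powers be principal. For complex $z,s,b$ let $\Phi(z,s,b)$ denote the Hurwitz–Lerch zeta function: for $|z|<1$ it is $\sum_{n\ge 0} z^n/(b+n)^s$; for $z\in\mathbb C\setminus[1,\infty)$ it is the analytic continuation of this series in $z$ to the cut plane; for $z=1$, $s\ne 1$, it is the Hurwitz zeta function $\zeta(s,b)$, i.e. the analytic continuation in $s$ to $\mathbb C\setminus\{1\}$ of $\sum_{n\ge0}(b+n)^{-s}$ ($\operatorname{Re}s>1$); for real $z>1$ it is the boundary value $\lim_{w\to z,\ \operatorname{Im}w<0}\Phi(w,s,b)$. (A term with $b+n=0$ counts as $0$; this matters only when $s$ is a negative integer.) Let $a,m,k,\alpha,\beta\in\mathbb C$ satisfy - $k\neq0$, $|\operatorname{Im}m|<1$, and $(m,k)\ne(0,-1)$; - $|\operatorname{Re}\alpha|<\pi$ and $|\operatorname{Re}\beta|<\pi$; - $|a|>1$; or $|a|=1$ and $\operatorname{Re}k>0$; or $a\neq0$ and $k$ is a positive integer. Let $\log\left(\frac{\cos\alpha+\cosh x}{\cos\beta+\cosh x}\right)$, $x\ge0$, denote the continuous branch of the logarithm of the quotient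 on $[0,\infty)$ that tends to $0$ as $x\to\infty$ (for real $\alpha,\beta$ this is the real logarithm). Then the following integral converges absolutely and $$\int_0^\infty e^{-imx}\left(e^{2imx}(\log a+ix)^{k-1}+\frac{m\left(e^{2imx}(\log a+ix)^k+(\log a-ix)^k\right)}{k}+(\log a-ix)^{k-1}\right)\log\left(\frac{\cos\alpha+\cosh x}{\cos\beta+\cosh x}\right)dx$$ $$=\frac{(2\pi)^{k+1}}{k}\Big(e^{(\pi-\alpha)m}\,\Phi\big(e^{2m\pi},-k,\tfrac{-\alpha+\log a+\pi}{2\pi}\big)+e^{(\alpha+\pi)m}\,\Phi\big(e^{2m\pi},-k,\tfrac{\alpha+\log a+\pi}{2\pi}\big)$$ $$\qquad-e^{(\pi-\beta)m}\Big(\Phi\big(e^{2m\pi},-k,\tfrac{-\beta+\log a+\pi}{2\pi}\big)+e^{2\beta m}\,\Phi\big(e^{2m\pi},-k,\tfrac{\beta+\log a+\pi}{2\pi}\big)\Big)\Big).$$ -/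

import Mathlib

open Set Filter Topology MeasureTheory

/-- The plane cut along the real half-line `[1, ∞)`. -/
def lerchCutPlane : Set ℂ := {z | ¬ (1 ≤ z.re ∧ z.im = 0)}

/-- `F` is, for fixed `s` and `a`, the analytic continuation to the cut plane of the series
`∑ zⁿ / (a + n)ˢ`, `|z| < 1`, with principal powers. Such an `F` is unique on the cut plane, which
is connected. (For `s = -k` with `k` a positive integer a term with `a + n = 0` is `0`, as it
should be.) -/
def IsLerchContinuation (s a : ℂ) (F : ℂ → ℂ) : Prop :=
  DifferentiableOn ℂ F lerchCutPlane ∧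
    ∀ z : ℂ, ‖z‖ < 1 → F z = ∑' n : ℕ, z ^ n / (a + n) ^ s

/-- `G` is, for fixed `a`, the analytic continuation in `s` to `ℂ ∖ {1}` of the series
`∑ 1 / (a + n)ˢ`, `Re s > 1`. -/
def IsHurwitzContinuation (a : ℂ) (G : ℂ → ℂ) : Prop :=
  DifferentiableOn ℂ G {1}ᶜ ∧
    ∀ s : ℂ, 1 < s.re → G s = ∑' n : ℕ, 1 / (a + n) ^ s

/-- The branch of `z ↦ Φ(z, s, a)` on the cut plane. -/
noncomputable def lerchPrincipal (s a : ℂ) : ℂ → ℂ :=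
  Classical.epsilon (IsLerchContinuation s a)

/-- The Hurwitz zeta function `ζ(s, a)`, `s ≠ 1`, with a complex parameter `a`. -/
noncomputable def hurwitzZetaC (s a : ℂ) : ℂ :=
  Classical.epsilon (IsHurwitzContinuation a) s

open Classical in
/-- The Hurwitz–Lerch zeta function `Φ(z, s, a)`: the principal branch on `ℂ ∖ [1, ∞)`, the
Hurwitz zeta function `ζ(s, a)` at `z = 1`, and on the cut `(1, ∞)` the boundary value from
below. -/
noncomputable def lerchPhi (z s a : ℂ) : ℂ :=
  if z ∈ lerchCutPlane then lerchPrincipal s a z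
  else if z = 1 then hurwitzZetaC s a
  else limUnder (𝓝[{w : ℂ | w.im < 0}] z) (lerchPrincipal s a)

/-- `ℓ` is the logarithm of the quotient `(cos α + cosh x) / (cos β + cosh x)` along `[0, ∞)`:
the continuous branch that tends to `0` as `x → ∞`. It is unique, and it is the principal
logarithm of the quotient whenever the quotient stays off `(-∞, 0]`, e.g. for real `α`, `β`. -/
structure IsLogQuotient (α β : ℂ) (ℓ : ℝ → ℂ) : Prop where
  continuousOn : ContinuousOn ℓ (Ici 0)
  exp_eq : ∀ x : ℝ, 0 ≤ x → Complex.exp (ℓ x) =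
    (Complex.cos α + Complex.cosh x) / (Complex.cos β + Complex.cosh x)
  tendsto_zero : Tendsto ℓ atTop (𝓝 0)

/-- The integrand, for a given logarithm `ℓ` of the quotient. -/
noncomputable def lerchIntegrand (a m k : ℂ) (ℓ : ℝ → ℂ) (x : ℝ) : ℂ :=
  Complex.exp (-(Complex.I * m * x)) *
    (Complex.exp (2 * Complex.I * m * x) * (Complex.log a + Complex.I * x) ^ (k - 1)
      + m * (Complex.exp (2 * Complex.I * m * x) * (Complex.log a + Complex.I * x) ^ k
          + (Complex.log a - Complex.I * x) ^ k) / k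
      + (Complex.log a - Complex.I * x) ^ (k - 1)) * ℓ x

/-! Put L = log a, z = exp(2πm), H(x) = exp(imx)(L + ix)^k and f_α(x) = 1/(1 + exp(x - iα)). The
integrand is (H(x) - H(-x))' ℓ(x)/(ik), and the factorization (1 + exp(x - iα))(1 + exp(x + iα)) = 2
exp(x)(cos α + cosh x) shows that -ℓ' is the odd function q = f_α - f_β + f_{-α} - f_{-β}
(`IsLogQuotient.hasDerivAt`). Integrating by parts and unfolding the half-line gives -(i/k) ∫ H q
over the whole line (`integral_lerchIntegrand`).

Moving that line down by 2πi leaves f_α unchanged, multiplies H by z and replaces L by L + 2π. One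
pole of f_α is crossed, and its residue is, up to a constant, the first term of the Lerch series
(`integral_expMulCpow_shift`). Iterating, the series telescopes to the line integral of H f_α when
Re m < 0 and -1 < Im m < 0 (`lerch_series_of_re_neg`). As m runs through the whole strip -1 < Im m <
0, z runs through the plane without [0, ∞), so the same integral continues the series analytically
(`exists_isLerchContinuation`).

For the remaining m, subtract from f_α the step function with the same limits at ±∞. The integral
against the difference converges for |Im m| < 1, and what the step contributes does not involve α,
so it cancels between α and β (`exists_lerchPhi_eq_integral`). This contribution is a half-line
integral for nonreal m, a limit from below for real m ≠ 0, and an explicit power of L for m = 0,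
where the Hurwitz zeta function enters.

All this uses Re L > 0. For other admissible L, both sides obey the same recurrence under L ↦ L +
2π, the contour shift on one side and Φ(z,s,b) = b^(-s) + zΦ(z,s,b+1) on the other, so finitely many
steps suffice (`lerchPhi_sub_eq_integral`). -/

/-! ### Holomorphic dependence of integrals on a parameter. -/

/-- An integral depending holomorphically on a parameter, with an integrable dominating function,
is holomorphic in the parameter. -/
theorem differentiableOn_integral_of_dominated {X : Type*} [MeasurableSpace X] {μ : Measure X}
    {U : Set ℂ} (hU : IsOpen U) {F : ℂ → X → ℂ}
    (hmeas : ∀ s ∈ U, AEStronglyMeasurable (F s) μ)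
    (hdiff : ∀ x, DifferentiableOn ℂ (fun s => F s x) U)
    (hbound : ∀ s₀ ∈ U, ∃ V ∈ 𝓝 s₀, ∃ B : X → ℝ, Integrable B μ ∧
      ∀ᵐ x ∂μ, ∀ s ∈ V, ‖F s x‖ ≤ B x) :
    DifferentiableOn ℂ (fun s => ∫ x, F s x ∂μ) U := by
  intro s₀ hs₀
  obtain ⟨V, hV, B, hB, hFB⟩ := hbound s₀ hs₀
  obtain ⟨r, hr, hrV⟩ := Metric.mem_nhds_iff.1 (inter_mem hV (hU.mem_nhds hs₀))
  -- Closed discs of radius r/4 about points of the ball of radius r/4 stay in the ball of radius r,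
  -- so Cauchy's estimate bounds the derivative by B/(r/4) there.
  have hr2 : 0 < r / 4 := by positivity
  have hsub : ∀ s ∈ Metric.ball s₀ (r / 4), Metric.closedBall s (r / 4) ⊆ V ∩ U := by
    intro s hs w hw
    apply hrV
    rw [Metric.mem_ball] at hs ⊢
    rw [Metric.mem_closedBall] at hw
    have := dist_triangle w s s₀
    linarith
  have hderiv : ∀ x, ∀ s ∈ U, HasDerivAt (fun s => F s x) (deriv (fun s => F s x) s) s :=
    fun x s hs => ((hdiff x s hs).differentiableAt (hU.mem_nhds hs)).hasDerivAt
  have hs₀' : s₀ ∈ Metric.ball s₀ (r / 4) := Metric.mem_ball_self hr2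
  -- the derivative is a limit of difference quotients, hence measurable
  have hmeas' : AEStronglyMeasurable (fun x => deriv (fun s => F s x) s₀) μ := by
    obtain ⟨u, hu⟩ : ∃ u : ℕ → ℂ, (∀ n, u n ≠ 0 ∧ s₀ + u n ∈ U) ∧ Tendsto u atTop (𝓝 0) := by
      refine ⟨fun n => ((r / 2 * (1 / ((n : ℝ) + 1)) : ℝ) : ℂ), fun n => ⟨?_, ?_⟩, ?_⟩
      · exact Complex.ofReal_ne_zero.2 (by positivity)
      · refine (hrV ?_).2
        rw [Metric.mem_ball, dist_eq_norm, add_sub_cancel_left, Complex.norm_real,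
          Real.norm_of_nonneg (by positivity)]
        have : 1 / ((n : ℝ) + 1) ≤ 1 := by
          rw [div_le_one (by positivity)]; linarith [Nat.cast_nonneg (α := ℝ) n]
        nlinarith
      · have := (tendsto_one_div_add_atTop_nhds_zero_nat (𝕜 := ℝ)).const_mul (r / 2)
        rw [mul_zero] at this
        exact_mod_cast (Complex.continuous_ofReal.tendsto 0).comp this
    refine aestronglyMeasurable_of_tendsto_ae (u := atTop)
      (f := fun n x => (u n)⁻¹ • (F (s₀ + u n) x - F s₀ x)) (fun n => ?_)
      (ae_of_all _ fun x => ?_)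
    · exact ((hmeas _ (hu.1 n).2).sub (hmeas _ hs₀)).const_smul (u n)⁻¹
    refine (hderiv x s₀ hs₀).tendsto_slope_zero.comp ?_
    exact tendsto_nhdsWithin_iff.2 ⟨hu.2, Eventually.of_forall fun n => (hu.1 n).1⟩
  refine (hasDerivAt_integral_of_dominated_loc_of_deriv_le (𝕜 := ℂ)
    (bound := fun x => B x / (r / 4)) (F' := fun s x => deriv (fun s => F s x) s)
    (Metric.ball_mem_nhds s₀ hr2) ?_ ?_ hmeas' ?_ (hB.div_const _) ?_).2.differentiableAt
    |>.differentiableWithinAt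
  · filter_upwards [hU.mem_nhds hs₀] with s hs using hmeas s hs
  · refine hB.mono' (hmeas _ hs₀) ?_
    filter_upwards [hFB] with x hx using hx _ (mem_of_mem_nhds hV)
  · filter_upwards [hFB] with x hx s hs
    refine Complex.norm_deriv_le_of_forall_mem_sphere_norm_le hr2 ?_ fun z hz =>
      hx z (hsub s hs (Metric.sphere_subset_closedBall hz)).1
    exact ((hdiff x).mono fun z hz => (hsub s hs hz).2).diffContOnCl_ball subset_rfl
  · exact ae_of_all _ fun x s hs =>
      hderiv x s (hsub s hs (Metric.mem_closedBall_self hr2.le)).2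

/-! ### Cauchy's theorem on a strip, and line integrals of simple fractions. -/

/-- Cauchy's theorem for a horizontal strip. -/
theorem integral_eq_integral_sub_of_strip {T : ℝ} (hT : 0 ≤ T) {G : ℂ → ℂ}
    (hc : ContinuousOn G {z | z.im ∈ Icc (-T) 0})
    (hd : DifferentiableOn ℂ G {z | z.im ∈ Ioo (-T) 0})
    (h1 : Integrable fun x : ℝ => G x) (h2 : Integrable fun x : ℝ => G (x - T * Complex.I))
    {B : ℝ → ℝ} (hB : Tendsto B (cocompact ℝ) (𝓝 0))
    (hGB : ∀ᶠ x : ℝ in cocompact ℝ, ∀ y ∈ Icc (-T) 0, ‖G (x + y * Complex.I)‖ ≤ B x) :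
    ∫ x : ℝ, G x = ∫ x : ℝ, G (x - T * Complex.I) := by
  -- The vertical sides vanish in the limit; u R = R and u R = -R are treated together.
  have hside : ∀ {u : ℝ → ℝ}, Tendsto u atTop (cocompact ℝ) →
      Tendsto (fun R : ℝ => Complex.I • ∫ y in (-T)..0, G ((u R : ℝ) + y * Complex.I))
        atTop (𝓝 0) := by
    intro u hu
    refine squeeze_zero_norm' (a := fun R => B (u R) * |0 - (-T)|) ?_ ?_
    · filter_upwards [hu.eventually hGB] with R hR
      rw [norm_smul, Complex.norm_I, one_mul]
      refine intervalIntegral.norm_integral_le_of_norm_le_const fun y hy => hR y ?_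
      rw [uIoc_of_le (by linarith)] at hy
      exact ⟨hy.1.le, hy.2⟩
    · simpa using (hB.comp hu).mul_const (|0 - (-T)|)
  have htop : Tendsto (fun R : ℝ => R) atTop (cocompact ℝ) :=
    tendsto_id.mono_right atTop_le_cocompact
  have hbot : Tendsto (fun R : ℝ => -R) atTop (cocompact ℝ) :=
    tendsto_neg_atTop_atBot.mono_right atBot_le_cocompact
  have hrect : ∀ R : ℝ, (((∫ x in (-R)..R, G (x - T * Complex.I)) - ∫ x in (-R)..R, G x) +
      Complex.I • ∫ y in (-T)..0, G ((R : ℝ) + y * Complex.I)) -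
      Complex.I • ∫ y in (-T)..0, G (((-R : ℝ) : ℝ) + y * Complex.I) = 0 := by
    intro R
    have := Complex.integral_boundary_rect_eq_zero_of_continuousOn_of_differentiableOn G
      (⟨-R, -T⟩ : ℂ) (⟨R, 0⟩ : ℂ) (hc.mono ?_) (hd.mono ?_)
    · simpa [sub_eq_add_neg] using this
    · intro z hz
      have := hz.2
      simpa [uIcc_of_le (show -T ≤ 0 by linarith)] using this
    · intro z hz
      have := hz.2
      simpa [min_eq_left (show -T ≤ 0 by linarith), max_eq_right (show -T ≤ 0 by linarith)]
        using this
  have hlim := (((intervalIntegral_tendsto_integral h2 tendsto_neg_atTop_atBot tendsto_id).sub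
    (intervalIntegral_tendsto_integral h1 tendsto_neg_atTop_atBot tendsto_id)).add
      (hside htop)).sub (hside hbot)
  have := tendsto_nhds_unique (hlim.congr hrect) tendsto_const_nhds
  rw [add_zero, sub_zero, sub_eq_zero] at this
  exact this.symm

theorem exists_pos_mul_one_add_abs_le {p : ℂ} (hp : p.im ≠ 0) :
    ∃ c > 0, ∀ x : ℝ, c * (1 + |x|) ≤ ‖(x : ℂ) - p‖ := by
  have hi : 0 < |p.im| := abs_pos.2 hp
  -- The constant results from adding |x| ≤ ‖x - p‖ + ‖p‖ and 1 + ‖p‖ ≤ ((1 + ‖p‖)/|Im p|) ‖x - p‖.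
  refine ⟨(1 + (1 + ‖p‖) / |p.im|)⁻¹, by positivity, fun x => ?_⟩
  rw [inv_mul_le_iff₀ (by positivity)]
  have h1 : |p.im| ≤ ‖(x : ℂ) - p‖ := by
    have := Complex.abs_im_le_norm ((x : ℂ) - p)
    simpa using this
  have h2 : |x| ≤ ‖(x : ℂ) - p‖ + ‖p‖ := by
    have := norm_add_le ((x : ℂ) - p) p
    simpa using this
  have h3 : 1 + ‖p‖ ≤ (1 + ‖p‖) / |p.im| * ‖(x : ℂ) - p‖ := by
    rw [div_mul_eq_mul_div, le_div_iff₀ hi]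
    gcongr
  linarith [add_mul 1 ((1 + ‖p‖) / |p.im|) ‖(x : ℂ) - p‖]

/-- A single fraction decays only like 1/|x|; in the difference the leading terms cancel and the
decay is quadratic. -/
theorem integrable_one_div_sub_sub {p p' : ℂ} (hp : p.im ≠ 0) (hp' : p'.im ≠ 0) :
    Integrable fun x : ℝ => 1 / ((x : ℂ) - p) - 1 / ((x : ℂ) - p') := by
  obtain ⟨c, hc, h⟩ := exists_pos_mul_one_add_abs_le hp
  obtain ⟨c', hc', h'⟩ := exists_pos_mul_one_add_abs_le hp'
  have hne : ∀ {q : ℂ}, q.im ≠ 0 → ∀ x : ℝ, (x : ℂ) - q ≠ 0 := fun hq x h0 => by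
    apply hq; simpa using congrArg Complex.im h0
  have hint := (integrable_one_add_norm (E := ℝ) (μ := volume) (r := 2) (by simp)).const_mul
    (‖p - p'‖ / (c * c'))
  refine hint.mono' (Continuous.aestronglyMeasurable ?_) (ae_of_all _ fun x => ?_)
  · exact (continuous_const.div (by fun_prop) (hne hp)).sub
      (continuous_const.div (by fun_prop) (hne hp'))
  · have e : 1 / ((x : ℂ) - p) - 1 / ((x : ℂ) - p') =
        (p - p') / (((x : ℂ) - p) * ((x : ℂ) - p')) := by
      field_simp [hne hp x, hne hp' x]
      ring
    have hx : 0 < 1 + |x| := by positivity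
    rw [e, norm_div, norm_mul, Real.norm_eq_abs, Real.rpow_neg hx.le, Real.rpow_two]
    rw [div_mul_eq_mul_div, ← div_eq_mul_inv, div_div]
    refine div_le_div_of_nonneg_left (norm_nonneg _) (by positivity) ?_
    calc (1 + |x|) ^ 2 * (c * c') = (c * (1 + |x|)) * (c' * (1 + |x|)) := by ring
      _ ≤ _ := mul_le_mul (h x) (h' x) (by positivity) (norm_nonneg _)

/-- A primitive of `1 / (x - p)` along the real line. -/
theorem hasDerivAt_log_mul_sub {u p : ℂ} (hu : ∀ x : ℝ, 0 < (u * (x - p)).re) (x : ℝ) :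
    HasDerivAt (fun x : ℝ => Complex.log (u * (x - p))) (1 / ((x : ℂ) - p)) x := by
  have hu0 : u ≠ 0 := by rintro rfl; simpa using hu x
  have h1 : HasDerivAt (fun x : ℝ => u * ((x : ℂ) - p)) u x := by
    simpa using ((Complex.ofRealCLM.hasDerivAt (x := x)).sub_const p).const_mul u
  have := h1.clog_real (Or.inl (hu x))
  rwa [show u / (u * ((x : ℂ) - p)) = 1 / ((x : ℂ) - p) by
    rw [div_mul_eq_div_div, div_self hu0]] at this

/-- The sign ε = ±1 selects the end of the line. Factoring εx out of u(x - p) isolates the divergent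
part log|x|, which does not depend on p and cancels between two fractions. -/
theorem tendsto_log_mul_sub_log {u p : ℂ} (hu : ∀ x : ℝ, 0 < (u * (x - p)).re) {ε : ℝ}
    (hslit : u * ε ∈ Complex.slitPlane) {l : Filter ℝ} (hl : Tendsto (fun x => ε * x) l atTop)
    (hε : ε * ε = 1) :
    Tendsto (fun x : ℝ => Complex.log (u * (x - p)) - Real.log (ε * x)) l
      (𝓝 (Complex.log (u * ε))) := by
  have h0 : Tendsto (fun x : ℝ => u * (ε - p * ((ε * x)⁻¹ : ℝ))) l (𝓝 (u * ε)) := by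
    have := (Complex.continuous_ofReal.tendsto 0).comp (tendsto_inv_atTop_zero.comp hl)
    simpa using ((this.const_mul p).const_sub (ε : ℂ)).const_mul u
  refine ((continuousAt_clog hslit).tendsto.comp h0).congr' ?_
  filter_upwards [hl.eventually_gt_atTop 0] with x hx
  have hne : ((ε * x : ℝ) : ℂ) ≠ 0 := Complex.ofReal_ne_zero.2 hx.ne'
  have e : u * ((x : ℂ) - p) = ((ε * x : ℝ) : ℂ) * (u * (ε - p * ((ε * x)⁻¹ : ℝ))) := by
    have hε' : (ε : ℂ) * ε = 1 := by exact_mod_cast hε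
    have : (p : ℂ) * ((ε * x : ℝ) : ℂ) * (((ε * x)⁻¹ : ℝ) : ℂ) = p := by
      rw [Complex.ofReal_inv, mul_assoc, mul_inv_cancel₀ hne, mul_one]
    calc u * ((x : ℂ) - p) = u * ((ε * ε) * x - p * ((ε * x : ℝ) : ℂ) * (((ε * x)⁻¹ : ℝ) : ℂ)) := by
          rw [this, hε', one_mul]
      _ = _ := by push_cast; ring
  have hne2 : u * (ε - p * ((ε * x)⁻¹ : ℝ)) ≠ 0 := by
    intro h; have := hu x; rw [e, h] at this; simp at this
  simp only [Function.comp]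
  rw [e, Complex.log_ofReal_mul hx hne2]
  ring

/-- The factors u and u' rotate each line into the right half-plane, so principal logarithms are
primitives along all of ℝ and only their limits at the two ends matter. -/
theorem integral_one_div_sub_sub {u u' p p' : ℂ} (hu : ∀ x : ℝ, 0 < (u * (x - p)).re)
    (hu' : ∀ x : ℝ, 0 < (u' * (x - p')).re) (hp : p.im ≠ 0) (hp' : p'.im ≠ 0)
    (h1 : u ∈ Complex.slitPlane) (h2 : -u ∈ Complex.slitPlane)
    (h1' : u' ∈ Complex.slitPlane) (h2' : -u' ∈ Complex.slitPlane) :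
    ∫ x : ℝ, (1 / ((x : ℂ) - p) - 1 / ((x : ℂ) - p')) =
      (Complex.log u - Complex.log u') - (Complex.log (-u) - Complex.log (-u')) := by
  refine integral_of_hasDerivAt_of_tendsto
    (f := fun x : ℝ => Complex.log (u * (x - p)) - Complex.log (u' * (x - p')))
    (fun x => (hasDerivAt_log_mul_sub hu x).sub (hasDerivAt_log_mul_sub hu' x))
    (integrable_one_div_sub_sub hp hp') ?_ ?_
  · have hl : Tendsto (fun x : ℝ => (-1) * x) atBot atTop := by
      simpa using tendsto_neg_atBot_atTop
    have := (tendsto_log_mul_sub_log (p := p) hu (ε := -1) (by simpa using h2) hl (by norm_num)).sub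
      (tendsto_log_mul_sub_log hu' (ε := -1) (by simpa using h2') hl (by norm_num))
    simpa using this
  · have hl : Tendsto (fun x : ℝ => 1 * x) atTop atTop := by
      simp only [one_mul]; exact tendsto_id
    have := (tendsto_log_mul_sub_log (p := p) hu (ε := 1) (by simpa using h1) hl (by norm_num)).sub
      (tendsto_log_mul_sub_log hu' (ε := 1) (by simpa using h1') hl (by norm_num))
    simpa using this

/-- Poles on opposite sides need opposite rotations -i and i, and each end of the line contributes
-πi. This is where the residue of the contour shift comes from. -/
theorem integral_one_div_sub_sub_of_im_neg {p p' : ℂ} (hp : p.im < 0) (hp' : 0 < p'.im) :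
    ∫ x : ℝ, (1 / ((x : ℂ) - p) - 1 / ((x : ℂ) - p')) = -(2 * Real.pi * Complex.I) := by
  rw [integral_one_div_sub_sub (u := -Complex.I) (u' := Complex.I) (by simpa using hp)
    (by simpa using hp') hp.ne hp'.ne' (by simp [Complex.mem_slitPlane_iff])
    (by simp [Complex.mem_slitPlane_iff]) (by simp [Complex.mem_slitPlane_iff])
    (by simp [Complex.mem_slitPlane_iff]), neg_neg, Complex.log_I, Complex.log_neg_I]
  ring

theorem integral_one_div_sub_sub_of_im_pos {p p' : ℂ} (hp : 0 < p.im) (hp' : 0 < p'.im) :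
    ∫ x : ℝ, (1 / ((x : ℂ) - p) - 1 / ((x : ℂ) - p')) = 0 := by
  rw [integral_one_div_sub_sub (u := Complex.I) (u' := Complex.I) (by simpa using hp)
    (by simpa using hp') hp.ne' hp'.ne' (by simp [Complex.mem_slitPlane_iff])
    (by simp [Complex.mem_slitPlane_iff]) (by simp [Complex.mem_slitPlane_iff])
    (by simp [Complex.mem_slitPlane_iff])]
  ring

/-! ### The Fermi function, its pole, and the shift by one period. -/

/-- The Fermi function `1 / (1 + exp (x - iα))`. -/
noncomputable def fermi (α x : ℂ) : ℂ := 1 / (1 + Complex.exp (x - Complex.I * α))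

/-- The pole of the Fermi function just below the real line. -/
noncomputable def fermiPole (α : ℂ) : ℂ := Complex.I * α - Real.pi * Complex.I

theorem fermiPole_im (α : ℂ) : (fermiPole α).im = α.re - Real.pi := by simp [fermiPole]

theorem one_add_exp_eq (α x : ℂ) :
    1 + Complex.exp (x - Complex.I * α) = 1 - Complex.exp (x - fermiPole α) := by
  rw [fermiPole, show x - (Complex.I * α - Real.pi * Complex.I) =
    (x - Complex.I * α) + Real.pi * Complex.I by ring, Complex.exp_add, Complex.exp_pi_mul_I]
  ring

/-- The zeros of (exp w - 1)/w are the nonzero multiples of 2πi. Hence the Fermi function has only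
one pole in the closed strip that is used. -/
theorem dslope_exp_ne_zero {w : ℂ} (hw : |w.im| < 2 * Real.pi) :
    dslope Complex.exp 0 w ≠ 0 := by
  by_cases h : w = 0
  · subst h; simp
  · rw [dslope_of_ne _ h, slope_def_field]
    refine div_ne_zero (fun h0 => h ?_) (by simpa using h)
    rw [Complex.exp_zero, sub_eq_zero, Complex.exp_eq_one_iff] at h0
    obtain ⟨n, hn⟩ := h0
    have him : w.im = n * (2 * Real.pi) := by rw [hn]; simp
    have hn0 : n = 0 := by
      by_contra hne
      have h1 : (1 : ℝ) ≤ |(n : ℝ)| := by exact_mod_cast Int.one_le_abs hne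
      rw [him, abs_mul, abs_of_pos Real.two_pi_pos] at hw
      nlinarith [Real.two_pi_pos]
    simp [hn, hn0]

/-- The Fermi function with its pole cancelled. -/
noncomputable def fermiReg (α x : ℂ) : ℂ := -(dslope Complex.exp 0 (x - fermiPole α))⁻¹

theorem fermiReg_pole (α : ℂ) : fermiReg α (fermiPole α) = -1 := by simp [fermiReg]

theorem fermi_eq_fermiReg_div {α x : ℂ} (hx : x ≠ fermiPole α) :
    fermi α x = fermiReg α x / (x - fermiPole α) := by
  have h := sub_ne_zero.2 hx
  rw [fermi, fermiReg, one_add_exp_eq, dslope_of_ne _ h, slope_def_field, Complex.exp_zero,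
    sub_zero, inv_div, ← neg_div, div_div, mul_comm, ← div_div, neg_div, div_self h, neg_div,
    ← div_neg, neg_sub]

theorem differentiableAt_fermiReg {α x : ℂ} (hx : |(x - fermiPole α).im| < 2 * Real.pi) :
    DifferentiableAt ℂ (fermiReg α) x := by
  have hd : Differentiable ℂ (dslope Complex.exp 0) := by
    rw [← differentiableOn_univ, Complex.differentiableOn_dslope univ_mem, differentiableOn_univ]
    exact Complex.differentiable_exp
  exact (DifferentiableAt.inv ((hd _).comp x (by fun_prop)) (dslope_exp_ne_zero hx)).neg

/-- Subtracting the principal part at the pole from `h * fermi α`. -/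
theorem exists_mul_fermi_eq_add {h : ℂ → ℂ} {α : ℂ} (hα : |α.re| < Real.pi)
    (hc : ContinuousOn h {z | z.im ∈ Icc (-(2 * Real.pi)) 0})
    (hd : DifferentiableOn ℂ h {z | z.im ∈ Ioo (-(2 * Real.pi)) 0}) :
    ∃ G : ℂ → ℂ, ContinuousOn G {z | z.im ∈ Icc (-(2 * Real.pi)) 0} ∧
      DifferentiableOn ℂ G {z | z.im ∈ Ioo (-(2 * Real.pi)) 0} ∧
      ∀ x, x ≠ fermiPole α → G x = h x * fermi α x +
        h (fermiPole α) * (1 / (x - fermiPole α) - 1 / (x - Complex.I)) := by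
  set p := fermiPole α with hp
  have him : p.im = α.re - Real.pi := fermiPole_im α
  obtain ⟨hα1, hα2⟩ := abs_lt.1 hα
  have hO : IsOpen {z : ℂ | z.im ∈ Ioo (-(2 * Real.pi)) 0} :=
    isOpen_Ioo.preimage Complex.continuous_im
  have hsub : {z : ℂ | z.im ∈ Ioo (-(2 * Real.pi)) 0} ⊆ {z | z.im ∈ Icc (-(2 * Real.pi)) 0} :=
    fun z hz => Ioo_subset_Icc_self hz
  have hpO : p ∈ {z : ℂ | z.im ∈ Ioo (-(2 * Real.pi)) 0} := by
    rw [mem_ofPred_eq, him]; constructor <;> linarith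
  have hreg : ∀ x ∈ {z : ℂ | z.im ∈ Icc (-(2 * Real.pi)) 0},
      DifferentiableAt ℂ (fermiReg α) x := by
    intro x hx
    refine differentiableAt_fermiReg ?_
    rw [Complex.sub_im, fermiPole_im, abs_lt]
    constructor <;> linarith [hx.1, hx.2]
  have hI : ∀ x ∈ {z : ℂ | z.im ∈ Icc (-(2 * Real.pi)) 0}, x - Complex.I ≠ 0 := by
    intro x hx h0
    rw [sub_eq_zero.1 h0] at hx
    have := hx.2
    norm_num at this
  -- As `fermiReg` is -1 at p, the difference quotient is h · fermi + h(p)/(x - p). The fraction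
  -- 1/(x - i) has its pole above the strip and only serves to make the correction integrable.
  refine ⟨fun x => dslope (fun x => h x * fermiReg α x) p x - h p * (1 / (x - Complex.I)),
    ?_, ?_, ?_⟩
  · refine ContinuousOn.sub ?_ (continuousOn_const.mul (continuousOn_const.div (by fun_prop) hI))
    refine (continuousOn_dslope (mem_of_superset (hO.mem_nhds hpO) hsub)).2 ⟨?_, ?_⟩
    · exact hc.mul fun x hx => (hreg x hx).continuousAt.continuousWithinAt
    · exact (hd.differentiableAt (hO.mem_nhds hpO)).mul (hreg p (hsub hpO))
  · refine DifferentiableOn.sub ?_ (DifferentiableOn.const_mul (DifferentiableOn.div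
      (by fun_prop) (by fun_prop) fun x hx => hI x (hsub hx)) _)
    refine (Complex.differentiableOn_dslope (hO.mem_nhds hpO)).2 ?_
    exact hd.mul fun x hx => (hreg x (hsub hx)).differentiableWithinAt
  · intro x hx
    have hx0 := sub_ne_zero.2 hx
    simp only []
    rw [dslope_of_ne _ hx, slope_def_field, fermiReg_pole, fermi_eq_fermiReg_div hx, ← hp]
    field_simp
    ring

theorem fermi_sub_two_pi_I (α x : ℂ) : fermi α (x - 2 * Real.pi * Complex.I) = fermi α x := by
  rw [fermi, fermi, show x - 2 * Real.pi * Complex.I - Complex.I * α =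
    (x - Complex.I * α) - 2 * Real.pi * Complex.I by ring, Complex.exp_periodic.sub_eq]

theorem tendsto_one_div_sub_strip (p : ℂ) {T : ℝ} (hT : 0 ≤ T) :
    ∃ B : ℝ → ℝ, Tendsto B (cocompact ℝ) (𝓝 0) ∧ ∀ᶠ x : ℝ in cocompact ℝ, ∀ y ∈ Icc (-T) 0,
      ‖1 / ((x : ℂ) + y * Complex.I - p)‖ ≤ B x := by
  have hn : Tendsto (fun x : ℝ => |x| - (T + ‖p‖)) (cocompact ℝ) atTop := by
    have := tendsto_norm_cocompact_atTop (E := ℝ)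
    exact tendsto_atTop_add_const_right _ (-(T + ‖p‖)) this
  refine ⟨fun x => (|x| - (T + ‖p‖))⁻¹, tendsto_inv_atTop_zero.comp hn, ?_⟩
  filter_upwards [hn.eventually_gt_atTop 0] with x hx y hy
  rw [norm_div, norm_one, one_div]
  refine inv_anti₀ hx ?_
  have h1 : ‖(x : ℂ)‖ ≤ ‖(x : ℂ) + y * Complex.I - p‖ + (‖(y : ℂ) * Complex.I‖ + ‖p‖) := by
    calc ‖(x : ℂ)‖ = ‖((x : ℂ) + y * Complex.I - p) - (y * Complex.I - p)‖ := by ring_nf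
      _ ≤ _ := (norm_sub_le _ _).trans (by gcongr; exact norm_sub_le _ _)
  rw [norm_mul, Complex.norm_I, mul_one, Complex.norm_real, Complex.norm_real] at h1
  have h2 : ‖y‖ ≤ T := by rw [Real.norm_eq_abs, abs_le]; constructor <;> linarith [hy.1, hy.2]
  have h3 : ‖x‖ = |x| := rfl
  linarith

/-- Shifting the line of integration of `h * (fermi α - c * fermi β)` down by one period. -/
theorem integral_mul_fermi_sub_shift {h : ℂ → ℂ} {α β c : ℂ} (hα : |α.re| < Real.pi)
    (hβ : |β.re| < Real.pi)
    (hc : ContinuousOn h {z | z.im ∈ Icc (-(2 * Real.pi)) 0})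
    (hd : DifferentiableOn ℂ h {z | z.im ∈ Ioo (-(2 * Real.pi)) 0})
    (h1 : Integrable fun x : ℝ => h x * (fermi α x - c * fermi β x))
    (h2 : Integrable fun x : ℝ =>
      h (x - 2 * Real.pi * Complex.I) * (fermi α x - c * fermi β x))
    {B : ℝ → ℝ} (hB : Tendsto B (cocompact ℝ) (𝓝 0))
    (hhB : ∀ᶠ x : ℝ in cocompact ℝ, ∀ y ∈ Icc (-(2 * Real.pi)) 0,
      ‖h (x + y * Complex.I) * (fermi α (x + y * Complex.I) - c * fermi β (x + y * Complex.I))‖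
        ≤ B x) :
    (∫ x : ℝ, h x * (fermi α x - c * fermi β x)) -
      ∫ x : ℝ, h (x - 2 * Real.pi * Complex.I) * (fermi α x - c * fermi β x) =
      2 * Real.pi * Complex.I * (h (fermiPole α) - c * h (fermiPole β)) := by
  obtain ⟨G₁, hc₁, hd₁, hG₁⟩ := exists_mul_fermi_eq_add hα hc hd
  obtain ⟨G₂, hc₂, hd₂, hG₂⟩ := exists_mul_fermi_eq_add hβ hc hd
  set a := h (fermiPole α)
  set b := h (fermiPole β)
  have hpi := Real.pi_pos
  have imneg : ∀ {α : ℂ}, |α.re| < Real.pi → (fermiPole α).im < 0 := fun h => by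
    rw [fermiPole_im]; linarith [(abs_lt.1 h).2]
  have impos : ∀ {α : ℂ}, |α.re| < Real.pi →
      0 < (fermiPole α + 2 * Real.pi * Complex.I).im := fun {α} h => by
    have : (fermiPole α + 2 * Real.pi * Complex.I).im = (fermiPole α).im + 2 * Real.pi := by simp
    rw [this, fermiPole_im]; linarith [(abs_lt.1 h).1]
  have imI : 0 < (Complex.I + 2 * Real.pi * Complex.I).im := by simp; positivity
  have ne1 : ∀ {α : ℂ}, |α.re| < Real.pi → ∀ x : ℝ, (x : ℂ) ≠ fermiPole α := fun h x h0 => by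
    have := imneg h; rw [← h0] at this; simp at this
  have ne2 : ∀ {α : ℂ}, |α.re| < Real.pi → ∀ x : ℝ,
      (x : ℂ) - 2 * Real.pi * Complex.I ≠ fermiPole α := fun h x h0 => by
    have := impos h; rw [← h0] at this; simp at this
  have e1 : ∀ x : ℝ, G₁ x - c * G₂ x = h x * (fermi α x - c * fermi β x) +
      (a * (1 / (x - fermiPole α) - 1 / (x - Complex.I)) -
        c * b * (1 / (x - fermiPole β) - 1 / (x - Complex.I))) := fun x => by
    rw [hG₁ _ (ne1 hα x), hG₂ _ (ne1 hβ x)]; ring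
  have e2 : ∀ x : ℝ, G₁ (x - (2 * Real.pi : ℝ) * Complex.I) -
      c * G₂ (x - (2 * Real.pi : ℝ) * Complex.I) =
      h (x - 2 * Real.pi * Complex.I) * (fermi α x - c * fermi β x) +
      (a * (1 / (x - (fermiPole α + 2 * Real.pi * Complex.I)) -
          1 / (x - (Complex.I + 2 * Real.pi * Complex.I))) -
        c * b * (1 / (x - (fermiPole β + 2 * Real.pi * Complex.I)) -
          1 / (x - (Complex.I + 2 * Real.pi * Complex.I)))) := fun x => by
    push_cast
    rw [hG₁ _ (ne2 hα x), hG₂ _ (ne2 hβ x), fermi_sub_two_pi_I, fermi_sub_two_pi_I]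
    simp only [sub_sub, add_comm (2 * (Real.pi : ℂ) * Complex.I)]
    ring
  have i1 : ∀ {α : ℂ}, |α.re| < Real.pi →
      Integrable fun x : ℝ => 1 / ((x : ℂ) - fermiPole α) - 1 / ((x : ℂ) - Complex.I) :=
    fun h => integrable_one_div_sub_sub (imneg h).ne (by simp)
  have i2 : ∀ {α : ℂ}, |α.re| < Real.pi →
      Integrable fun x : ℝ => 1 / ((x : ℂ) - (fermiPole α + 2 * Real.pi * Complex.I)) -
        1 / ((x : ℂ) - (Complex.I + 2 * Real.pi * Complex.I)) :=
    fun h => integrable_one_div_sub_sub (impos h).ne' imI.ne'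
  have j1 := ((i1 hα).const_mul a).sub ((i1 hβ).const_mul (c * b))
  have j2 := ((i2 hα).const_mul a).sub ((i2 hβ).const_mul (c * b))
  simp only [Pi.sub_def] at j1 j2
  have key : ∫ x : ℝ, (G₁ x - c * G₂ x) = ∫ x : ℝ, (G₁ (x - (2 * Real.pi : ℝ) * Complex.I) -
      c * G₂ (x - (2 * Real.pi : ℝ) * Complex.I)) := by
    have hT : (0 : ℝ) ≤ 2 * Real.pi := by positivity
    obtain ⟨B₁, hB₁, hb₁⟩ := tendsto_one_div_sub_strip (fermiPole α) hT
    obtain ⟨B₂, hB₂, hb₂⟩ := tendsto_one_div_sub_strip (fermiPole β) hT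
    obtain ⟨B₃, hB₃, hb₃⟩ := tendsto_one_div_sub_strip Complex.I hT
    refine integral_eq_integral_sub_of_strip (G := fun x => G₁ x - c * G₂ x)
      (B := fun x => B x + (‖a‖ * (B₁ x + B₃ x) + ‖c * b‖ * (B₂ x + B₃ x))) hT
      (hc₁.sub (continuousOn_const.mul hc₂)) (hd₁.sub (hd₂.const_mul c)) ?_ ?_ ?_ ?_
    · simp only [e1]; exact h1.add j1
    · simp only [e2]; exact h2.add j2
    · simpa using hB.add (((hB₁.add hB₃).const_mul ‖a‖).add ((hB₂.add hB₃).const_mul ‖c * b‖))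
    -- Vertical segments through the poles are avoided, since the formulas for `G₁` and `G₂` fail
    -- there.
    · have hfar : ∀ q : ℂ, ∀ᶠ x : ℝ in cocompact ℝ, x ≠ q.re := fun q => by
        have := (isCompact_singleton (x := q.re)).compl_mem_cocompact
        filter_upwards [this] with x hx using hx
      filter_upwards [hhB, hb₁, hb₂, hb₃, hfar (fermiPole α), hfar (fermiPole β)]
        with x h0 h1 h2 h3 h4 h5 y hy
      have hx : ∀ {q : ℂ}, x ≠ q.re → (x : ℂ) + y * Complex.I ≠ q := fun h h0 => h (by simp [← h0])
      rw [hG₁ _ (hx h4), hG₂ _ (hx h5)]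
      have e : ∀ u v w s t f g : ℂ, u * f + a * (v - w) - c * (u * g + b * (s - w)) =
        u * (f - c * g) + (a * (v - w) - c * b * (s - w)) := fun u v w s t f g => by ring
      rw [e _ _ _ _ 0 _ _]
      refine (norm_add_le _ _).trans (add_le_add (h0 y hy) ((norm_sub_le _ _).trans
        (add_le_add ?_ ?_))) <;> rw [norm_mul] <;>
        refine mul_le_mul_of_nonneg_left ((norm_sub_le _ _).trans (add_le_add ?_ (h3 y hy)))
          (norm_nonneg _)
      exacts [h1 y hy, h2 y hy]
  -- On the real line the poles lie below and the fractions contribute -2πi each; after translation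
  -- by 2πi they lie above and contribute nothing.
  simp only [e1, e2] at key
  rw [integral_add h1 j1, integral_add h2 j2, integral_sub ((i1 hα).const_mul a)
    ((i1 hβ).const_mul (c * b)), integral_sub ((i2 hα).const_mul a) ((i2 hβ).const_mul (c * b))]
    at key
  simp only [integral_const_mul] at key
  rw [integral_one_div_sub_sub_of_im_neg (imneg hα) (by simp),
    integral_one_div_sub_sub_of_im_neg (imneg hβ) (by simp),
    integral_one_div_sub_sub_of_im_pos (impos hα) imI,
    integral_one_div_sub_sub_of_im_pos (impos hβ) imI] at key
  linear_combination key

/-! ### Exponential bounds for Fermi functions. -/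

theorem integrable_exp_neg_mul_abs {δ : ℝ} (hδ : 0 < δ) :
    Integrable fun x : ℝ => Real.exp (-(δ * |x|)) := by
  rw [← integrableOn_univ, ← Iic_union_Ioi (a := (0 : ℝ))]
  refine IntegrableOn.union ?_ ?_
  · refine (integrableOn_exp_mul_Iic hδ 0).congr_fun (fun x hx => ?_) measurableSet_Iic
    simp only [abs_of_nonpos (mem_Iic.1 hx)]; ring_nf
  · refine (integrableOn_exp_mul_Ioi (neg_neg_of_pos hδ) 0).congr_fun (fun x hx => ?_)
      measurableSet_Ioi
    simp only [abs_of_pos (mem_Ioi.1 hx)]; ring_nf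

theorem tendsto_exp_neg_mul_abs_cocompact {δ : ℝ} (hδ : 0 < δ) :
    Tendsto (fun x : ℝ => Real.exp (-(δ * |x|))) (cocompact ℝ) (𝓝 0) :=
  Real.tendsto_exp_neg_atTop_nhds_zero.comp
    ((tendsto_norm_cocompact_atTop (E := ℝ)).const_mul_atTop hδ)

/-- With ρ = exp(Re w), the difference of the squares of the two sides is exactly (1 - ρ)² sin²(Im w
/ 2). -/
theorem norm_one_add_exp_ge {w : ℂ} (hw : |w.im| < Real.pi) :
    Real.cos (w.im / 2) * (1 + Real.exp w.re) ≤ ‖1 + Complex.exp w‖ := by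
  obtain ⟨h1, h2⟩ := abs_lt.1 hw
  have hc : 0 < Real.cos (w.im / 2) := Real.cos_pos_of_mem_Ioo ⟨by linarith, by linarith⟩
  refine le_of_sq_le_sq ?_ (norm_nonneg _)
  rw [Complex.sq_norm, Complex.normSq_apply]
  simp only [Complex.add_re, Complex.add_im, Complex.one_re, Complex.one_im, Complex.exp_re,
    Complex.exp_im, zero_add]
  have hcos : Real.cos w.im = 2 * Real.cos (w.im / 2) ^ 2 - 1 := by
    rw [← Real.cos_two_mul]; ring_nf
  have hs := Real.sin_sq_add_cos_sq w.im
  have hc1 : Real.cos (w.im / 2) ^ 2 ≤ 1 := Real.cos_sq_le_one _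
  set ρ := Real.exp w.re
  have e : (1 + ρ * Real.cos w.im) * (1 + ρ * Real.cos w.im) +
      ρ * Real.sin w.im * (ρ * Real.sin w.im) - (Real.cos (w.im / 2) * (1 + ρ)) ^ 2 =
      (1 - ρ) ^ 2 * (1 - Real.cos (w.im / 2) ^ 2) := by
    linear_combination ρ ^ 2 * hs + 2 * ρ * hcos
  nlinarith [mul_nonneg (sq_nonneg (1 - ρ)) (sub_nonneg.2 hc1)]

/-- The pole inside the strip rules out a uniform bound. The two boundary lines avoid it, and for
large |Re z| one of the two summands dominates. -/
theorem exists_norm_one_add_exp_ge {α : ℂ} (hα : |α.re| < Real.pi) :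
    ∃ c > 0, ∃ R : ℝ, ∀ z : ℂ, (z.im = 0 ∨ z.im = -(2 * Real.pi) ∨ R ≤ |z.re|) →
      c * (1 + Real.exp (z.re + α.im)) ≤ ‖1 + Complex.exp (z - Complex.I * α)‖ := by
  have hre : ∀ z : ℂ, (z - Complex.I * α).re = z.re + α.im := fun z => by simp
  have him : ∀ z : ℂ, (z - Complex.I * α).im = z.im - α.re := fun z => by simp
  obtain ⟨h1, h2⟩ := abs_lt.1 hα
  have hc : 0 < Real.cos (α.re / 2) := Real.cos_pos_of_mem_Ioo ⟨by linarith, by linarith⟩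
  have h0 : ∀ z : ℂ, z.im = 0 → Real.cos (α.re / 2) * (1 + Real.exp (z.re + α.im)) ≤
      ‖1 + Complex.exp (z - Complex.I * α)‖ := fun z hz => by
    have := norm_one_add_exp_ge (w := z - Complex.I * α) (by rw [him, hz, zero_sub, abs_neg]; exact hα)
    rwa [hre, him, hz, zero_sub, neg_div, Real.cos_neg] at this
  -- The radius forces ρ = exp(Re z + Im α) to be at least e or at most 1/e, so ρ ≥ 2 or ρ ≤ 1/2,
  -- and then |ρ - 1| ≥ (1 + ρ)/3.
  refine ⟨min (Real.cos (α.re / 2)) (1 / 3), by positivity, |α.im| + 1, fun z hz => ?_⟩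
  have hpos : 0 < 1 + Real.exp (z.re + α.im) := by positivity
  rcases hz with hz | hz | hz
  · exact (mul_le_mul_of_nonneg_right (min_le_left _ _) hpos.le).trans (h0 z hz)
  · have := h0 (z + 2 * Real.pi * Complex.I) (by simp [hz])
    rw [show z + 2 * Real.pi * Complex.I - Complex.I * α =
      (z - Complex.I * α) + 2 * Real.pi * Complex.I by ring, Complex.exp_periodic] at this
    refine (mul_le_mul_of_nonneg_right (min_le_left _ _) hpos.le).trans ?_
    simpa using this
  · refine (mul_le_mul_of_nonneg_right (min_le_right _ _) hpos.le).trans ?_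
    have hn : ‖Complex.exp (z - Complex.I * α)‖ = Real.exp (z.re + α.im) := by
      rw [Complex.norm_exp, hre]
    have hone : ‖(1 : ℂ)‖ = 1 := norm_one
    have t1 := norm_sub_norm_le (Complex.exp (z - Complex.I * α)) (-1)
    have t2 := norm_sub_norm_le (1 : ℂ) (-Complex.exp (z - Complex.I * α))
    rw [norm_neg, hn, hone, sub_neg_eq_add] at t1 t2
    rw [add_comm (Complex.exp _)] at t1
    have ha := neg_abs_le α.im
    have hb := le_abs_self α.im
    rcases le_abs.1 hz with hz | hz
    · have : 1 + 1 ≤ Real.exp (z.re + α.im) :=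
        (by linarith : (1 : ℝ) + 1 ≤ (z.re + α.im) + 1).trans (Real.add_one_le_exp _)
      linarith
    · have h3 : 1 + 1 ≤ Real.exp (-(z.re + α.im)) :=
        (by linarith : (1 : ℝ) + 1 ≤ -(z.re + α.im) + 1).trans (Real.add_one_le_exp _)
      have h4 : Real.exp (-(z.re + α.im)) * Real.exp (z.re + α.im) = 1 := by
        rw [← Real.exp_add]; simp
      nlinarith [Real.exp_pos (z.re + α.im)]

theorem fermi_bounds {α : ℂ} (hα : |α.re| < Real.pi) :
    ∃ C > 0, ∃ R : ℝ, ∀ z : ℂ, (z.im = 0 ∨ z.im = -(2 * Real.pi) ∨ R ≤ |z.re|) →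
      ‖fermi α z‖ ≤ C ∧ ‖fermi α z‖ ≤ C * Real.exp (-z.re) ∧
        ‖1 - fermi α z‖ ≤ C * Real.exp z.re := by
  obtain ⟨c, hc, R, h⟩ := exists_norm_one_add_exp_ge hα
  refine ⟨c⁻¹ * Real.exp |α.im|, by positivity, R, fun z hz => ?_⟩
  have hb := h z hz
  have hpos := Real.exp_pos (z.re + α.im)
  have hD : 0 < ‖1 + Complex.exp (z - Complex.I * α)‖ := lt_of_lt_of_le (by positivity) hb
  have hne : 1 + Complex.exp (z - Complex.I * α) ≠ 0 := norm_pos_iff.1 hD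
  have e1 : 1 ≤ Real.exp |α.im| := Real.one_le_exp (abs_nonneg _)
  have hn : ‖fermi α z‖ ≤ c⁻¹ * (1 + Real.exp (z.re + α.im))⁻¹ := by
    rw [fermi, norm_div, norm_one, one_div, ← mul_inv]
    exact inv_anti₀ (by positivity) hb
  refine ⟨hn.trans ?_, hn.trans ?_, ?_⟩
  · refine mul_le_mul_of_nonneg_left (le_trans ?_ e1) (by positivity)
    exact inv_le_one_of_one_le₀ (by linarith)
  · rw [mul_assoc, ← Real.exp_add]
    refine mul_le_mul_of_nonneg_left ?_ (by positivity)
    calc (1 + Real.exp (z.re + α.im))⁻¹ ≤ (Real.exp (z.re + α.im))⁻¹ :=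
          inv_anti₀ hpos (by linarith)
      _ = Real.exp (-(z.re + α.im)) := (Real.exp_neg _).symm
      _ ≤ _ := Real.exp_le_exp.2 (by linarith [neg_abs_le α.im])
  · have e : 1 - fermi α z = Complex.exp (z - Complex.I * α) * fermi α z := by
      rw [fermi]; field_simp; ring
    have hre : (z - Complex.I * α).re = z.re + α.im := by simp
    rw [e, norm_mul, Complex.norm_exp, hre]
    calc Real.exp (z.re + α.im) * ‖fermi α z‖
        ≤ Real.exp (z.re + α.im) * (c⁻¹ * 1) := by
          refine mul_le_mul_of_nonneg_left (hn.trans ?_) hpos.le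
          exact mul_le_mul_of_nonneg_left (inv_le_one_of_one_le₀ (by linarith)) (by positivity)
      _ = c⁻¹ * Real.exp (z.re + α.im) := by ring
      _ ≤ _ := by
          rw [mul_assoc, ← Real.exp_add]
          exact mul_le_mul_of_nonneg_left
            (Real.exp_le_exp.2 (by linarith [le_abs_self α.im])) (by positivity)

theorem one_add_exp_ne_zero {α : ℂ} (hα : |α.re| < Real.pi) (x : ℝ) :
    1 + Complex.exp (x - Complex.I * α) ≠ 0 := by
  obtain ⟨c, hc, R, h⟩ := exists_norm_one_add_exp_ge hα
  exact norm_pos_iff.1 (lt_of_lt_of_le (by positivity) (h x (Or.inl (by simp))))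

theorem continuous_fermi {α : ℂ} (hα : |α.re| < Real.pi) :
    Continuous fun x : ℝ => fermi α x :=
  continuous_const.div (by fun_prop) (one_add_exp_ne_zero hα)

/-- All Fermi functions have the limits 1 at -∞ and 0 at +∞, so a difference decays at both ends.
This is what makes the whole range |Im m| < 1 accessible. -/
theorem fermi_sub_fermi_bound {α β : ℂ} (hα : |α.re| < Real.pi) (hβ : |β.re| < Real.pi) :
    ∃ C > 0, ∃ R : ℝ, ∀ z : ℂ, (z.im = 0 ∨ z.im = -(2 * Real.pi) ∨ R ≤ |z.re|) →
      ‖fermi α z - fermi β z‖ ≤ C * Real.exp (-|z.re|) := by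
  obtain ⟨C, hC, R, h⟩ := fermi_bounds hα
  obtain ⟨C', hC', R', h'⟩ := fermi_bounds hβ
  refine ⟨C + C', by positivity, max R R', fun z hz => ?_⟩
  obtain ⟨-, h1, h2⟩ := h z (hz.imp_right (Or.imp_right (le_trans (le_max_left _ _))))
  obtain ⟨-, h1', h2'⟩ := h' z (hz.imp_right (Or.imp_right (le_trans (le_max_right _ _))))
  rw [add_mul]
  rcases le_total 0 z.re with h0 | h0
  · rw [abs_of_nonneg h0]
    exact (norm_sub_le _ _).trans (add_le_add h1 h1')
  · rw [abs_of_nonpos h0, neg_neg, show fermi α z - fermi β z =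
      (1 - fermi β z) - (1 - fermi α z) by ring, add_comm]
    exact (norm_sub_le _ _).trans (add_le_add h2' h2)

/-! ### Complex powers on a half-plane. -/

/-- The conditions on `L = log a` and `k` under which `w ↦ w ^ k` is continuous on the half-plane
`Re L ≤ Re w` and holomorphic in its interior. -/
def LerchAdmissible (L k : ℂ) : Prop :=
  0 < L.re ∨ (L.re = 0 ∧ 0 < k.re) ∨ ∃ n : ℕ, k = n

theorem LerchAdmissible.mono {L L' k : ℂ} (h : LerchAdmissible L k) (hL : L.re ≤ L'.re) :
    LerchAdmissible L' k := by
  rcases h with h | ⟨h, hk⟩ | h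
  · exact Or.inl (h.trans_le hL)
  · rcases (h ▸ hL).eq_or_lt with h0 | h0
    · exact Or.inr (Or.inl ⟨h0.symm, hk⟩)
    · exact Or.inl h0
  · exact Or.inr (Or.inr h)

theorem LerchAdmissible.continuousOn {L k : ℂ} (h : LerchAdmissible L k) :
    ContinuousOn (fun w : ℂ => w ^ k) {w | L.re ≤ w.re} := by
  rcases h with h | ⟨h, hk⟩ | ⟨n, rfl⟩
  · exact fun w hw => (continuousAt_cpow_const
      (Or.inl (h.trans_le hw))).continuousWithinAt
  · intro w hw
    rw [mem_ofPred_eq, h] at hw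
    refine ContinuousAt.continuousWithinAt ?_
    by_cases h0 : w = 0
    · subst h0
      exact (Complex.continuousAt_cpow_zero_of_re_pos hk).comp
        (f := fun w : ℂ => (w, k)) (by fun_prop)
    · refine continuousAt_cpow_const (Complex.mem_slitPlane_iff.2 ?_)
      rcases hw.eq_or_lt with h1 | h1
      · exact Or.inr fun h2 => h0 (Complex.ext h1.symm h2)
      · exact Or.inl h1
  · simp only [Complex.cpow_natCast]
    fun_prop

theorem LerchAdmissible.differentiableOn {L k : ℂ} (h : LerchAdmissible L k) :
    DifferentiableOn ℂ (fun w : ℂ => w ^ k) {w | L.re < w.re} := by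
  have key : 0 ≤ L.re → DifferentiableOn ℂ (fun w : ℂ => w ^ k) {w | L.re < w.re} := fun h0 w hw =>
    (differentiableAt_id.cpow_const (Or.inl (h0.trans_lt hw))).differentiableWithinAt
  rcases h with h | ⟨h, hk⟩ | ⟨n, rfl⟩
  · exact key h.le
  · exact key h.ge
  · simp only [Complex.cpow_natCast]
    fun_prop

theorem norm_cpow_le_exp_mul_rpow (w k : ℂ) :
    ‖w ^ k‖ ≤ Real.exp (Real.pi * |k.im|) * ‖w‖ ^ k.re := by
  refine (Complex.norm_cpow_le w k).trans ?_
  rw [div_eq_mul_inv, ← Real.exp_neg, mul_comm]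
  gcongr
  calc -(w.arg * k.im) ≤ |w.arg * k.im| := neg_le_abs _
    _ = |w.arg| * |k.im| := abs_mul _ _
    _ ≤ _ := mul_le_mul_of_nonneg_right (Complex.abs_arg_le_pi w) (abs_nonneg _)

theorem exists_rpow_le_exp {p ε : ℝ} (hp : 0 ≤ p) (hε : 0 < ε) :
    ∃ C > 0, ∀ u : ℝ, 0 ≤ u → u ^ p ≤ C * Real.exp (ε * u) := by
  have h := (isLittleO_rpow_exp_pos_mul_atTop p hε).bound one_pos
  obtain ⟨A, hA⟩ := eventually_atTop.1 h
  refine ⟨1 + (max A 0) ^ p, by positivity, fun u hu => ?_⟩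
  have h1 : 1 ≤ Real.exp (ε * u) := Real.one_le_exp (by positivity)
  have h2 : 0 ≤ (max A 0) ^ p := by positivity
  rcases le_total A u with hAu | hAu
  · have := hA u hAu
    rw [one_mul, Real.norm_of_nonneg (by positivity), Real.norm_of_nonneg (by positivity)] at this
    nlinarith
  · have : u ^ p ≤ (max A 0) ^ p := Real.rpow_le_rpow hu (hAu.trans (le_max_left _ _)) hp
    nlinarith

/-- For Re k ≥ 0 a power grows more slowly than any exponential. For Re k < 0 admissibility forces
Re L > 0, which keeps w away from 0. -/
theorem LerchAdmissible.exists_norm_cpow_le {L k : ℂ} (h : LerchAdmissible L k) {ε : ℝ}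
    (hε : 0 < ε) : ∃ C > 0, ∀ w : ℂ, L.re ≤ w.re → ‖w ^ k‖ ≤ C * Real.exp (ε * ‖w‖) := by
  rcases le_or_gt 0 k.re with hk | hk
  · obtain ⟨C, hC, hb⟩ := exists_rpow_le_exp hk hε
    refine ⟨Real.exp (Real.pi * |k.im|) * C, by positivity, fun w _ => ?_⟩
    refine (norm_cpow_le_exp_mul_rpow w k).trans ?_
    rw [mul_assoc]
    gcongr
    exact hb _ (norm_nonneg _)
  · have hL : 0 < L.re := by
      rcases h with h | ⟨-, h⟩ | ⟨n, rfl⟩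
      · exact h
      · exact absurd h hk.not_gt
      · simp at hk; exact absurd hk (Nat.cast_nonneg n).not_gt
    refine ⟨Real.exp (Real.pi * |k.im|) * L.re ^ k.re, by positivity, fun w hw => ?_⟩
    refine (norm_cpow_le_exp_mul_rpow w k).trans ?_
    refine le_trans ?_ (le_mul_of_one_le_right (by positivity)
      (Real.one_le_exp (by positivity)))
    gcongr ?_ * ?_
    exact Real.rpow_le_rpow_of_nonpos hL (hw.trans (Complex.re_le_norm w)) hk.le

/-! ### The integrand of the contour integral and its shift. -/

/-- The function `exp (imz) (L + iz) ^ k`. -/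
noncomputable def expMulCpow (m k L z : ℂ) : ℂ :=
  Complex.exp (Complex.I * m * z) * (L + Complex.I * z) ^ k

/-- This is the source of the Lerch function: one period down costs a factor exp(2πm) and raises the
Lerch parameter by one. -/
theorem expMulCpow_sub_two_pi_I (m k L z : ℂ) :
    expMulCpow m k L (z - 2 * Real.pi * Complex.I) =
      Complex.exp (2 * m * Real.pi) * expMulCpow m k (L + 2 * Real.pi) z := by
  have e1 : Complex.I * m * (z - 2 * Real.pi * Complex.I) =
      2 * m * Real.pi + Complex.I * m * z := by
    linear_combination (-2 * m * Real.pi) * Complex.I_sq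
  have e2 : L + Complex.I * (z - 2 * Real.pi * Complex.I) =
      L + 2 * Real.pi + Complex.I * z := by
    linear_combination (-2 * Real.pi : ℂ) * Complex.I_sq
  rw [expMulCpow, expMulCpow, e1, e2, Complex.exp_add, mul_assoc]

theorem expMulCpow_fermiPole (m k L α : ℂ) :
    expMulCpow m k L (fermiPole α) =
      Complex.exp ((Real.pi - α) * m) * (-α + L + Real.pi) ^ k := by
  have e1 : Complex.I * m * fermiPole α = (Real.pi - α) * m := by
    rw [fermiPole]; linear_combination (m * α - m * Real.pi) * Complex.I_sq
  have e2 : L + Complex.I * fermiPole α = -α + L + Real.pi := by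
    rw [fermiPole]; linear_combination (α - Real.pi) * Complex.I_sq
  rw [expMulCpow, e1, e2]

/-- Moving z down moves the base of the power to the right, so downward shifts stay where the power
is holomorphic. -/
theorem add_I_mul_re (L z : ℂ) : (L + Complex.I * z).re = L.re - z.im := by
  simp [sub_eq_add_neg]

theorem LerchAdmissible.continuousOn_expMulCpow {L k : ℂ} (h : LerchAdmissible L k) (m : ℂ) :
    ContinuousOn (expMulCpow m k L) {z | z.im ≤ 0} := by
  refine ContinuousOn.mul (by fun_prop) (h.continuousOn.comp (by fun_prop) fun z hz => ?_)
  rw [mem_ofPred_eq] at hz ⊢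
  rw [add_I_mul_re]; linarith

theorem LerchAdmissible.differentiableOn_expMulCpow {L k : ℂ} (h : LerchAdmissible L k) (m : ℂ) :
    DifferentiableOn ℂ (expMulCpow m k L) {z | z.im < 0} := by
  refine DifferentiableOn.mul (by fun_prop) (h.differentiableOn.comp (by fun_prop) fun z hz => ?_)
  rw [mem_ofPred_eq] at hz ⊢
  rw [add_I_mul_re]; linarith

theorem LerchAdmissible.continuous_expMulCpow {L k : ℂ} (h : LerchAdmissible L k) (m : ℂ) :
    Continuous fun x : ℝ => expMulCpow m k L x :=
  (h.continuousOn_expMulCpow m).comp_continuous Complex.continuous_ofReal fun x => by simp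

theorem norm_exp_I_mul_mul (m z : ℂ) :
    ‖Complex.exp (Complex.I * m * z)‖ = Real.exp (-(m.im * z.re) - m.re * z.im) := by
  rw [Complex.norm_exp]; simp

/-- The coefficient c allows both uses: c = 0 for a single Fermi function and c = 1 for a
difference. -/
theorem integral_expMulCpow_shift {m k L α β c : ℂ} (hadm : LerchAdmissible L k)
    (hα : |α.re| < Real.pi) (hβ : |β.re| < Real.pi) {B : ℝ → ℝ} (hBi : Integrable B)
    (hB : Tendsto B (cocompact ℝ) (𝓝 0)) {R : ℝ}
    (hbound : ∀ z : ℂ, z.im ∈ Icc (-(2 * Real.pi)) 0 →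
      (z.im = 0 ∨ z.im = -(2 * Real.pi) ∨ R ≤ |z.re|) →
      ‖expMulCpow m k L z * (fermi α z - c * fermi β z)‖ ≤ B z.re) :
    (∫ x : ℝ, expMulCpow m k L x * (fermi α x - c * fermi β x)) -
      Complex.exp (2 * m * Real.pi) *
        ∫ x : ℝ, expMulCpow m k (L + 2 * Real.pi) x * (fermi α x - c * fermi β x) =
      2 * Real.pi * Complex.I * (Complex.exp ((Real.pi - α) * m) * (-α + L + Real.pi) ^ k -
        c * (Complex.exp ((Real.pi - β) * m) * (-β + L + Real.pi) ^ k)) := by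
  have hpi := Real.pi_pos
  have hK : Continuous fun x : ℝ => fermi α x - c * fermi β x :=
    (continuous_fermi hα).sub (continuous_const.mul (continuous_fermi hβ))
  have hadm' : LerchAdmissible (L + 2 * Real.pi) k := hadm.mono (by simp; positivity)
  have h := integral_mul_fermi_sub_shift (h := expMulCpow m k L) (c := c) hα hβ
    ((hadm.continuousOn_expMulCpow m).mono fun z hz => hz.2)
    ((hadm.differentiableOn_expMulCpow m).mono fun z hz => hz.2) ?_ ?_ hB ?_
  · simp only [expMulCpow_sub_two_pi_I, mul_assoc (Complex.exp _), integral_const_mul,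
      expMulCpow_fermiPole] at h ⊢
    exact h
  · refine hBi.mono' ((hadm.continuous_expMulCpow m).mul hK).aestronglyMeasurable
      (ae_of_all _ fun x => ?_)
    simpa using hbound x (by simp; positivity) (by simp)
  · refine hBi.mono' ?_ (ae_of_all _ fun x => ?_)
    · simp only [expMulCpow_sub_two_pi_I]
      exact ((continuous_const.mul (hadm'.continuous_expMulCpow m)).mul hK).aestronglyMeasurable
    · have := hbound (x - 2 * Real.pi * Complex.I) (by simp; positivity) (by simp)
      rw [fermi_sub_two_pi_I, fermi_sub_two_pi_I] at this
      simpa using this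
  · have hfar : ∀ᶠ x : ℝ in cocompact ℝ, R ≤ |x| :=
      (tendsto_norm_cocompact_atTop (E := ℝ)).eventually_ge_atTop R
    filter_upwards [hfar] with x hx y hy
    simpa using hbound (x + y * Complex.I) (by simpa using hy) (by simp [hx])

/-- Uniformity in t is needed to control the remainder after n shifts, where t = 2πn; the loss
exp(εt) can be made smaller than the gain from |z|^n. -/
theorem LerchAdmissible.exists_norm_expMulCpow_le {L k : ℂ} (h : LerchAdmissible L k) (m : ℂ)
    {ε : ℝ} (hε : 0 < ε) : ∃ C > 0, ∀ t : ℝ, 0 ≤ t → ∀ z : ℂ, z.im ∈ Icc (-(2 * Real.pi)) 0 →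
      ‖expMulCpow m k (L + t) z‖ ≤
        C * Real.exp (ε * t) * Real.exp (-(m.im * z.re) + ε * |z.re|) := by
  obtain ⟨C, hC, hb⟩ := h.exists_norm_cpow_le hε
  refine ⟨C * Real.exp (ε * (‖L‖ + 2 * Real.pi)) * Real.exp (2 * Real.pi * |m.re|),
    by positivity, fun t ht z hz => ?_⟩
  have him : |z.im| ≤ 2 * Real.pi := abs_le.2 ⟨hz.1, hz.2.trans (by positivity)⟩
  have h1 := hb (L + t + Complex.I * z) (by
    rw [add_I_mul_re, Complex.add_re, Complex.ofReal_re]; linarith [hz.2])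
  have h2 : ‖L + t + Complex.I * z‖ ≤ ‖L‖ + t + (|z.re| + 2 * Real.pi) := by
    refine (norm_add_le _ _).trans (add_le_add ((norm_add_le _ _).trans_eq ?_) ?_)
    · rw [Complex.norm_real, Real.norm_of_nonneg ht]
    · rw [norm_mul, Complex.norm_I, one_mul]
      exact (Complex.norm_le_abs_re_add_abs_im z).trans (by gcongr)
  have h3 : -(m.re * z.im) ≤ 2 * Real.pi * |m.re| := by
    calc -(m.re * z.im) ≤ |m.re * z.im| := neg_le_abs _
      _ = |m.re| * |z.im| := abs_mul _ _
      _ ≤ |m.re| * (2 * Real.pi) := by gcongr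
      _ = _ := mul_comm _ _
  rw [expMulCpow, norm_mul, norm_exp_I_mul_mul]
  calc Real.exp (-(m.im * z.re) - m.re * z.im) * ‖(L + t + Complex.I * z) ^ k‖
      ≤ Real.exp (-(m.im * z.re) + 2 * Real.pi * |m.re|) *
        (C * Real.exp (ε * (‖L‖ + t + (|z.re| + 2 * Real.pi)))) := by
        gcongr
        · linarith
        · exact h1.trans (by gcongr)
    _ = _ := by
      rw [show ε * (‖L‖ + t + (|z.re| + 2 * Real.pi)) =
        ε * (‖L‖ + 2 * Real.pi) + ε * t + ε * |z.re| by ring]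
      simp only [Real.exp_add]; ring

theorem expMulCpow_mul_fermi_sub_bound {L k m α β : ℂ} (h : LerchAdmissible L k)
    (hm : |m.im| < 1) (hα : |α.re| < Real.pi) (hβ : |β.re| < Real.pi) :
    ∃ δ > 0, ∃ C > 0, ∃ R : ℝ, ∀ z : ℂ, z.im ∈ Icc (-(2 * Real.pi)) 0 →
      (z.im = 0 ∨ z.im = -(2 * Real.pi) ∨ R ≤ |z.re|) →
      ‖expMulCpow m k L z * (fermi α z - fermi β z)‖ ≤ C * Real.exp (-(δ * |z.re|)) := by
  -- One δ absorbs the growth of the power, the other is the decay that remains.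
  obtain ⟨δ, hδ, hδm⟩ : ∃ δ > 0, |m.im| + 2 * δ = 1 := ⟨(1 - |m.im|) / 2, by linarith, by ring⟩
  obtain ⟨C, hC, hb⟩ := h.exists_norm_expMulCpow_le m hδ
  obtain ⟨C', hC', R, hb'⟩ := fermi_sub_fermi_bound hα hβ
  refine ⟨δ, hδ, C * C', by positivity, R, fun z hz hz' => ?_⟩
  have h1 := hb 0 le_rfl z hz
  simp only [Complex.ofReal_zero, add_zero, mul_zero, Real.exp_zero, mul_one] at h1
  rw [norm_mul]
  refine (mul_le_mul h1 (hb' z hz') (norm_nonneg _) (by positivity)).trans ?_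
  have e : C * Real.exp (-(m.im * z.re) + δ * |z.re|) * (C' * Real.exp (-|z.re|)) =
      C * C' * Real.exp (-(m.im * z.re) + δ * |z.re| + -|z.re|) := by
    rw [Real.exp_add (-(m.im * z.re) + δ * |z.re|)]; ring
  rw [e]
  · gcongr
    have : -(m.im * z.re) ≤ |m.im| * |z.re| := by rw [← abs_mul]; exact neg_le_abs _
    nlinarith [abs_nonneg z.re]

/-- A single Fermi function decays only at +∞, where it must beat exp(imx), hence Im m > -1; at -∞
the decay must come from exp(imx), hence Im m < 0. -/
theorem expMulCpow_mul_fermi_bound {L k m α : ℂ} (h : LerchAdmissible L k)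
    (hm : -1 < m.im) (hm' : m.im < 0) (hα : |α.re| < Real.pi) {ε : ℝ} (hε : 0 < ε) :
    ∃ δ > 0, ∃ C > 0, ∃ R : ℝ, ∀ t : ℝ, 0 ≤ t → ∀ z : ℂ, z.im ∈ Icc (-(2 * Real.pi)) 0 →
      (z.im = 0 ∨ z.im = -(2 * Real.pi) ∨ R ≤ |z.re|) →
      ‖expMulCpow m k (L + t) z * fermi α z‖ ≤
        C * Real.exp (ε * t) * Real.exp (-(δ * |z.re|)) := by
  obtain ⟨δ, hδ, hδ1, hδ2, hδε⟩ : ∃ δ > 0, 2 * δ ≤ -m.im ∧ 2 * δ ≤ 1 + m.im ∧ δ ≤ ε :=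
    ⟨min (min (-m.im) (1 + m.im) / 2) ε, lt_min (half_pos (lt_min (by linarith) (by linarith))) hε,
      by linarith [min_le_left (min (-m.im) (1 + m.im) / 2) ε, min_le_left (-m.im) (1 + m.im)],
      by linarith [min_le_left (min (-m.im) (1 + m.im) / 2) ε, min_le_right (-m.im) (1 + m.im)],
      min_le_right _ _⟩
  obtain ⟨C, hC, hb⟩ := h.exists_norm_expMulCpow_le m hδ
  obtain ⟨C', hC', R, hb'⟩ := fermi_bounds hα
  refine ⟨δ, hδ, C * C', by positivity, R, fun t ht z hz hz' => ?_⟩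
  have h1 := hb t ht z hz
  obtain ⟨h2, h3, -⟩ := hb' z hz'
  have hε : Real.exp (δ * t) ≤ Real.exp (ε * t) := by gcongr
  have key : ∀ u, ‖fermi α z‖ ≤ C' * Real.exp u →
      -(m.im * z.re) + δ * |z.re| + u ≤ -(δ * |z.re|) →
      ‖expMulCpow m k (L + t) z * fermi α z‖ ≤
        C * C' * Real.exp (ε * t) * Real.exp (-(δ * |z.re|)) := fun u hu hu' => by
    rw [norm_mul]
    calc _ ≤ C * Real.exp (δ * t) * Real.exp (-(m.im * z.re) + δ * |z.re|) *
          (C' * Real.exp u) := mul_le_mul h1 hu (norm_nonneg _) (by positivity)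
      _ = C * C' * Real.exp (δ * t) * Real.exp (-(m.im * z.re) + δ * |z.re| + u) := by
          rw [Real.exp_add (-(m.im * z.re) + δ * |z.re|)]; ring
      _ ≤ _ := by gcongr
  rcases le_total 0 z.re with h0 | h0
  · refine key _ h3 ?_
    rw [abs_of_nonneg h0]; nlinarith
  · refine key 0 (by simpa using h2) ?_
    rw [abs_of_nonpos h0]; nlinarith

theorem exists_pos_mul_one_add_abs_le_add_I_mul {L : ℂ} (hL : 0 < L.re) :
    ∃ c > 0, ∀ t : ℝ, 0 ≤ t → ∀ z : ℂ, z.im ≤ 0 → c * (1 + |z.re|) ≤ ‖L + t + Complex.I * z‖ := by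
  obtain ⟨c, hc, h⟩ := exists_pos_mul_one_add_abs_le (p := Complex.I * L) (by simpa using hL.ne')
  refine ⟨c, hc, fun t ht z hz => (h z.re).trans ?_⟩
  refine le_of_sq_le_sq ?_ (norm_nonneg _)
  simp only [Complex.sq_norm, Complex.normSq_apply]
  simp
  nlinarith

/-- At m = 0 only the algebraic decay of the power is left at -∞; it becomes integrable once Re k <
-1. -/
theorem cpow_mul_fermi_bound {L k α : ℂ} (hL : 0 < L.re) (hk : k.re ≤ 0)
    (hα : |α.re| < Real.pi) :
    ∃ C > 0, ∃ R : ℝ, ∀ t : ℝ, 0 ≤ t → ∀ z : ℂ, z.im ∈ Icc (-(2 * Real.pi)) 0 →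
      (z.im = 0 ∨ z.im = -(2 * Real.pi) ∨ R ≤ |z.re|) →
      ‖expMulCpow 0 k (L + t) z * fermi α z‖ ≤ C * (1 + |z.re|) ^ k.re := by
  obtain ⟨c, hc, h⟩ := exists_pos_mul_one_add_abs_le_add_I_mul hL
  obtain ⟨C', hC', R, hb'⟩ := fermi_bounds hα
  refine ⟨Real.exp (Real.pi * |k.im|) * c ^ k.re * C', by positivity, R, fun t ht z hz hz' => ?_⟩
  have h1 : ‖expMulCpow 0 k (L + t) z‖ ≤
      Real.exp (Real.pi * |k.im|) * (c * (1 + |z.re|)) ^ k.re := by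
    simp only [expMulCpow, mul_zero, zero_mul, Complex.exp_zero, one_mul]
    refine (norm_cpow_le_exp_mul_rpow _ _).trans ?_
    gcongr ?_ * ?_
    exact Real.rpow_le_rpow_of_nonpos (by positivity) (h t ht z hz.2) hk
  rw [Real.mul_rpow hc.le (by positivity)] at h1
  rw [norm_mul]
  refine (mul_le_mul h1 (hb' z hz').1 (norm_nonneg _) (by positivity)).trans_eq ?_
  ring

theorem tendsto_one_add_abs_rpow_cocompact {p : ℝ} (hp : p < 0) :
    Tendsto (fun x : ℝ => (1 + |x|) ^ p) (cocompact ℝ) (𝓝 0) := by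
  have h : Tendsto (fun x : ℝ => 1 + |x|) (cocompact ℝ) atTop :=
    tendsto_atTop_add_const_left _ _ (tendsto_norm_cocompact_atTop (E := ℝ))
  have := (tendsto_rpow_neg_atTop (neg_pos.2 hp)).comp h
  rw [neg_neg] at this
  exact this

theorem integrable_one_add_abs_rpow {p : ℝ} (hp : p < -1) :
    Integrable fun x : ℝ => (1 + |x|) ^ p := by
  have := integrable_one_add_norm (E := ℝ) (μ := volume) (r := -p) (by simp; linarith)
  simpa using this

/-! ### The Lerch series -/

/-- The parameter of the Lerch function attached to `L = log a` and `α`. -/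
noncomputable def lerchParam (L α : ℂ) : ℂ := (-α + L + Real.pi) / (2 * Real.pi)

theorem two_pi_mul_lerchParam_add (L α : ℂ) (n : ℂ) :
    ((2 * Real.pi : ℝ) : ℂ) * (lerchParam L α + n) = -α + (L + 2 * Real.pi * n) + Real.pi := by
  have : (Real.pi : ℂ) ≠ 0 := Complex.ofReal_ne_zero.2 Real.pi_ne_zero
  rw [lerchParam]; push_cast; field_simp; ring

theorem lerchParam_add_one (L α : ℂ) : lerchParam (L + 2 * Real.pi) α = lerchParam L α + 1 := by
  have : (Real.pi : ℂ) ≠ 0 := Complex.ofReal_ne_zero.2 Real.pi_ne_zero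
  rw [lerchParam, lerchParam]; field_simp; ring

theorem lerchParam_re (L α : ℂ) :
    (lerchParam L α).re = (-α.re + L.re + Real.pi) / (2 * Real.pi) := by
  rw [lerchParam, show (2 * Real.pi : ℂ) = ((2 * Real.pi : ℝ) : ℂ) by push_cast; rfl,
    Complex.div_ofReal_re]
  simp

theorem lerchParam_re_pos {L α : ℂ} (hL : 0 ≤ L.re) (hα : |α.re| < Real.pi) :
    0 < (lerchParam L α).re := by
  rw [lerchParam_re]
  have := (abs_lt.1 hα).2
  exact div_pos (by linarith) Real.two_pi_pos

theorem ofReal_mul_cpow {r : ℝ} (hr : 0 < r) {k : ℂ} (hk : k ≠ 0) (w : ℂ) :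
    ((r : ℂ) * w) ^ k = (r : ℂ) ^ k * w ^ k := by
  have hr' : (r : ℂ) ≠ 0 := Complex.ofReal_ne_zero.2 hr.ne'
  by_cases hw : w = 0
  · simp [hw, Complex.zero_cpow hk]
  · rw [Complex.cpow_def_of_ne_zero (mul_ne_zero hr' hw), Complex.cpow_def_of_ne_zero hr',
      Complex.cpow_def_of_ne_zero hw, Complex.log_ofReal_mul hr hw, Complex.ofReal_log hr.le,
      add_mul, Complex.exp_add]

theorem add_pi_cpow_eq {k : ℂ} (hk : k ≠ 0) (L α n : ℂ) :
    (-α + (L + 2 * Real.pi * n) + Real.pi) ^ k =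
      (2 * Real.pi : ℂ) ^ k * (lerchParam L α + n) ^ k := by
  rw [← two_pi_mul_lerchParam_add, ofReal_mul_cpow Real.two_pi_pos hk]
  push_cast; rfl

theorem div_cpow_neg (u w k : ℂ) : u / w ^ (-k) = u * w ^ k := by
  rw [Complex.cpow_neg, div_inv_eq_mul]

theorem summable_lerch {b k z : ℂ} (h : LerchAdmissible b k) (hz : ‖z‖ < 1) :
    Summable fun n : ℕ => z ^ n / (b + n) ^ (-k) := by
  -- A ratio strictly between ‖z‖ and 1: with ε = -log r the power costs a factor r⁻¹ per term, and
  -- ‖z‖ r⁻¹ < 1.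
  set r := (1 + ‖z‖) / 2 with hr
  have hz0 := norm_nonneg z
  have hr0 : 0 < r := by linarith
  have hε : 0 < -Real.log r := neg_pos.2 (Real.log_neg hr0 (by linarith))
  obtain ⟨C, hC, hb⟩ := h.exists_norm_cpow_le hε
  have hg : Summable fun n : ℕ => C * Real.exp (-Real.log r * ‖b‖) * (‖z‖ * r⁻¹) ^ n := by
    refine (summable_geometric_of_lt_one (by positivity) ?_).mul_left _
    rw [← div_eq_mul_inv, div_lt_one hr0]; linarith
  refine hg.of_norm_bounded fun n => ?_
  rw [div_cpow_neg, norm_mul, norm_pow]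
  have h1 := hb (b + n) (by simp)
  have h2 : ‖b + n‖ ≤ ‖b‖ + n := (norm_add_le _ _).trans_eq (by simp)
  have h3 : Real.exp (-Real.log r * n) = r⁻¹ ^ n := by
    rw [mul_comm, Real.exp_nat_mul, Real.exp_neg, Real.exp_log hr0]
  calc ‖z‖ ^ n * ‖(b + n) ^ k‖ ≤ ‖z‖ ^ n * (C * Real.exp (-Real.log r * (‖b‖ + n))) := by
        gcongr
        exact h1.trans (by gcongr)
    _ = _ := by rw [mul_add, Real.exp_add, h3, mul_pow]; ring

theorem summable_hurwitz (b : ℂ) {s : ℂ} (hs : 1 < s.re) :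
    Summable fun n : ℕ => 1 / (b + n) ^ s := by
  have key : ∀ b : ℂ, 0 < b.re → Summable fun n : ℕ => 1 / (b + n) ^ s := by
    intro b hb
    set c := min b.re 1
    have hc : 0 < c := lt_min hb one_pos
    have hg : Summable fun n : ℕ =>
        Real.exp (Real.pi * |s.im|) * c ^ (-s.re) * ((n + 1 : ℕ) : ℝ) ^ (-s.re) :=
      ((summable_nat_add_iff 1).2 (Real.summable_nat_rpow.2 (by linarith))).mul_left _
    refine hg.of_norm_bounded fun n => ?_
    have e : 1 / (b + n) ^ s = (b + n) ^ (-s) := by rw [Complex.cpow_neg, one_div]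
    rw [e]
    refine (norm_cpow_le_exp_mul_rpow _ _).trans ?_
    rw [Complex.neg_im, abs_neg, Complex.neg_re, mul_assoc,
      ← Real.mul_rpow hc.le (by positivity)]
    gcongr ?_ * ?_
    refine Real.rpow_le_rpow_of_nonpos (by positivity) ?_ (by linarith)
    refine le_trans ?_ (Complex.re_le_norm _)
    simp only [Complex.add_re, Complex.natCast_re]
    push_cast
    nlinarith [min_le_left b.re 1, min_le_right b.re 1, Nat.cast_nonneg (α := ℝ) n]
  -- For arbitrary b, dropping N terms moves the parameter into the right half-plane.
  obtain ⟨N, hN⟩ := exists_nat_gt (-b.re)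
  rw [← summable_nat_add_iff N]
  refine (key (b + N) (by simp; linarith)).congr fun n => ?_
  push_cast
  rw [add_assoc, add_comm (N : ℂ)]

theorem tsum_eq_of_telescope {z : ℂ} {a I : ℕ → ℂ} (h : ∀ n, I n - z * I (n + 1) = a n)
    (hs : Summable fun n => z ^ n * a n) (hI : Tendsto (fun n => z ^ n * I n) atTop (𝓝 0)) :
    ∑' n, z ^ n * a n = I 0 := by
  have hsum : ∀ N, ∑ n ∈ Finset.range N, z ^ n * a n = I 0 - z ^ N * I N := by
    intro N
    induction N with
    | zero => simp
    | succ N ih => rw [Finset.sum_range_succ, ih, ← h]; ring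
  have h1 := hs.hasSum.tendsto_sum_nat
  simp only [hsum] at h1
  refine tendsto_nhds_unique h1 ?_
  simpa using hI.const_sub (I 0)

/-- The Lerch series as a line integral, provided that the shift and the remainder are under
control. -/
theorem lerch_series_eq_integral {m k L α : ℂ} (hk : k ≠ 0)
    (hshift : ∀ n : ℕ, (∫ x : ℝ, expMulCpow m k (L + 2 * Real.pi * n) x * fermi α x) -
      Complex.exp (2 * m * Real.pi) *
        ∫ x : ℝ, expMulCpow m k (L + 2 * Real.pi * n + 2 * Real.pi) x * fermi α x =
      2 * Real.pi * Complex.I * (Complex.exp ((Real.pi - α) * m) *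
        (-α + (L + 2 * Real.pi * n) + Real.pi) ^ k))
    (hsum : Summable fun n : ℕ =>
      Complex.exp (2 * m * Real.pi) ^ n / (lerchParam L α + n) ^ (-k))
    (hrem : Tendsto (fun n : ℕ => Complex.exp (2 * m * Real.pi) ^ n *
      ∫ x : ℝ, expMulCpow m k (L + 2 * Real.pi * n) x * fermi α x) atTop (𝓝 0)) :
    (2 * Real.pi : ℂ) ^ (k + 1) * (Complex.exp ((Real.pi - α) * m) *
      ∑' n : ℕ, Complex.exp (2 * m * Real.pi) ^ n / (lerchParam L α + n) ^ (-k)) =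
      -Complex.I * ∫ x : ℝ, expMulCpow m k L x * fermi α x := by
  have hpi : (2 * Real.pi : ℂ) ≠ 0 := by exact_mod_cast Real.two_pi_pos.ne'
  set c := 2 * Real.pi * Complex.I * Complex.exp ((Real.pi - α) * m) * (2 * Real.pi : ℂ) ^ k with hc
  have e : ∀ n : ℕ, Complex.exp (2 * m * Real.pi) ^ n *
      (2 * Real.pi * Complex.I * (Complex.exp ((Real.pi - α) * m) *
        (-α + (L + 2 * Real.pi * n) + Real.pi) ^ k)) =
      c * (Complex.exp (2 * m * Real.pi) ^ n / (lerchParam L α + n) ^ (-k)) := fun n => by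
    rw [add_pi_cpow_eq hk, div_cpow_neg, hc]; ring
  have h := tsum_eq_of_telescope
    (I := fun n : ℕ => ∫ x : ℝ, expMulCpow m k (L + 2 * Real.pi * n) x * fermi α x)
    (a := fun n : ℕ => 2 * Real.pi * Complex.I * (Complex.exp ((Real.pi - α) * m) *
        (-α + (L + 2 * Real.pi * n) + Real.pi) ^ k)) (z := Complex.exp (2 * m * Real.pi))
    (fun n => ?_) ?_ hrem
  · simp only [e, tsum_mul_left, Nat.cast_zero, mul_zero, add_zero] at h
    rw [← h, hc, Complex.cpow_add _ _ hpi, Complex.cpow_one]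
    linear_combination ((2 * Real.pi : ℂ) ^ k * (2 * Real.pi) *
      Complex.exp ((Real.pi - α) * m) * ∑' n : ℕ, Complex.exp (2 * m * Real.pi) ^ n /
      (lerchParam L α + n) ^ (-k)) * Complex.I_sq
  · rw [← hshift n]; push_cast; ring_nf
  · simp only [e]; exact hsum.mul_left c

theorem expMulCpow_fermi_shift {m k L α : ℂ} (hadm : LerchAdmissible L k)
    (hα : |α.re| < Real.pi) {B : ℝ → ℝ} (hBi : Integrable B)
    (hB : Tendsto B (cocompact ℝ) (𝓝 0)) {R : ℝ}
    (hbound : ∀ z : ℂ, z.im ∈ Icc (-(2 * Real.pi)) 0 →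
      (z.im = 0 ∨ z.im = -(2 * Real.pi) ∨ R ≤ |z.re|) →
      ‖expMulCpow m k L z * fermi α z‖ ≤ B z.re) :
    (∫ x : ℝ, expMulCpow m k L x * fermi α x) - Complex.exp (2 * m * Real.pi) *
        ∫ x : ℝ, expMulCpow m k (L + 2 * Real.pi) x * fermi α x =
      2 * Real.pi * Complex.I *
        (Complex.exp ((Real.pi - α) * m) * (-α + L + Real.pi) ^ k) := by
  have := integral_expMulCpow_shift (m := m) (c := 0) (β := α) hadm hα hα hBi hB (R := R)
    (by simpa only [zero_mul, sub_zero] using hbound)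
  simpa only [zero_mul, sub_zero] using this

theorem exp_two_mul_pi_norm (m : ℂ) :
    ‖Complex.exp (2 * m * Real.pi)‖ = Real.exp (2 * Real.pi * m.re) := by
  rw [Complex.norm_exp]; simp; ring_nf

theorem lerch_series_of_re_neg {m k L α : ℂ} (hk : k ≠ 0) (hL : 0 < L.re)
    (hα : |α.re| < Real.pi) (hm : -1 < m.im) (hm' : m.im < 0) (hre : m.re < 0) :
    (2 * Real.pi : ℂ) ^ (k + 1) * (Complex.exp ((Real.pi - α) * m) *
      ∑' n : ℕ, Complex.exp (2 * m * Real.pi) ^ n / (lerchParam L α + n) ^ (-k)) =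
      -Complex.I * ∫ x : ℝ, expMulCpow m k L x * fermi α x := by
  have hadm : LerchAdmissible L k := Or.inl hL
  -- For this ε the n-th integral is O(exp(-πn Re m)), while |z|^n = exp(2πn Re m); the product
  -- exp(πn Re m) tends to 0.
  obtain ⟨δ, hδ, C, hC, R, hb⟩ := expMulCpow_mul_fermi_bound hadm hm hm' hα
    (ε := -m.re / 2) (by linarith)
  have hB : ∀ D : ℝ, Integrable (fun x : ℝ => D * Real.exp (-(δ * |x|))) :=
    fun D => (integrable_exp_neg_mul_abs hδ).const_mul _
  have hBt : ∀ D : ℝ, Tendsto (fun x : ℝ => D * Real.exp (-(δ * |x|))) (cocompact ℝ) (𝓝 0) :=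
    fun D => by simpa only [mul_zero] using (tendsto_exp_neg_mul_abs_cocompact hδ).const_mul D
  have hcast : ∀ n : ℕ, L + 2 * Real.pi * n = L + ((2 * Real.pi * n : ℝ) : ℂ) := fun n => by
    push_cast; rfl
  have hpos : ∀ n : ℕ, 0 ≤ 2 * Real.pi * n := fun n => by positivity
  refine lerch_series_eq_integral hk (fun n => ?_) (summable_lerch
    (Or.inl (lerchParam_re_pos hL.le hα)) ?_) ?_
  · refine expMulCpow_fermi_shift (hadm.mono ?_) hα
      (hB (C * Real.exp (-m.re / 2 * (2 * Real.pi * n)))) (hBt _) (R := R) ?_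
    · rw [hcast, Complex.add_re, Complex.ofReal_re]; linarith [hpos n]
    · rw [hcast]; exact hb _ (hpos n)
  · rw [exp_two_mul_pi_norm, Real.exp_lt_one_iff]
    nlinarith [Real.pi_pos]
  · have hlim : Tendsto (fun n : ℕ => C * (∫ x : ℝ, Real.exp (-(δ * |x|))) *
        Real.exp (Real.pi * m.re) ^ n) atTop (𝓝 0) := by
      have := tendsto_pow_atTop_nhds_zero_of_lt_one (Real.exp_pos (Real.pi * m.re)).le
        (Real.exp_lt_one_iff.2 (by nlinarith [Real.pi_pos]))
      simpa using this.const_mul (C * ∫ x : ℝ, Real.exp (-(δ * |x|)))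
    refine squeeze_zero_norm (fun n => ?_) hlim
    have h1 : ‖∫ x : ℝ, expMulCpow m k (L + 2 * Real.pi * n) x * fermi α x‖ ≤
        ∫ x : ℝ, C * Real.exp (-m.re / 2 * (2 * Real.pi * n)) * Real.exp (-(δ * |x|)) := by
      refine norm_integral_le_of_norm_le (hB _) (ae_of_all _ fun x => ?_)
      rw [hcast]
      simpa using hb _ (hpos n) x (by simp; positivity) (by simp)
    rw [integral_const_mul] at h1
    rw [norm_mul, norm_pow, exp_two_mul_pi_norm]
    refine (mul_le_mul_of_nonneg_left h1 (by positivity)).trans_eq ?_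
    rw [← Real.exp_nat_mul, ← Real.exp_nat_mul]
    rw [show (n : ℝ) * (Real.pi * m.re) = n * (2 * Real.pi * m.re) +
      -m.re / 2 * (2 * Real.pi * n) by ring, Real.exp_add]
    ring

/-- At z = 1 there is no geometric factor. The remainder vanishes by dominated convergence, because
(L + 2πn + ix)^k tends to 0 pointwise. -/
theorem hurwitz_series_eq_integral {k L α : ℂ} (hL : 0 < L.re)
    (hα : |α.re| < Real.pi) (hk : k.re < -1) :
    (2 * Real.pi : ℂ) ^ (k + 1) * ∑' n : ℕ, 1 / (lerchParam L α + n) ^ (-k) =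
      -Complex.I * ∫ x : ℝ, expMulCpow 0 k L x * fermi α x := by
  have hadm : LerchAdmissible L k := Or.inl hL
  have hk0 : k ≠ 0 := by rintro rfl; norm_num at hk
  obtain ⟨C, hC, R, hb⟩ := cpow_mul_fermi_bound hL (k := k) (by linarith) hα
  have hB : Integrable (fun x : ℝ => C * (1 + |x|) ^ k.re) :=
    (integrable_one_add_abs_rpow hk).const_mul _
  have hcast : ∀ n : ℕ, L + 2 * Real.pi * n = L + ((2 * Real.pi * n : ℝ) : ℂ) := fun n => by
    push_cast; rfl
  have hpos : ∀ n : ℕ, 0 ≤ 2 * Real.pi * n := fun n => by positivity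
  have hadmn : ∀ n : ℕ, LerchAdmissible (L + 2 * Real.pi * n) k := fun n => hadm.mono (by
    rw [hcast, Complex.add_re, Complex.ofReal_re]; linarith [hpos n])
  have := lerch_series_eq_integral (m := 0) (L := L) (α := α) hk0 (fun n => ?_) ?_ ?_
  · simpa using this
  · refine expMulCpow_fermi_shift (hadmn n) hα hB (R := R) (by
      simpa only [mul_zero] using (tendsto_one_add_abs_rpow_cocompact (by linarith)).const_mul C) ?_
    · rw [hcast]; exact hb _ (hpos n)
  · simpa using summable_hurwitz (lerchParam L α) (s := -k) (by simp; linarith)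
  · simp only [mul_zero, zero_mul, Complex.exp_zero, one_pow, one_mul]
    have hz : Tendsto (fun n : ℕ => ∫ x : ℝ, expMulCpow 0 k (L + 2 * Real.pi * n) x * fermi α x)
        atTop (𝓝 (∫ _ : ℝ, (0 : ℂ))) := ?_
    · simpa using hz
    refine tendsto_integral_of_dominated_convergence _ (fun n => ?_) hB (fun n =>
      ae_of_all _ fun x => ?_) (ae_of_all _ fun x => ?_)
    · exact (((hadmn n).continuous_expMulCpow 0).mul (continuous_fermi hα)).aestronglyMeasurable
    · rw [hcast]
      simpa using hb _ (hpos n) x (by simp; positivity) (by simp)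
    · rw [← zero_mul (fermi α x)]
      refine Tendsto.mul_const _ ?_
      simp only [expMulCpow, mul_zero, zero_mul, Complex.exp_zero, one_mul]
      have hlim : Tendsto (fun n : ℕ => Real.exp (Real.pi * |k.im|) * (2 * Real.pi * n) ^ k.re)
          atTop (𝓝 0) := by
        have h1 : Tendsto (fun n : ℕ => 2 * Real.pi * (n : ℝ)) atTop atTop :=
          tendsto_natCast_atTop_atTop.const_mul_atTop Real.two_pi_pos
        have := (tendsto_rpow_neg_atTop (show 0 < -k.re by linarith)).comp h1
        simpa using this.const_mul (Real.exp (Real.pi * |k.im|))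
      refine squeeze_zero_norm' ?_ hlim
      filter_upwards [eventually_gt_atTop 0] with n hn
      refine (norm_cpow_le_exp_mul_rpow _ _).trans ?_
      gcongr ?_ * ?_
      have : (0 : ℝ) < n := by exact_mod_cast hn
      refine Real.rpow_le_rpow_of_nonpos (by positivity) ?_ (by linarith)
      refine le_trans ?_ (Complex.re_le_norm _)
      rw [add_I_mul_re, hcast, Complex.add_re, Complex.ofReal_re, Complex.ofReal_im]
      linarith

/-! ### The cut plane and analytic continuation -/

theorem isOpen_lerchCutPlane : IsOpen lerchCutPlane := by
  have : IsClosed {z : ℂ | 1 ≤ z.re ∧ z.im = 0} :=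
    (isClosed_le continuous_const Complex.continuous_re).inter
      (isClosed_eq Complex.continuous_im continuous_const)
  exact this.isOpen_compl

theorem mem_lerchCutPlane_of_norm_lt_one {z : ℂ} (hz : ‖z‖ < 1) : z ∈ lerchCutPlane :=
  fun h => by linarith [h.1, Complex.re_le_norm z]

/-- The cut plane is star-shaped about 0. -/
theorem isPreconnected_lerchCutPlane : IsPreconnected lerchCutPlane := by
  have h0 : (0 : ℂ) ∈ lerchCutPlane := mem_lerchCutPlane_of_norm_lt_one (by simp)
  have : StarConvex ℝ (0 : ℂ) lerchCutPlane := by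
    rw [starConvex_zero_iff]
    intro z hz t ht ht1 h
    refine hz ?_
    simp only [Complex.real_smul, Complex.mul_re, Complex.ofReal_re, Complex.ofReal_im, zero_mul,
      sub_zero, Complex.mul_im, add_zero] at h
    rcases ht.eq_or_lt with rfl | ht0
    · norm_num at h
    · exact ⟨by nlinarith [h.1], (mul_eq_zero.1 h.2).resolve_left ht0.ne'⟩
  exact (this.isPathConnected h0).isConnected.isPreconnected

theorem IsLerchContinuation.eqOn {s b : ℂ} {F G : ℂ → ℂ} (hF : IsLerchContinuation s b F)
    (hG : IsLerchContinuation s b G) : EqOn F G lerchCutPlane := by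
  refine (hF.1.analyticOnNhd isOpen_lerchCutPlane).eqOn_of_preconnected_of_eventuallyEq
    (hG.1.analyticOnNhd isOpen_lerchCutPlane) isPreconnected_lerchCutPlane
    (mem_lerchCutPlane_of_norm_lt_one (z := 0) (by simp)) ?_
  filter_upwards [Metric.ball_mem_nhds (0 : ℂ) one_pos] with z hz
  rw [mem_ball_zero_iff] at hz
  rw [hF.2 z hz, hG.2 z hz]

/-- The chosen branch is meaningful as soon as some continuation exists; uniqueness then identifies
it with any explicit one. -/
theorem IsLerchContinuation.lerchPrincipal {s b : ℂ} {F : ℂ → ℂ}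
    (hF : IsLerchContinuation s b F) : IsLerchContinuation s b (lerchPrincipal s b) :=
  Classical.epsilon_spec (p := IsLerchContinuation s b) ⟨F, hF⟩

theorem IsHurwitzContinuation.eqOn {b : ℂ} {F G : ℂ → ℂ} (hF : IsHurwitzContinuation b F)
    (hG : IsHurwitzContinuation b G) : EqOn F G {1}ᶜ := by
  have hO : IsOpen ({1}ᶜ : Set ℂ) := isOpen_compl_singleton
  refine (hF.1.analyticOnNhd hO).eqOn_of_preconnected_of_eventuallyEq
    (hG.1.analyticOnNhd hO) (isConnected_compl_singleton_of_one_lt_rank (by simp) 1).isPreconnected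
    (z₀ := 2) (by simp) ?_
  have : {s : ℂ | 1 < s.re} ∈ 𝓝 (2 : ℂ) :=
    (isOpen_lt continuous_const Complex.continuous_re).mem_nhds (by simp)
  filter_upwards [this] with s hs
  rw [hF.2 s hs, hG.2 s hs]

theorem IsHurwitzContinuation.hurwitzZetaC {b : ℂ} {G : ℂ → ℂ}
    (hG : IsHurwitzContinuation b G) : IsHurwitzContinuation b (fun s => hurwitzZetaC s b) :=
  Classical.epsilon_spec (p := IsHurwitzContinuation b) ⟨G, hG⟩

/-! ### Integrals over the real line depending on `m` -/

theorem LerchAdmissible.exists_norm_expMulCpow_real_le {L k : ℂ} (h : LerchAdmissible L k)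
    {ε : ℝ} (hε : 0 < ε) : ∃ C > 0, ∀ (m : ℂ) (x : ℝ),
      ‖expMulCpow m k L x‖ ≤ C * Real.exp (-(m.im * x) + ε * |x|) := by
  obtain ⟨C, hC, hb⟩ := h.exists_norm_cpow_le hε
  refine ⟨C * Real.exp (ε * ‖L‖), by positivity, fun m x => ?_⟩
  have h1 := hb (L + Complex.I * x) (by simp)
  have h2 : ‖L + Complex.I * x‖ ≤ ‖L‖ + |x| := (norm_add_le _ _).trans_eq (by simp)
  rw [expMulCpow, norm_mul, norm_exp_I_mul_mul]
  simp only [Complex.ofReal_re, Complex.ofReal_im, mul_zero, sub_zero]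
  calc Real.exp (-(m.im * x)) * ‖(L + Complex.I * x) ^ k‖
      ≤ Real.exp (-(m.im * x)) * (C * Real.exp (ε * (‖L‖ + |x|))) := by
        gcongr
        exact h1.trans (by gcongr)
    _ = _ := by simp only [mul_add, Real.exp_add]; ring

/-- The indicator function of `(-∞, 0]`. -/
noncomputable def negStep (x : ℝ) : ℂ := (Iic (0 : ℝ)).indicator 1 x

theorem measurable_negStep : Measurable negStep :=
  measurable_const.indicator measurableSet_Iic

/-- The step function has the same limits at ±∞ as every Fermi function, and it does not depend on
α. -/
theorem exists_norm_fermi_sub_negStep_le {α : ℂ} (hα : |α.re| < Real.pi) :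
    ∃ C > 0, ∀ x : ℝ, ‖fermi α x - negStep x‖ ≤ C * Real.exp (-|x|) := by
  obtain ⟨C, hC, R, h⟩ := fermi_bounds hα
  refine ⟨C, hC, fun x => ?_⟩
  obtain ⟨-, h1, h2⟩ := h x (Or.inl (by simp))
  rw [Complex.ofReal_re] at h1 h2
  rw [negStep]
  rcases le_or_gt x 0 with hx | hx
  · rw [indicator_of_mem (mem_Iic.2 hx), Pi.one_apply, norm_sub_rev, abs_of_nonpos hx, neg_neg]
    exact h2
  · rw [indicator_of_notMem (by simpa using hx), sub_zero, abs_of_pos hx]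
    exact h1

/-- The constant is independent of m, as needed to dominate locally uniformly in m. -/
theorem LerchAdmissible.exists_norm_mul_fermi_sub_negStep_le {L k α : ℂ}
    (h : LerchAdmissible L k) (hα : |α.re| < Real.pi) {ε : ℝ} (hε : 0 < ε) :
    ∃ C > 0, ∀ m : ℂ, |m.im| + 2 * ε ≤ 1 → ∀ x : ℝ,
      ‖expMulCpow m k L x * (fermi α x - negStep x)‖ ≤ C * Real.exp (-(ε * |x|)) := by
  obtain ⟨C, hC, hb⟩ := h.exists_norm_expMulCpow_real_le hε
  obtain ⟨C', hC', hb'⟩ := exists_norm_fermi_sub_negStep_le hα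
  refine ⟨C * C', by positivity, fun m hm x => ?_⟩
  rw [norm_mul]
  refine (mul_le_mul (hb m x) (hb' x) (norm_nonneg _) (by positivity)).trans ?_
  have e : C * Real.exp (-(m.im * x) + ε * |x|) * (C' * Real.exp (-|x|)) =
      C * C' * Real.exp (-(m.im * x) + ε * |x| + -|x|) := by
    rw [Real.exp_add (-(m.im * x) + ε * |x|)]; ring
  rw [e]
  gcongr
  have : -(m.im * x) ≤ |m.im| * |x| := by rw [← abs_mul]; exact neg_le_abs _
  nlinarith [abs_nonneg x]

theorem LerchAdmissible.exists_norm_mul_fermi_le {L k α : ℂ}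
    (h : LerchAdmissible L k) (hα : |α.re| < Real.pi) {ε : ℝ} (hε : 0 < ε) :
    ∃ C > 0, ∀ m : ℂ, 2 * ε ≤ -m.im → 2 * ε ≤ 1 + m.im → ∀ x : ℝ,
      ‖expMulCpow m k L x * fermi α x‖ ≤ C * Real.exp (-(ε * |x|)) := by
  obtain ⟨C, hC, hb⟩ := h.exists_norm_expMulCpow_real_le hε
  obtain ⟨C', hC', R, hb'⟩ := fermi_bounds hα
  refine ⟨C * C', by positivity, fun m hm hm' x => ?_⟩
  obtain ⟨h1, h2, -⟩ := hb' x (Or.inl (by simp))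
  rw [Complex.ofReal_re] at h2
  have key : ∀ u, ‖fermi α x‖ ≤ C' * Real.exp u →
      -(m.im * x) + ε * |x| + u ≤ -(ε * |x|) →
      ‖expMulCpow m k L x * fermi α x‖ ≤ C * C' * Real.exp (-(ε * |x|)) := fun u hu hu' => by
    rw [norm_mul]
    calc _ ≤ C * Real.exp (-(m.im * x) + ε * |x|) * (C' * Real.exp u) :=
          mul_le_mul (hb m x) hu (norm_nonneg _) (by positivity)
      _ = C * C' * Real.exp (-(m.im * x) + ε * |x| + u) := by
          rw [Real.exp_add (-(m.im * x) + ε * |x|)]; ring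
      _ ≤ _ := by gcongr
  rcases le_total 0 x with h0 | h0
  · refine key _ h2 ?_
    rw [abs_of_nonneg h0]; nlinarith
  · refine key 0 (by simpa using h1) ?_
    rw [abs_of_nonpos h0]; nlinarith

theorem LerchAdmissible.aestronglyMeasurable_mul_fermi_sub_negStep {L k α : ℂ}
    (h : LerchAdmissible L k) (hα : |α.re| < Real.pi) (m : ℂ) : AEStronglyMeasurable
      (fun x : ℝ => expMulCpow m k L x * (fermi α x - negStep x)) volume :=
  (h.continuous_expMulCpow m).aestronglyMeasurable.mul
    ((continuous_fermi hα).aestronglyMeasurable.sub measurable_negStep.aestronglyMeasurable)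

theorem LerchAdmissible.integrable_mul_fermi_sub_negStep {L k α m : ℂ}
    (h : LerchAdmissible L k) (hα : |α.re| < Real.pi) (hm : |m.im| < 1) :
    Integrable fun x : ℝ => expMulCpow m k L x * (fermi α x - negStep x) := by
  have hε : 0 < (1 - |m.im|) / 2 := by linarith
  obtain ⟨C, hC, hb⟩ := h.exists_norm_mul_fermi_sub_negStep_le hα hε
  exact ((integrable_exp_neg_mul_abs hε).const_mul C).mono'
    (h.aestronglyMeasurable_mul_fermi_sub_negStep hα m) (ae_of_all _ (hb m (by linarith)))

theorem LerchAdmissible.integrable_mul_fermi {L k α m : ℂ}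
    (h : LerchAdmissible L k) (hα : |α.re| < Real.pi) (hm : -1 < m.im) (hm' : m.im < 0) :
    Integrable fun x : ℝ => expMulCpow m k L x * fermi α x := by
  have hε : 0 < min (-m.im) (1 + m.im) / 2 := half_pos (lt_min (by linarith) (by linarith))
  obtain ⟨C, hC, hb⟩ := h.exists_norm_mul_fermi_le hα hε
  refine ((integrable_exp_neg_mul_abs hε).const_mul C).mono'
    ((h.continuous_expMulCpow m).mul (continuous_fermi hα)).aestronglyMeasurable
    (ae_of_all _ (hb m ?_ ?_))
  · linarith [min_le_left (-m.im) (1 + m.im)]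
  · linarith [min_le_right (-m.im) (1 + m.im)]

theorem differentiable_expMulCpow (k L z : ℂ) :
    Differentiable ℂ fun m => expMulCpow m k L z := by
  unfold expMulCpow
  fun_prop

theorem LerchAdmissible.differentiableOn_integral_mul_fermi {L k α : ℂ}
    (h : LerchAdmissible L k) (hα : |α.re| < Real.pi) :
    DifferentiableOn ℂ (fun m => ∫ x : ℝ, expMulCpow m k L x * fermi α x)
      {m | m.im ∈ Ioo (-1) 0} := by
  refine differentiableOn_integral_of_dominated (isOpen_Ioo.preimage Complex.continuous_im)
    (fun m _ => ((h.continuous_expMulCpow m).mul (continuous_fermi hα)).aestronglyMeasurable)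
    (fun x => ((differentiable_expMulCpow k L x).mul_const _).differentiableOn)
    fun m₀ hm₀ => ?_
  have hpos : 0 < min (-m₀.im) (1 + m₀.im) :=
    lt_min (by linarith [hm₀.2]) (by linarith [hm₀.1])
  set ε := min (-m₀.im) (1 + m₀.im) / 4 with hε
  have hε0 : 0 < ε := by positivity
  obtain ⟨C, hC, hb⟩ := h.exists_norm_mul_fermi_le hα hε0
  refine ⟨{m | m.im ∈ Ioo (m₀.im - ε) (m₀.im + ε)},
    (isOpen_Ioo.preimage Complex.continuous_im).mem_nhds
      ⟨by linarith, by linarith⟩, _,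
    (integrable_exp_neg_mul_abs hε0).const_mul C, ae_of_all _ fun x m hm => hb m ?_ ?_ x⟩
  · linarith [min_le_left (-m₀.im) (1 + m₀.im), hm.2]
  · linarith [min_le_right (-m₀.im) (1 + m₀.im), hm.1]

/-- Subtracting the step widens the strip of holomorphy so that it contains the real axis, the locus
of the boundary values. -/
theorem LerchAdmissible.differentiableOn_integral_mul_fermi_sub_negStep {L k α : ℂ}
    (h : LerchAdmissible L k) (hα : |α.re| < Real.pi) :
    DifferentiableOn ℂ (fun m => ∫ x : ℝ, expMulCpow m k L x * (fermi α x - negStep x))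
      {m | m.im ∈ Ioo (-1) 1} := by
  refine differentiableOn_integral_of_dominated (isOpen_Ioo.preimage Complex.continuous_im)
    (fun m _ => h.aestronglyMeasurable_mul_fermi_sub_negStep hα m)
    (fun x => ((differentiable_expMulCpow k L x).mul_const _).differentiableOn)
    fun m₀ hm₀ => ?_
  have hlt : |m₀.im| < 1 := abs_lt.2 hm₀
  -- One ε is the half-width of the neighbourhood of m₀, the other two are required by the bound.
  obtain ⟨ε, hε0, hε⟩ : ∃ ε > 0, |m₀.im| + 3 * ε = 1 := ⟨(1 - |m₀.im|) / 3, by linarith, by ring⟩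
  obtain ⟨C, hC, hb⟩ := h.exists_norm_mul_fermi_sub_negStep_le hα hε0
  refine ⟨{m | m.im ∈ Ioo (m₀.im - ε) (m₀.im + ε)},
    (isOpen_Ioo.preimage Complex.continuous_im).mem_nhds
      ⟨by linarith, by linarith⟩, _,
    (integrable_exp_neg_mul_abs hε0).const_mul C, ae_of_all _ fun x m hm => hb m ?_ x⟩
  have h1 : |m.im| ≤ |m₀.im| + ε := by
    have h1 := le_abs_self m₀.im
    have h2 := neg_le_abs m₀.im
    exact abs_le.2 ⟨by linarith [hm.1], by linarith [hm.2]⟩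
  linarith

/-! ### The Lerch function on the cut plane -/

theorem differentiableOn_lerch_series {b k : ℂ} (h : LerchAdmissible b k) :
    DifferentiableOn ℂ (fun z : ℂ => ∑' n : ℕ, z ^ n / (b + n) ^ (-k)) (Metric.ball 0 1) := by
  intro z hz
  rw [mem_ball_zero_iff] at hz
  obtain ⟨r, hzr, hr⟩ := exists_between hz
  have hr0 : 0 ≤ r := (norm_nonneg z).trans hzr.le
  have hs := (summable_lerch h (z := (r : ℂ)) (by
    rwa [Complex.norm_real, Real.norm_of_nonneg hr0])).norm
  refine DifferentiableAt.differentiableWithinAt ?_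
  refine (Complex.differentiableOn_tsum_of_summable_norm (U := Metric.ball 0 r) hs
    (fun n => (by fun_prop : Differentiable ℂ fun z : ℂ => z ^ n / (b + n) ^ (-k)).differentiableOn)
    Metric.isOpen_ball fun n w hw => ?_).differentiableAt
      (Metric.isOpen_ball.mem_nhds (mem_ball_zero_iff.2 hzr))
  rw [mem_ball_zero_iff] at hw
  rw [norm_div, norm_div, norm_pow, norm_pow, Complex.norm_real, Real.norm_of_nonneg hr0]
  gcongr

/-- The map m ↦ exp(2πm) takes the strip -1 < Im m < 0 bijectively onto the plane without [0, ∞).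
There the line integral defines a holomorphic function; it agrees with the series where both apply,
and the unit disc supplies the missing segment [0, 1). -/
theorem exists_isLerchContinuation {k L α : ℂ} (hk : k ≠ 0) (hL : 0 < L.re)
    (hα : |α.re| < Real.pi) :
    ∃ F : ℂ → ℂ, IsLerchContinuation (-k) (lerchParam L α) F ∧
      ∀ m : ℂ, -1 < m.im → m.im < 0 →
        (2 * Real.pi : ℂ) ^ (k + 1) * (Complex.exp ((Real.pi - α) * m) *
          F (Complex.exp (2 * m * Real.pi))) =
        -Complex.I * ∫ x : ℝ, expMulCpow m k L x * fermi α x := by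
  classical
  have hadm : LerchAdmissible L k := Or.inl hL
  have hb : LerchAdmissible (lerchParam L α) k := Or.inl (lerchParam_re_pos hL.le hα)
  have hpi : (Real.pi : ℂ) ≠ 0 := Complex.ofReal_ne_zero.2 Real.pi_ne_zero
  have hpi2 : (2 * Real.pi : ℂ) ^ (k + 1) ≠ 0 := by simp [Complex.cpow_eq_zero_iff, hpi]
  have hpos := Real.pi_pos
  -- The inverse of m ↦ exp(2πm) on the strip; using log(-z) puts the branch cut on the positive
  -- axis.
  let μ : ℂ → ℂ := fun z => (Complex.log (-z) - Real.pi * Complex.I) / (2 * Real.pi)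
  have hμim : ∀ z, (μ z).im = ((-z).arg - Real.pi) / (2 * Real.pi) := fun z => by
    simp only [μ]
    rw [show (2 * Real.pi : ℂ) = ((2 * Real.pi : ℝ) : ℂ) by push_cast; rfl, Complex.div_ofReal_im]
    simp [Complex.log_im]
  have hμ1 : ∀ z, -1 < (μ z).im := fun z => by
    rw [hμim, lt_div_iff₀ (by positivity)]; linarith [Complex.neg_pi_lt_arg (-z)]
  have hμ2 : ∀ z, -z ∈ Complex.slitPlane → (μ z).im < 0 := fun z hz => by
    rw [hμim, div_lt_iff₀ (by positivity)]
    linarith [(Complex.arg_le_pi (-z)).lt_of_ne (Complex.mem_slitPlane_iff_arg.1 hz).1]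
  have hμexp : ∀ z, -z ∈ Complex.slitPlane → Complex.exp (2 * μ z * Real.pi) = z := fun z hz => by
    rw [show 2 * μ z * Real.pi = Complex.log (-z) - Real.pi * Complex.I by
      simp only [μ]; field_simp, Complex.exp_sub, Complex.exp_pi_mul_I,
      Complex.exp_log (Complex.slitPlane_ne_zero hz)]
    simp
  have hμre : ∀ z, -z ∈ Complex.slitPlane → ‖z‖ < 1 → (μ z).re < 0 := fun z hz hz1 => by
    have := exp_two_mul_pi_norm (μ z)
    rw [hμexp z hz] at this
    rw [this, Real.exp_lt_one_iff] at hz1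
    by_contra! h
    nlinarith
  let H : ℂ → ℂ := fun z => (Complex.exp ((Real.pi - α) * μ z))⁻¹ *
    (((2 * Real.pi : ℂ) ^ (k + 1))⁻¹ *
      (-Complex.I * ∫ x : ℝ, expMulCpow (μ z) k L x * fermi α x))
  have hUo : IsOpen {z : ℂ | -z ∈ Complex.slitPlane} :=
    Complex.isOpen_slitPlane.preimage continuous_neg
  have hH : DifferentiableOn ℂ H {z : ℂ | -z ∈ Complex.slitPlane} := by
    have hμd : DifferentiableOn ℂ μ {z : ℂ | -z ∈ Complex.slitPlane} := by
      refine DifferentiableOn.div_const (DifferentiableOn.sub_const ?_ _) _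
      exact DifferentiableOn.clog (by fun_prop) fun z hz => hz
    have h1 := (hadm.differentiableOn_integral_mul_fermi hα).comp hμd
      fun z hz => ⟨hμ1 z, hμ2 z hz⟩
    refine DifferentiableOn.mul (DifferentiableOn.inv ?_
      fun z _ => Complex.exp_ne_zero _) ((h1.const_mul _).const_mul _)
    exact (hμd.const_mul _).cexp
  let F : ℂ → ℂ := fun z => if ‖z‖ < 1 then
    ∑' n : ℕ, z ^ n / (lerchParam L α + n) ^ (-k) else H z
  have hF1 : ∀ z, ‖z‖ < 1 → F z = ∑' n : ℕ, z ^ n / (lerchParam L α + n) ^ (-k) :=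
    fun z hz => if_pos hz
  have hF2 : ∀ z, -z ∈ Complex.slitPlane → F z = H z := fun z hz => by
    by_cases h1 : ‖z‖ < 1
    · have := lerch_series_of_re_neg hk hL hα (hμ1 z) (hμ2 z hz) (hμre z hz h1)
      rw [hF1 z h1]
      simp only [H]
      rw [← this, hμexp z hz, inv_mul_cancel_left₀ hpi2,
        inv_mul_cancel_left₀ (Complex.exp_ne_zero _)]
    · exact if_neg h1
  refine ⟨F, ⟨fun z hz => DifferentiableAt.differentiableWithinAt ?_, hF1⟩, fun m hm hm' => ?_⟩
  · by_cases h1 : ‖z‖ < 1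
    · have hB : Metric.ball (0 : ℂ) 1 ∈ 𝓝 z :=
        Metric.isOpen_ball.mem_nhds (mem_ball_zero_iff.2 h1)
      refine ((differentiableOn_lerch_series hb).differentiableAt hB).congr_of_eventuallyEq ?_
      filter_upwards [hB] with w hw using hF1 w (mem_ball_zero_iff.1 hw)
    -- A point of the cut plane outside the open unit disc is not on [0, ∞).
    · have hz' : -z ∈ Complex.slitPlane := by
        rw [Complex.mem_slitPlane_iff, Complex.neg_re, Complex.neg_im]
        by_contra! h
        have him : z.im = 0 := neg_eq_zero.1 h.2
        have hre : ‖z‖ = z.re := by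
          rw [← Complex.abs_re_eq_norm.2 him, abs_of_nonneg (by linarith [h.1])]
        exact hz ⟨by linarith, him⟩
      refine (hH.differentiableAt (hUo.mem_nhds hz')).congr_of_eventuallyEq ?_
      filter_upwards [hUo.mem_nhds hz'] with w hw using hF2 w hw
  · have hw : -Complex.exp (2 * m * Real.pi) =
        Complex.exp (2 * m * Real.pi + Real.pi * Complex.I) := by
      rw [Complex.exp_add, Complex.exp_pi_mul_I]; ring
    have hwim : (2 * m * Real.pi + Real.pi * Complex.I).im = 2 * m.im * Real.pi + Real.pi := by
      simp
    have hlog : Complex.log (-Complex.exp (2 * m * Real.pi)) =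
        2 * m * Real.pi + Real.pi * Complex.I := by
      rw [hw, Complex.log_exp] <;> rw [hwim] <;> nlinarith
    have hslit : -Complex.exp (2 * m * Real.pi) ∈ Complex.slitPlane := by
      rw [Complex.mem_slitPlane_iff_arg]
      refine ⟨?_, neg_ne_zero.2 (Complex.exp_ne_zero _)⟩
      rw [← Complex.log_im, hlog, hwim]
      intro h
      nlinarith
    have hμm : μ (Complex.exp (2 * m * Real.pi)) = m := by
      simp only [μ]
      rw [hlog]
      field_simp
      ring
    rw [hF2 _ hslit]
    simp only [H]
    rw [hμm, mul_inv_cancel_left₀ (Complex.exp_ne_zero _), mul_inv_cancel_left₀ hpi2]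

theorem lerchPrincipal_eq_integral {k m L α : ℂ} (hk : k ≠ 0) (hL : 0 < L.re)
    (hα : |α.re| < Real.pi) (hm : -1 < m.im) (hm' : m.im < 0)
    (hz : Complex.exp (2 * m * Real.pi) ∈ lerchCutPlane) :
    (2 * Real.pi : ℂ) ^ (k + 1) * (Complex.exp ((Real.pi - α) * m) *
      lerchPrincipal (-k) (lerchParam L α) (Complex.exp (2 * m * Real.pi))) =
      -Complex.I * ∫ x : ℝ, expMulCpow m k L x * fermi α x := by
  obtain ⟨F, hF, hFm⟩ := exists_isLerchContinuation hk hL hα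
  rw [hF.lerchPrincipal.eqOn hF hz, hFm m hm hm']

/-- A positive value of exp(2πm) forces Im m to be an integer, here 0; and Re m < 0 puts the value
in the unit disc. -/
theorem exp_two_mul_pi_mem_lerchCutPlane {m : ℂ} (hm : |m.im| < 1) (h : m.im ≠ 0 ∨ m.re < 0) :
    Complex.exp (2 * m * Real.pi) ∈ lerchCutPlane := by
  rcases h with h | h
  · rintro ⟨h1, h2⟩
    refine h ?_
    set z := Complex.exp (2 * m * Real.pi) with hz
    have hzr : z = (z.re : ℂ) := Complex.ext (by simp) (by simp [h2])
    have : Complex.exp (2 * m * Real.pi) = Complex.exp (Real.log z.re : ℝ) := by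
      rw [← Complex.ofReal_exp, Real.exp_log (by linarith), ← hz, ← hzr]
    obtain ⟨n, hn⟩ := Complex.exp_eq_exp_iff_exists_int.1 this
    have him : 2 * m.im * Real.pi = n * (2 * Real.pi) := by simpa using congrArg Complex.im hn
    have hmn : m.im = n := by
      have := Real.pi_pos
      nlinarith
    rw [hmn] at hm ⊢
    have : |n| < 1 := by exact_mod_cast hm
    rw [Int.abs_lt_one_iff.1 this, Int.cast_zero]
  · refine mem_lerchCutPlane_of_norm_lt_one ?_
    rw [exp_two_mul_pi_norm, Real.exp_lt_one_iff]
    nlinarith [Real.pi_pos]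

/-! ### Half-line integrals and the values near the positive axis. -/

theorem hasDerivAt_expMulCpow_of {m k L : ℂ} {x : ℝ}
    (hx : HasDerivAt (fun w : ℂ => w ^ k) (k * (L + Complex.I * x) ^ (k - 1))
      (L + Complex.I * x)) :
    HasDerivAt (fun x : ℝ => expMulCpow m k L x)
      (Complex.I * m * expMulCpow m k L x + Complex.I * k * expMulCpow m (k - 1) L x) x := by
  have h1 : HasDerivAt (fun x : ℝ => Complex.exp (Complex.I * m * x))
      (Complex.exp (Complex.I * m * x) * (Complex.I * m)) x := by
    have := ((hasDerivAt_id (x : ℂ)).const_mul (Complex.I * m)).cexp.comp_ofReal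
    simpa using this
  have h2 : HasDerivAt (fun x : ℝ => (L + Complex.I * x) ^ k)
      (k * (L + Complex.I * x) ^ (k - 1) * Complex.I) x := by
    have h3 : HasDerivAt (fun z : ℂ => L + Complex.I * z) Complex.I x := by
      simpa using ((hasDerivAt_id (x : ℂ)).const_mul Complex.I).const_add L
    exact (hx.comp (x : ℂ) h3).comp_ofReal
  refine (h1.mul h2).congr_deriv ?_
  simp only [expMulCpow]
  ring

theorem hasDerivAt_expMulCpow {m k L : ℂ} {x : ℝ} (hx : L + Complex.I * x ∈ Complex.slitPlane) :
    HasDerivAt (fun x : ℝ => expMulCpow m k L x)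
      (Complex.I * m * expMulCpow m k L x + Complex.I * k * expMulCpow m (k - 1) L x) x :=
  hasDerivAt_expMulCpow_of (by
    simpa using (hasDerivAt_id (L + Complex.I * x)).cpow_const (c := k) hx)

theorem add_I_mul_mem_slitPlane {L : ℂ} (hL : 0 < L.re) (x : ℝ) :
    L + Complex.I * x ∈ Complex.slitPlane := by
  left; rw [add_I_mul_re]; simpa using hL

theorem LerchAdmissible.exists_norm_expMulCpow_neg_le {L k m : ℂ} (h : LerchAdmissible L k)
    (hm : m.im < 0) : ∃ C > 0, ∀ x : ℝ, x ≤ 0 →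
      ‖expMulCpow m k L x‖ ≤ C * Real.exp (-m.im / 2 * x) := by
  obtain ⟨C, hC, hb⟩ := h.exists_norm_expMulCpow_real_le (ε := -m.im / 2) (by linarith)
  refine ⟨C, hC, fun x hx => (hb m x).trans_eq ?_⟩
  rw [abs_of_nonpos hx]
  ring_nf

theorem LerchAdmissible.integrableOn_Iic_expMulCpow {L k m : ℂ} (h : LerchAdmissible L k)
    (hm : m.im < 0) : IntegrableOn (fun x : ℝ => expMulCpow m k L x) (Iic 0) := by
  obtain ⟨C, hC, hb⟩ := h.exists_norm_expMulCpow_neg_le hm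
  refine Integrable.mono' ((integrableOn_exp_mul_Iic (a := -m.im / 2) (by linarith) 0).const_mul C)
    (h.continuous_expMulCpow m).aestronglyMeasurable ?_
  filter_upwards [ae_restrict_mem measurableSet_Iic] with x hx using hb x hx

theorem LerchAdmissible.tendsto_atBot_expMulCpow {L k m : ℂ} (h : LerchAdmissible L k)
    (hm : m.im < 0) : Tendsto (fun x : ℝ => expMulCpow m k L x) atBot (𝓝 0) := by
  obtain ⟨C, hC, hb⟩ := h.exists_norm_expMulCpow_neg_le hm
  have hlim : Tendsto (fun x : ℝ => C * Real.exp (-m.im / 2 * x)) atBot (𝓝 0) := by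
    have := Real.tendsto_exp_atBot.comp
      (tendsto_id.const_mul_atBot (show 0 < -m.im / 2 by linarith))
    simpa using this.const_mul C
  refine squeeze_zero_norm' ?_ hlim
  filter_upwards [eventually_le_atBot 0] with x hx using hb x hx

/-- Integration by parts for the incomplete Gamma integral. -/
theorem integral_Iic_expMulCpow_recurrence {L k m : ℂ} (hL : 0 < L.re) (hm : m.im < 0) :
    ∫ x in Iic (0 : ℝ), expMulCpow m k L x = (L ^ k - Complex.I * k *
      ∫ x in Iic (0 : ℝ), expMulCpow m (k - 1) L x) / (Complex.I * m) := by
  have hm0 : m ≠ 0 := by rintro rfl; simp at hm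
  have hadm : ∀ k, LerchAdmissible L k := fun k => Or.inl hL
  have i1 := ((hadm k).integrableOn_Iic_expMulCpow hm).const_mul (Complex.I * m)
  have i2 := ((hadm (k - 1)).integrableOn_Iic_expMulCpow hm).const_mul (Complex.I * k)
  have h := integral_Iic_of_hasDerivAt_of_tendsto
    ((hadm k).continuous_expMulCpow m).continuousWithinAt
    (fun x _ => hasDerivAt_expMulCpow (add_I_mul_mem_slitPlane hL x)) (i1.add i2)
    ((hadm k).tendsto_atBot_expMulCpow hm)
  rw [integral_add i1 i2, integral_const_mul, integral_const_mul] at h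
  rw [eq_div_iff (mul_ne_zero Complex.I_ne_zero hm0), eq_sub_iff_add_eq, mul_comm, h]
  simp [expMulCpow]

theorem exists_norm_cpow_real_le {L k : ℂ} (hL : 0 < L.re) (hk : k.re ≤ 0) :
    ∃ C > 0, ∀ x : ℝ, ‖(L + Complex.I * x) ^ k‖ ≤ C * (1 + |x|) ^ k.re := by
  obtain ⟨c, hc, h⟩ := exists_pos_mul_one_add_abs_le_add_I_mul hL
  refine ⟨Real.exp (Real.pi * |k.im|) * c ^ k.re, by positivity, fun x => ?_⟩
  refine (norm_cpow_le_exp_mul_rpow _ _).trans ?_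
  rw [mul_assoc, ← Real.mul_rpow hc.le (by positivity)]
  gcongr ?_ * ?_
  refine Real.rpow_le_rpow_of_nonpos (by positivity) ?_ hk
  simpa using h 0 le_rfl x (by simp)

/-- For Re k < -1 the power alone is integrable and dominates, since |exp(imx)| ≤ 1 for x ≤ 0 and Im
m < 0. Integration by parts raises k by one at the price of dividing by m, which is harmless near m₀
≠ 0; hence the induction. -/
theorem exists_tendsto_integral_Iic_expMulCpow {L : ℂ} (hL : 0 < L.re) {m₀ : ℂ}
    (hm₀ : m₀ ≠ 0) (k : ℂ) :
    ∃ l, Tendsto (fun m => ∫ x in Iic (0 : ℝ), expMulCpow m k L x) (𝓝[{m | m.im < 0}] m₀)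
      (𝓝 l) := by
  suffices H : ∀ (N : ℕ) (k : ℂ), k.re < N - 1 → ∃ l, Tendsto (fun m =>
      ∫ x in Iic (0 : ℝ), expMulCpow m k L x) (𝓝[{m | m.im < 0}] m₀) (𝓝 l) by
    obtain ⟨N, hN⟩ := exists_nat_gt (k.re + 1)
    exact H N k (by linarith)
  intro N
  induction N with
  | zero =>
    intro k hk
    simp only [Nat.cast_zero, zero_sub] at hk
    have hadm : LerchAdmissible L k := Or.inl hL
    obtain ⟨C, hC, hb⟩ := exists_norm_cpow_real_le hL (k := k) (by linarith)
    refine ⟨∫ x in Iic (0 : ℝ), expMulCpow m₀ k L x, ?_⟩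
    refine tendsto_integral_filter_of_dominated_convergence (fun x => C * (1 + |x|) ^ k.re)
      (Eventually.of_forall fun m => (hadm.continuous_expMulCpow m).aestronglyMeasurable) ?_
      ((integrable_one_add_abs_rpow hk).const_mul C).integrableOn (ae_of_all _ fun x => ?_)
    · filter_upwards [self_mem_nhdsWithin] with m hm
      filter_upwards [ae_restrict_mem measurableSet_Iic] with x hx
      rw [expMulCpow, norm_mul, norm_exp_I_mul_mul]
      refine (mul_le_of_le_one_left (norm_nonneg _) ?_).trans (hb x)
      rw [Real.exp_le_one_iff]
      simp only [Complex.ofReal_re, Complex.ofReal_im, mul_zero, sub_zero, Left.neg_nonpos_iff]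
      exact mul_nonneg_of_nonpos_of_nonpos (le_of_lt hm) hx
    · exact ((differentiable_expMulCpow k L x).continuous.tendsto m₀).mono_left nhdsWithin_le_nhds
  | succ N ih =>
    intro k hk
    obtain ⟨l, hl⟩ := ih (k - 1) (by push_cast at hk; simp; linarith)
    have hid : Tendsto (fun m : ℂ => Complex.I * m) (𝓝[{m | m.im < 0}] m₀)
        (𝓝 (Complex.I * m₀)) :=
      (((continuous_const.mul continuous_id).tendsto m₀)).mono_left nhdsWithin_le_nhds
    refine ⟨_, (((hl.const_mul (Complex.I * k)).const_sub (L ^ k)).div hid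
      (mul_ne_zero Complex.I_ne_zero hm₀)).congr' ?_⟩
    filter_upwards [self_mem_nhdsWithin] with m hm
      using (integral_Iic_expMulCpow_recurrence hL hm).symm

theorem integral_mul_negStep (f : ℝ → ℂ) :
    ∫ x : ℝ, f x * negStep x = ∫ x in Iic (0 : ℝ), f x := by
  rw [← integral_indicator measurableSet_Iic]
  congr 1 with x
  by_cases hx : x ∈ Iic (0 : ℝ) <;> simp [negStep, hx]

theorem integral_mul_one_sub_negStep (f : ℝ → ℂ) :
    ∫ x : ℝ, f x * (1 - negStep x) = ∫ x in Ioi (0 : ℝ), f x := by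
  rw [← integral_indicator measurableSet_Ioi]
  congr 1 with x
  by_cases hx : x ∈ Iic (0 : ℝ)
  · simp [negStep, hx, not_lt.2 (mem_Iic.1 hx)]
  · simp [negStep, hx, not_le.1 (mt mem_Iic.2 hx)]

theorem LerchAdmissible.integral_mul_fermi {L k m α : ℂ} (h : LerchAdmissible L k)
    (hα : |α.re| < Real.pi) (hm : -1 < m.im) (hm' : m.im < 0) :
    ∫ x : ℝ, expMulCpow m k L x * fermi α x =
      (∫ x : ℝ, expMulCpow m k L x * (fermi α x - negStep x)) +
        ∫ x in Iic (0 : ℝ), expMulCpow m k L x := by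
  have i1 := h.integrable_mul_fermi hα hm hm'
  have i2 := h.integrable_mul_fermi_sub_negStep (m := m) hα (abs_lt.2 ⟨hm, by linarith⟩)
  rw [← integral_mul_negStep, ← integral_add i2]
  · congr 1 with x; ring
  · refine (i1.sub i2).congr (ae_of_all _ fun x => ?_)
    simp only [Pi.sub_apply]; ring

theorem LerchAdmissible.integral_mul_one_sub_fermi {L k m α : ℂ} (h : LerchAdmissible L k)
    (hα : |α.re| < Real.pi) (hm : 0 < m.im) (hm' : m.im < 1)
    (i1 : Integrable fun x : ℝ => expMulCpow m k L x * (1 - fermi α x)) :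
    ∫ x : ℝ, expMulCpow m k L x * (1 - fermi α x) =
      -(∫ x : ℝ, expMulCpow m k L x * (fermi α x - negStep x)) +
        ∫ x in Ioi (0 : ℝ), expMulCpow m k L x := by
  have i2 := h.integrable_mul_fermi_sub_negStep (m := m) hα (abs_lt.2 ⟨by linarith, hm'⟩)
  rw [← integral_mul_one_sub_negStep, eq_neg_add_iff_add_eq, add_comm, ← integral_add i1 i2]
  congr 1 with x
  ring

/-- The Lerch function for `-1 < Im m < 0`, with the common part split off. -/
theorem lerchPrincipal_eq_of_im_neg {k m L α : ℂ} (hk : k ≠ 0) (hL : 0 < L.re)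
    (hα : |α.re| < Real.pi) (hm : -1 < m.im) (hm' : m.im < 0) :
    (2 * Real.pi : ℂ) ^ (k + 1) * (Complex.exp ((Real.pi - α) * m) *
      lerchPrincipal (-k) (lerchParam L α) (Complex.exp (2 * m * Real.pi))) =
      -Complex.I * (∫ x : ℝ, expMulCpow m k L x * (fermi α x - negStep x)) +
        -Complex.I * ∫ x in Iic (0 : ℝ), expMulCpow m k L x := by
  rw [lerchPrincipal_eq_integral hk hL hα hm hm' (exp_two_mul_pi_mem_lerchCutPlane
    (abs_lt.2 ⟨hm, by linarith⟩) (Or.inl hm'.ne)),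
    LerchAdmissible.integral_mul_fermi (Or.inl hL) hα hm hm', mul_add]

/-- The Lerch function for `0 < Im m < 1`, with the common part split off. -/
theorem lerchPrincipal_eq_of_im_pos {k m L α : ℂ} (hk : k ≠ 0) (hL : 0 < L.re)
    (hα : |α.re| < Real.pi) (hm : 0 < m.im) (hm' : m.im < 1) :
    (2 * Real.pi : ℂ) ^ (k + 1) * (Complex.exp ((Real.pi - α) * m) *
      lerchPrincipal (-k) (lerchParam L α) (Complex.exp (2 * m * Real.pi))) =
      -Complex.I * (∫ x : ℝ, expMulCpow m k L x * (fermi α x - negStep x)) +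
        Complex.I * ∫ x in Ioi (0 : ℝ), expMulCpow m k L x := by
  have hadm : LerchAdmissible L k := Or.inl hL
  -- The point m - i gives the same z and lies in the strip where the integral formula holds. The
  -- extra factor exp(x) turns the Fermi function into 1 minus itself.
  have him : (m - Complex.I).im = m.im - 1 := by simp
  have hz : Complex.exp (2 * (m - Complex.I) * Real.pi) = Complex.exp (2 * m * Real.pi) := by
    rw [show 2 * (m - Complex.I) * Real.pi = 2 * m * Real.pi - 2 * Real.pi * Complex.I by ring,
      Complex.exp_periodic.sub_eq]
  have hcut := exp_two_mul_pi_mem_lerchCutPlane (m := m)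
    (abs_lt.2 ⟨by linarith, hm'⟩) (Or.inl hm.ne')
  have h := lerchPrincipal_eq_integral (m := m - Complex.I) hk hL hα (by rw [him]; linarith)
    (by rw [him]; linarith) (by rwa [hz])
  have e1 : Complex.exp ((Real.pi - α) * (m - Complex.I)) =
      -(Complex.exp (Complex.I * α) * Complex.exp ((Real.pi - α) * m)) := by
    rw [show (Real.pi - α) * (m - Complex.I) =
      Complex.I * α + (Real.pi - α) * m - Real.pi * Complex.I by ring, Complex.exp_sub,
      Complex.exp_pi_mul_I, Complex.exp_add]
    ring
  have e2 : ∀ x : ℝ, expMulCpow (m - Complex.I) k L x * fermi α x =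
      Complex.exp (Complex.I * α) * (expMulCpow m k L x * (1 - fermi α x)) := fun x => by
    have hne := one_add_exp_ne_zero hα x
    have h1 : Complex.exp (Complex.I * (m - Complex.I) * x) =
        Complex.exp (Complex.I * m * x) * (Complex.exp (Complex.I * α) *
          Complex.exp (x - Complex.I * α)) := by
      rw [← Complex.exp_add, ← Complex.exp_add]
      congr 1
      linear_combination (-x : ℂ) * Complex.I_sq
    have h2 : 1 - fermi α x = Complex.exp (x - Complex.I * α) * fermi α x := by
      rw [fermi]; field_simp; ring
    rw [h2, expMulCpow, expMulCpow, h1]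
    ring
  have i1 : Integrable fun x : ℝ => expMulCpow m k L x * (1 - fermi α x) := by
    refine ((hadm.integrable_mul_fermi (m := m - Complex.I) hα (by rw [him]; linarith)
      (by rw [him]; linarith)).const_mul (Complex.exp (Complex.I * α))⁻¹).congr
        (ae_of_all _ fun x => ?_)
    simp only []
    rw [e2, inv_mul_cancel_left₀ (Complex.exp_ne_zero _)]
  simp only [e2, integral_const_mul] at h
  rw [hz, e1, hadm.integral_mul_one_sub_fermi hα hm hm' i1] at h
  refine mul_left_cancel₀ (Complex.exp_ne_zero (Complex.I * α)) ?_
  linear_combination -h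

theorem neBot_nhdsWithin_im_neg {z : ℂ} (hz : z.im = 0) : (𝓝[{w : ℂ | w.im < 0}] z).NeBot := by
  rw [← mem_closure_iff_nhdsWithin_neBot, Complex.closure_setOfPred_im_lt]
  exact hz.le

/-- The limit of the Lerch function as `m` tends to a real point from below. -/
theorem exists_tendsto_lerchPrincipal {k m₀ L : ℂ} (hk : k ≠ 0) (hL : 0 < L.re)
    (him : m₀.im = 0) (hm₀ : m₀ ≠ 0) :
    ∃ E, ∀ α : ℂ, |α.re| < Real.pi → Tendsto (lerchPrincipal (-k) (lerchParam L α))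
      (𝓝[{w : ℂ | w.im < 0}] (Complex.exp (2 * m₀ * Real.pi)))
      (𝓝 ((Complex.exp ((Real.pi - α) * m₀))⁻¹ * (((2 * Real.pi : ℂ) ^ (k + 1))⁻¹ *
        (-Complex.I * (∫ x : ℝ, expMulCpow m₀ k L x * (fermi α x - negStep x)) + E)))) := by
  obtain ⟨l, hl⟩ := exists_tendsto_integral_Iic_expMulCpow hL hm₀ k
  have hpi : (Real.pi : ℂ) ≠ 0 := Complex.ofReal_ne_zero.2 Real.pi_ne_zero
  have hpi2 : (2 * Real.pi : ℂ) ^ (k + 1) ≠ 0 := by simp [Complex.cpow_eq_zero_iff, hpi]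
  -- The limit l of the half-line integral is obtained before α is introduced, so E is common to all
  -- α.
  refine ⟨-Complex.I * l, fun α hα => ?_⟩
  have hJ := ((LerchAdmissible.differentiableOn_integral_mul_fermi_sub_negStep
    (k := k) (Or.inl hL) hα).differentiableAt ((isOpen_Ioo.preimage
      Complex.continuous_im).mem_nhds (show m₀.im ∈ Ioo (-1 : ℝ) 1 by simp [him]))).continuousAt
  have hexp : Tendsto (fun m : ℂ => (Complex.exp ((Real.pi - α) * m))⁻¹) (𝓝[{m | m.im < 0}] m₀)
      (𝓝 (Complex.exp ((Real.pi - α) * m₀))⁻¹) := by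
    have : Continuous fun m : ℂ => (Complex.exp ((Real.pi - α) * m))⁻¹ :=
      Continuous.inv₀ (by fun_prop) fun m => Complex.exp_ne_zero _
    exact (this.tendsto m₀).mono_left nhdsWithin_le_nhds
  have hlim := hexp.mul ((((hJ.tendsto.mono_left (nhdsWithin_le_nhds (s := {m | m.im < 0}))).const_mul
    (-Complex.I)).add (hl.const_mul (-Complex.I))).const_mul ((2 * Real.pi : ℂ) ^ (k + 1))⁻¹)
  -- Near the positive axis Im w < 0 corresponds to Im m < 0, so the boundary value from below is
  -- reached inside the strip of the integral formula.
  have hm_lim : Tendsto (fun w : ℂ => Complex.log w / (2 * Real.pi))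
      (𝓝[{w : ℂ | w.im < 0}] (Complex.exp (2 * m₀ * Real.pi))) (𝓝[{m | m.im < 0}] m₀) := by
    have him2 : (2 * m₀ * Real.pi).im = 0 := by simp [him]
    have hlog : Complex.log (Complex.exp (2 * m₀ * Real.pi)) = 2 * m₀ * Real.pi :=
      Complex.log_exp (by rw [him2]; linarith [Real.pi_pos]) (by rw [him2]; exact Real.pi_pos.le)
    have hslit : Complex.exp (2 * m₀ * Real.pi) ∈ Complex.slitPlane := by
      rw [Complex.mem_slitPlane_iff_arg]
      refine ⟨?_, Complex.exp_ne_zero _⟩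
      rw [← Complex.log_im, hlog, him2]
      exact Real.pi_ne_zero.symm
    refine tendsto_nhdsWithin_iff.2 ⟨?_, ?_⟩
    · have := ((continuousAt_clog hslit).tendsto.div_const (2 * Real.pi : ℂ)).mono_left
        (nhdsWithin_le_nhds (s := {w : ℂ | w.im < 0}))
      rwa [hlog, show 2 * m₀ * Real.pi / (2 * Real.pi) = m₀ by field_simp] at this
    · filter_upwards [self_mem_nhdsWithin] with w hw
      rw [show (2 * Real.pi : ℂ) = ((2 * Real.pi : ℝ) : ℂ) by push_cast; rfl,
        Complex.div_ofReal_im, Complex.log_im]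
      exact div_neg_of_neg_of_pos (Complex.arg_neg_iff.2 hw) Real.two_pi_pos
  refine (hlim.comp hm_lim).congr' ?_
  have hev : ∀ᶠ m in 𝓝[{m | m.im < 0}] m₀, -1 < m.im ∧ m.im < 0 := by
    filter_upwards [self_mem_nhdsWithin, nhdsWithin_le_nhds
      ((isOpen_lt continuous_const Complex.continuous_im).mem_nhds
        (show (-1 : ℝ) < m₀.im by rw [him]; norm_num))] with m h1 h2 using ⟨h2, h1⟩
  filter_upwards [hm_lim.eventually hev, self_mem_nhdsWithin] with w hw hw0
  have hw0' : w ≠ 0 := by rintro rfl; simp at hw0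
  have hexpw : Complex.exp (2 * (Complex.log w / (2 * Real.pi)) * Real.pi) = w := by
    rw [show 2 * (Complex.log w / (2 * Real.pi)) * Real.pi = Complex.log w by field_simp,
      Complex.exp_log hw0']
  have h := lerchPrincipal_eq_of_im_neg hk hL hα hw.1 hw.2
  simp only [Function.comp]
  rw [← h, hexpw, inv_mul_cancel_left₀ hpi2, inv_mul_cancel_left₀ (Complex.exp_ne_zero _)]

/-! ### The Hurwitz zeta function -/

theorem rpow_le_rpow_add_rpow {u p a b : ℝ} (hu : 0 < u) (ha : a ≤ p) (hb : p ≤ b) :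
    u ^ p ≤ u ^ b + u ^ a := by
  rcases le_total 1 u with h | h
  · exact (Real.rpow_le_rpow_of_exponent_le h hb).trans
      (le_add_of_nonneg_right (Real.rpow_nonneg hu.le _))
  · exact (Real.rpow_le_rpow_of_exponent_ge hu h ha).trans
      (le_add_of_nonneg_left (Real.rpow_nonneg hu.le _))

theorem expMulCpow_zero_left (k L z : ℂ) : expMulCpow 0 k L z = (L + Complex.I * z) ^ k := by
  simp [expMulCpow]

/-- The exponential decay of the kernel beats every power, so this part is entire in s. -/
theorem differentiable_integral_cpow_mul_fermi_sub_negStep {L α : ℂ} (hL : 0 < L.re)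
    (hα : |α.re| < Real.pi) :
    Differentiable ℂ fun s => ∫ x : ℝ, expMulCpow 0 (-s) L x * (fermi α x - negStep x) := by
  have hadm : ∀ k, LerchAdmissible L k := fun k => Or.inl hL
  rw [← differentiableOn_univ]
  refine differentiableOn_integral_of_dominated isOpen_univ
    (fun s _ => (hadm _).aestronglyMeasurable_mul_fermi_sub_negStep hα 0) (fun x => ?_)
    fun s₀ _ => ?_
  · simp only [expMulCpow_zero_left]
    refine DifferentiableOn.mul_const (fun s _ => ?_) _
    exact (differentiableAt_id.neg.const_cpow
      (Or.inl (Complex.slitPlane_ne_zero (add_I_mul_mem_slitPlane hL x)))).differentiableWithinAt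
  · set p := -s₀.re with hp
    -- For s within 1 of s₀, u^(-Re s) is at most u^(p+1) + u^(p-1) for every u > 0; this avoids
    -- distinguishing u < 1 from u > 1.
    obtain ⟨C, hC, hb⟩ := (hadm ((p + 1 : ℝ) : ℂ)).exists_norm_expMulCpow_real_le
      (ε := 1 / 2) (by norm_num)
    obtain ⟨C', hC', hb'⟩ := (hadm ((p - 1 : ℝ) : ℂ)).exists_norm_expMulCpow_real_le
      (ε := 1 / 2) (by norm_num)
    obtain ⟨D, hD, hq⟩ := exists_norm_fermi_sub_negStep_le hα
    refine ⟨Metric.ball s₀ 1, Metric.ball_mem_nhds _ one_pos,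
      fun x => Real.exp (Real.pi * (|s₀.im| + 1)) * (C + C') * D * Real.exp (-(1 / 2 * |x|)),
      (integrable_exp_neg_mul_abs (by norm_num)).const_mul _, ae_of_all _ fun x s hs => ?_⟩
    rw [mem_ball_iff_norm] at hs
    have hre := (Complex.abs_re_le_norm (s - s₀)).trans hs.le
    have him := (Complex.abs_im_le_norm (s - s₀)).trans hs.le
    rw [Complex.sub_re, abs_le] at hre
    rw [Complex.sub_im] at him
    have him' : |s.im| ≤ |s₀.im| + 1 := by
      have := abs_sub_abs_le_abs_sub s.im s₀.im
      linarith
    have h1 := hb 0 x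
    have h2 := hb' 0 x
    simp only [expMulCpow_zero_left, Complex.zero_im, zero_mul, neg_zero, zero_add,
      Complex.norm_cpow_real] at h1 h2
    have hw : 0 < ‖L + Complex.I * x‖ :=
      norm_pos_iff.2 (Complex.slitPlane_ne_zero (add_I_mul_mem_slitPlane hL x))
    have h3 : ‖(L + Complex.I * x) ^ (-s)‖ ≤ Real.exp (Real.pi * (|s₀.im| + 1)) *
        ((C + C') * Real.exp (1 / 2 * |x|)) := by
      refine (norm_cpow_le_exp_mul_rpow _ _).trans ?_
      rw [Complex.neg_im, abs_neg, Complex.neg_re]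
      have := rpow_le_rpow_add_rpow (p := -s.re) hw (a := p - 1) (b := p + 1)
        (by linarith [hre.2]) (by linarith [hre.1])
      gcongr
      linarith
    rw [expMulCpow_zero_left, norm_mul]
    refine (mul_le_mul h3 (hq x) (norm_nonneg _) (by positivity)).trans_eq ?_
    beta_reduce
    rw [show -(1 / 2 * |x|) = 1 / 2 * |x| + -|x| by ring, Real.exp_add]
    ring

theorem integrableOn_Iic_cpow {L k : ℂ} (hL : 0 < L.re) (hk : k.re < -1) :
    IntegrableOn (fun x : ℝ => expMulCpow 0 k L x) (Iic 0) := by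
  obtain ⟨C, hC, hb⟩ := exists_norm_cpow_real_le hL (k := k) (by linarith)
  refine Integrable.integrableOn ?_
  refine ((integrable_one_add_abs_rpow hk).const_mul C).mono'
    (LerchAdmissible.continuous_expMulCpow (Or.inl hL) 0).aestronglyMeasurable
    (ae_of_all _ fun x => ?_)
  rw [expMulCpow_zero_left]
  exact hb x

theorem integral_Iic_cpow {L k : ℂ} (hL : 0 < L.re) (hk : k.re < -1) :
    ∫ x in Iic (0 : ℝ), expMulCpow 0 k L x = L ^ (k + 1) / (Complex.I * (k + 1)) := by
  have hk1 : k + 1 ≠ 0 := fun h => by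
    have := congrArg Complex.re h; simp at this; linarith
  have hd : ∀ x ∈ Iio (0 : ℝ), HasDerivAt (fun x : ℝ => expMulCpow 0 (k + 1) L x)
      (Complex.I * (k + 1) * expMulCpow 0 k L x) x := fun x _ => by
    simpa using hasDerivAt_expMulCpow (m := 0) (k := k + 1) (add_I_mul_mem_slitPlane hL x)
  have hlim : Tendsto (fun x : ℝ => expMulCpow 0 (k + 1) L x) atBot (𝓝 0) := by
    obtain ⟨C, hC, hb⟩ := exists_norm_cpow_real_le hL (k := k + 1) (by simp; linarith)
    have h0 := ((tendsto_one_add_abs_rpow_cocompact (p := (k + 1).re)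
      (by simp; linarith)).const_mul C).mono_left atBot_le_cocompact
    rw [mul_zero] at h0
    refine squeeze_zero_norm (fun x => ?_) h0
    rw [expMulCpow_zero_left]
    exact hb x
  have h := integral_Iic_of_hasDerivAt_of_tendsto (LerchAdmissible.continuous_expMulCpow
    (Or.inl hL) 0).continuousWithinAt hd ((integrableOn_Iic_cpow hL hk).const_mul _) hlim
  rw [integral_const_mul] at h
  rw [eq_div_iff (mul_ne_zero Complex.I_ne_zero hk1), mul_comm, h, expMulCpow_zero_left]
  simp

/-- Writing the Fermi function as its difference with the step plus the step leaves an entire part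
and the explicit term L^(1-s)/(s-1), which carries the only possible pole. -/
theorem isHurwitzContinuation_lerchParam {L α : ℂ} (hL : 0 < L.re) (hα : |α.re| < Real.pi) :
    IsHurwitzContinuation (lerchParam L α) fun s => (2 * Real.pi : ℂ) ^ (s - 1) *
      (-Complex.I * (∫ x : ℝ, expMulCpow 0 (-s) L x * (fermi α x - negStep x)) +
        L ^ (1 - s) / (s - 1)) := by
  have hpi : (2 * Real.pi : ℂ) ≠ 0 := by exact_mod_cast Real.two_pi_pos.ne'
  have hL0 : L ≠ 0 := by rintro rfl; simp at hL
  refine ⟨fun s hs => ?_, fun s hs => ?_⟩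
  · have h1 : s - 1 ≠ 0 := sub_ne_zero.2 hs
    refine DifferentiableAt.differentiableWithinAt (DifferentiableAt.mul ?_ (DifferentiableAt.add
      ((differentiable_integral_cpow_mul_fermi_sub_negStep hL hα s).const_mul _)
      (DifferentiableAt.div ?_ (by fun_prop) h1)))
    · exact DifferentiableAt.const_cpow (by fun_prop) (Or.inl hpi)
    · exact DifferentiableAt.const_cpow (by fun_prop) (Or.inl hL0)
  · have hk : (-s).re < -1 := by simpa using hs
    have hadm : LerchAdmissible L (-s) := Or.inl hL
    have h := hurwitz_series_eq_integral hL hα hk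
    rw [neg_neg] at h
    have i2 := hadm.integrable_mul_fermi_sub_negStep (m := 0) hα (by simp)
    have i1 : Integrable fun x : ℝ => expMulCpow 0 (-s) L x * negStep x := by
      refine ((integrable_indicator_iff measurableSet_Iic).2 (integrableOn_Iic_cpow hL hk)).congr
        (ae_of_all _ fun x => ?_)
      by_cases hx : x ∈ Iic (0 : ℝ) <;> simp [negStep, hx]
    have e : ∫ x : ℝ, expMulCpow 0 (-s) L x * fermi α x =
        (∫ x : ℝ, expMulCpow 0 (-s) L x * (fermi α x - negStep x)) +
          L ^ (-s + 1) / (Complex.I * (-s + 1)) := by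
      rw [← integral_Iic_cpow hL hk, ← integral_mul_negStep, ← integral_add i2 i1]
      congr 1 with x; ring
    have h1 : s - 1 ≠ 0 := fun h => by
      have := congrArg Complex.re h; simp at this; linarith
    have h2 : -s + 1 ≠ 0 := fun h => h1 (by linear_combination -h)
    have e2 : -Complex.I * (L ^ (-s + 1) / (Complex.I * (-s + 1))) = L ^ (1 - s) / (s - 1) := by
      rw [show (1 - s : ℂ) = -s + 1 by ring]
      field_simp
      ring
    have e3 : (2 * Real.pi : ℂ) ^ (s - 1) * (2 * Real.pi : ℂ) ^ (-s + 1) = 1 := by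
      rw [← Complex.cpow_add _ _ hpi]; simp
    rw [e, mul_add, e2] at h
    beta_reduce
    rw [← h, ← mul_assoc, e3, one_mul]

/-! ### The Hurwitz-Lerch function at `exp (2πm)` -/

theorem lerchPhi_of_mem {z s b : ℂ} (hz : z ∈ lerchCutPlane) :
    lerchPhi z s b = lerchPrincipal s b z := if_pos hz

theorem one_notMem_lerchCutPlane : (1 : ℂ) ∉ lerchCutPlane := fun h => h ⟨by simp, by simp⟩

theorem lerchPhi_one (s b : ℂ) : lerchPhi 1 s b = hurwitzZetaC s b := by
  rw [lerchPhi, if_neg one_notMem_lerchCutPlane, if_pos rfl]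

theorem lerchPhi_of_tendsto {z s b l : ℂ} (hz : z ∉ lerchCutPlane) (hz1 : z ≠ 1)
    (h : Tendsto (lerchPrincipal s b) (𝓝[{w : ℂ | w.im < 0}] z) (𝓝 l)) : lerchPhi z s b = l := by
  have him : z.im = 0 := (not_not.1 hz).2
  have := neBot_nhdsWithin_im_neg him
  rw [lerchPhi, if_neg hz, if_neg hz1]
  exact h.limUnder_eq

/-- The Hurwitz-Lerch function at `exp (2πm)` is a line integral, up to a term which does not
depend on `α`. -/
theorem exists_lerchPhi_eq_integral {m k L : ℂ} (hk : k ≠ 0) (hL : 0 < L.re)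
    (hm : |m.im| < 1) (hmk : m ≠ 0 ∨ k ≠ -1) :
    ∃ E, ∀ α : ℂ, |α.re| < Real.pi →
      (2 * Real.pi : ℂ) ^ (k + 1) * (Complex.exp ((Real.pi - α) * m) *
        lerchPhi (Complex.exp (2 * m * Real.pi)) (-k) (lerchParam L α)) =
      -Complex.I * (∫ x : ℝ, expMulCpow m k L x * (fermi α x - negStep x)) + E := by
  obtain ⟨hm1, hm2⟩ := abs_lt.1 hm
  have hpi : (2 * Real.pi : ℂ) ≠ 0 := by exact_mod_cast Real.two_pi_pos.ne'
  have hpi2 : (2 * Real.pi : ℂ) ^ (k + 1) ≠ 0 := by simp [Complex.cpow_eq_zero_iff]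
  rcases lt_trichotomy m.im 0 with him | him | him
  · refine ⟨-Complex.I * ∫ x in Iic (0 : ℝ), expMulCpow m k L x, fun α hα => ?_⟩
    rw [lerchPhi_of_mem (exp_two_mul_pi_mem_lerchCutPlane hm (Or.inl him.ne))]
    exact lerchPrincipal_eq_of_im_neg hk hL hα hm1 him
  · by_cases hm0 : m = 0
    · subst hm0
      refine ⟨L ^ (1 - -k) / (-k - 1), fun α hα => ?_⟩
      have hk1 : -k ∈ ({1}ᶜ : Set ℂ) := fun h =>
        (hmk.resolve_left (by simp)) (by rw [← neg_neg k, mem_singleton_iff.1 h])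
      have hH := isHurwitzContinuation_lerchParam hL hα
      have h := hH.hurwitzZetaC.eqOn hH hk1
      simp only [neg_neg] at h
      simp only [mul_zero, zero_mul, Complex.exp_zero, one_mul]
      have e3 : (2 * Real.pi : ℂ) ^ (k + 1) * (2 * Real.pi : ℂ) ^ (-k - 1) = 1 := by
        rw [← Complex.cpow_add _ _ hpi]; simp
      rw [lerchPhi_one, h, ← mul_assoc, e3, one_mul]
    · obtain ⟨E, hE⟩ := exists_tendsto_lerchPrincipal hk hL him hm0
      refine ⟨E, fun α hα => ?_⟩
      have h := hE α hα
      have hzim : (Complex.exp (2 * m * Real.pi)).im = 0 := by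
        rw [Complex.exp_im]; simp [him]
      have key : lerchPhi (Complex.exp (2 * m * Real.pi)) (-k) (lerchParam L α) =
          (Complex.exp ((Real.pi - α) * m))⁻¹ * (((2 * Real.pi : ℂ) ^ (k + 1))⁻¹ *
          (-Complex.I * (∫ x : ℝ, expMulCpow m k L x * (fermi α x - negStep x)) + E)) := by
        -- For negative m the point z lies in the unit disc and the limit from below is the value by
        -- continuity; for positive m it is the value by definition.
        by_cases hz : Complex.exp (2 * m * Real.pi) ∈ lerchCutPlane
        · rw [lerchPhi_of_mem hz]
          obtain ⟨F, hF, -⟩ := exists_isLerchContinuation hk hL hα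
          have := neBot_nhdsWithin_im_neg hzim
          exact tendsto_nhds_unique (((hF.lerchPrincipal.1.differentiableAt
            (isOpen_lerchCutPlane.mem_nhds hz)).continuousAt.tendsto).mono_left
              nhdsWithin_le_nhds) h
        · refine lerchPhi_of_tendsto hz (fun h1 => hm0 ?_) h
          have h2 := exp_two_mul_pi_norm m
          rw [h1, norm_one, eq_comm, Real.exp_eq_one_iff] at h2
          exact Complex.ext ((mul_eq_zero.1 h2).resolve_left Real.two_pi_pos.ne') him
      rw [key, mul_inv_cancel_left₀ (Complex.exp_ne_zero _), mul_inv_cancel_left₀ hpi2]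
  · refine ⟨Complex.I * ∫ x in Ioi (0 : ℝ), expMulCpow m k L x, fun α hα => ?_⟩
    rw [lerchPhi_of_mem (exp_two_mul_pi_mem_lerchCutPlane hm (Or.inl him.ne'))]
    exact lerchPrincipal_eq_of_im_pos hk hL hα him hm2

/-! ### The recurrence in the parameter -/

theorem tsum_lerch_eq_add {b s z : ℂ} (h : Summable fun n : ℕ => z ^ n / (b + n) ^ s) :
    ∑' n : ℕ, z ^ n / (b + n) ^ s = 1 / b ^ s + z * ∑' n : ℕ, z ^ n / (b + 1 + n) ^ s := by
  rw [h.tsum_eq_zero_add, ← tsum_mul_left]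
  congr 1
  · simp
  · refine tsum_congr fun n => ?_
    rw [pow_succ']; push_cast
    rw [mul_div_assoc, add_assoc, add_comm (1 : ℂ)]

theorem IsLerchContinuation.of_add_one {s b : ℂ} {F : ℂ → ℂ}
    (hF : IsLerchContinuation s (b + 1) F)
    (hs : ∀ z : ℂ, ‖z‖ < 1 → Summable fun n : ℕ => z ^ n / (b + n) ^ s) :
    IsLerchContinuation s b fun z => 1 / b ^ s + z * F z :=
  ⟨(differentiableOn_id.mul hF.1).const_add _, fun z hz => by
    beta_reduce
    rw [tsum_lerch_eq_add (hs z hz), hF.2 z hz]⟩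

theorem IsHurwitzContinuation.of_add_one {b : ℂ} {G : ℂ → ℂ}
    (hG : IsHurwitzContinuation (b + 1) G) :
    ∃ G' : ℂ → ℂ, IsHurwitzContinuation b G' ∧ ∀ s, s ≠ 0 → G' s = 1 / b ^ s + G s := by
  have hsum : ∀ s : ℂ, 1 < s.re →
      ∑' n : ℕ, 1 / (b + n) ^ s = 1 / b ^ s + G s := fun s hs => by
    have := tsum_lerch_eq_add (b := b) (s := s) (z := 1) (by simpa using summable_hurwitz b hs)
    rw [hG.2 s hs]
    simpa using this
  -- For b = 0 the function 1/b^s is 0 except at s = 0, where it is 1, so the sum would not be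
  -- holomorphic there. Then G itself is the continuation, and the relation is claimed only for s ≠
  -- 0.
  by_cases hb : b = 0
  · have hz : ∀ s : ℂ, s ≠ 0 → G s = 1 / b ^ s + G s := fun s hs => by
      rw [hb, Complex.zero_cpow hs]; simp
    refine ⟨G, ⟨hG.1, fun s hs => ?_⟩, hz⟩
    have hs0 : s ≠ 0 := by rintro rfl; norm_num at hs
    rw [hsum s hs, ← hz s hs0]
  · refine ⟨fun s => 1 / b ^ s + G s, ⟨?_, fun s hs => (hsum s hs).symm⟩, fun s _ => rfl⟩
    refine DifferentiableOn.add (fun s _ => DifferentiableAt.differentiableWithinAt ?_) hG.1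
    refine DifferentiableAt.div (by fun_prop) ?_ (by simp [Complex.cpow_eq_zero_iff, hb])
    exact DifferentiableAt.const_cpow (by fun_prop) (Or.inl hb)

/-- Existence of the analytic continuations and boundary values which define
`lerchPhi z s b`. -/
structure LerchRegular (s b z : ℂ) : Prop where
  lerch : ∃ F, IsLerchContinuation s b F
  hurwitz : ∃ G, IsHurwitzContinuation b G
  limit : z ∉ lerchCutPlane → z ≠ 1 →
    ∃ l, Tendsto (lerchPrincipal s b) (𝓝[{w : ℂ | w.im < 0}] z) (𝓝 l)

/-- The relation holds on the cut plane by uniqueness of continuation, passes to limits from the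
lower half-plane, and at z = 1 follows from uniqueness in s. Regularity is propagated because the
values are defined by choice and by `limUnder`. -/
theorem LerchRegular.of_add_one {s b z : ℂ} (h : LerchRegular s (b + 1) z) (hs0 : s ≠ 0)
    (hs1 : z ≠ 1 ∨ s ≠ 1)
    (hs : ∀ z : ℂ, ‖z‖ < 1 → Summable fun n : ℕ => z ^ n / (b + n) ^ s) :
    LerchRegular s b z ∧ lerchPhi z s b = 1 / b ^ s + z * lerchPhi z s (b + 1) := by
  obtain ⟨⟨F, hF⟩, ⟨G, hG⟩, hl⟩ := h
  have hF' := hF.lerchPrincipal.of_add_one hs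
  have heq : EqOn (lerchPrincipal s b)
      (fun z => 1 / b ^ s + z * lerchPrincipal s (b + 1) z) lerchCutPlane :=
    hF'.lerchPrincipal.eqOn hF'
  have hlim : ∀ l, Tendsto (lerchPrincipal s (b + 1)) (𝓝[{w : ℂ | w.im < 0}] z) (𝓝 l) →
      Tendsto (lerchPrincipal s b) (𝓝[{w : ℂ | w.im < 0}] z) (𝓝 (1 / b ^ s + z * l)) := by
    intro l h
    have hid : Tendsto (fun w : ℂ => w) (𝓝[{w : ℂ | w.im < 0}] z) (𝓝 z) := nhdsWithin_le_nhds
    refine ((hid.mul h).const_add _).congr' ?_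
    filter_upwards [self_mem_nhdsWithin] with w hw
    exact (heq fun h0 => (ne_of_lt hw) h0.2).symm
  obtain ⟨G', hG', hGG'⟩ := hG.hurwitzZetaC.of_add_one
  refine ⟨⟨⟨_, hF'⟩, ⟨G', hG'⟩, fun h1 h2 => ?_⟩, ?_⟩
  · obtain ⟨l, hl⟩ := hl h1 h2
    exact ⟨_, hlim l hl⟩
  · by_cases hz : z ∈ lerchCutPlane
    · rw [lerchPhi_of_mem hz, lerchPhi_of_mem hz]
      exact heq hz
    · by_cases hz1 : z = 1
      · subst hz1
        have hs1' : s ∈ ({1}ᶜ : Set ℂ) := hs1.resolve_left (by simp)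
        rw [lerchPhi_one, lerchPhi_one, one_mul, ← hGG' s hs0]
        exact hG'.hurwitzZetaC.eqOn hG' hs1'
      · obtain ⟨l, hl⟩ := hl hz hz1
        rw [lerchPhi_of_tendsto hz hz1 hl, lerchPhi_of_tendsto hz hz1 (hlim l hl)]

theorem lerchRegular_of_re_pos {k m L α : ℂ} (hk : k ≠ 0) (hL : 0 < L.re)
    (hα : |α.re| < Real.pi) (hm : |m.im| < 1) :
    LerchRegular (-k) (lerchParam L α) (Complex.exp (2 * m * Real.pi)) := by
  refine ⟨?_, ⟨_, isHurwitzContinuation_lerchParam hL hα⟩, fun h1 h2 => ?_⟩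
  · obtain ⟨F, hF, -⟩ := exists_isLerchContinuation hk hL hα
    exact ⟨F, hF⟩
  · have him : m.im = 0 := by
      by_contra h
      exact h1 (exp_two_mul_pi_mem_lerchCutPlane hm (Or.inl h))
    have hm0 : m ≠ 0 := by rintro rfl; simp at h2
    obtain ⟨E, hE⟩ := exists_tendsto_lerchPrincipal hk hL him hm0
    exact ⟨_, hE α hα⟩

theorem LerchAdmissible.integrable_mul_fermi_sub_fermi {L k m α β : ℂ}
    (h : LerchAdmissible L k) (hα : |α.re| < Real.pi) (hβ : |β.re| < Real.pi)
    (hm : |m.im| < 1) :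
    Integrable fun x : ℝ => expMulCpow m k L x * (fermi α x - fermi β x) := by
  refine ((h.integrable_mul_fermi_sub_negStep hα hm).sub
    (h.integrable_mul_fermi_sub_negStep hβ hm)).congr (ae_of_all _ fun x => ?_)
  simp only [Pi.sub_apply]; ring

theorem LerchAdmissible.integral_mul_fermi_sub_fermi_shift {L k m α β : ℂ}
    (h : LerchAdmissible L k) (hα : |α.re| < Real.pi) (hβ : |β.re| < Real.pi)
    (hm : |m.im| < 1) :
    (∫ x : ℝ, expMulCpow m k L x * (fermi α x - fermi β x)) -
      Complex.exp (2 * m * Real.pi) *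
        ∫ x : ℝ, expMulCpow m k (L + 2 * Real.pi) x * (fermi α x - fermi β x) =
      2 * Real.pi * Complex.I * (Complex.exp ((Real.pi - α) * m) * (-α + L + Real.pi) ^ k -
        Complex.exp ((Real.pi - β) * m) * (-β + L + Real.pi) ^ k) := by
  obtain ⟨δ, hδ, C, hC, R, hb⟩ := expMulCpow_mul_fermi_sub_bound h hm hα hβ
  have := integral_expMulCpow_shift (c := 1) h hα hβ ((integrable_exp_neg_mul_abs hδ).const_mul C)
    (by simpa only [mul_zero] using (tendsto_exp_neg_mul_abs_cocompact hδ).const_mul C) (R := R)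
    (m := m) (by simpa only [one_mul] using hb)
  simpa only [one_mul] using this

/-- The difference of two Hurwitz-Lerch functions as a line integral. -/
theorem lerchPhi_sub_eq_integral {k m L : ℂ} (hadm : LerchAdmissible L k) (hk : k ≠ 0)
    (hm : |m.im| < 1) (hmk : m ≠ 0 ∨ k ≠ -1) {α β : ℂ} (hα : |α.re| < Real.pi)
    (hβ : |β.re| < Real.pi) :
    (2 * Real.pi : ℂ) ^ (k + 1) * (Complex.exp ((Real.pi - α) * m) *
        lerchPhi (Complex.exp (2 * m * Real.pi)) (-k) (lerchParam L α) -
      Complex.exp ((Real.pi - β) * m) *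
        lerchPhi (Complex.exp (2 * m * Real.pi)) (-k) (lerchParam L β)) =
      -Complex.I * ∫ x : ℝ, expMulCpow m k L x * (fermi α x - fermi β x) := by
  -- N bounds the number of shifts by 2π needed to reach Re L > 0.
  suffices H : ∀ (N : ℕ) (L : ℂ), LerchAdmissible L k → 0 < L.re + 2 * Real.pi * N →
      (∀ α : ℂ, |α.re| < Real.pi →
        LerchRegular (-k) (lerchParam L α) (Complex.exp (2 * m * Real.pi))) ∧
      (2 * Real.pi : ℂ) ^ (k + 1) * (Complex.exp ((Real.pi - α) * m) *
        lerchPhi (Complex.exp (2 * m * Real.pi)) (-k) (lerchParam L α) -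
      Complex.exp ((Real.pi - β) * m) *
        lerchPhi (Complex.exp (2 * m * Real.pi)) (-k) (lerchParam L β)) =
      -Complex.I * ∫ x : ℝ, expMulCpow m k L x * (fermi α x - fermi β x) by
    obtain ⟨N, hN⟩ := exists_nat_gt (-L.re / (2 * Real.pi))
    rw [div_lt_iff₀ Real.two_pi_pos] at hN
    exact (H N L hadm (by linarith)).2
  clear hadm L
  intro N
  induction N with
  | zero =>
    intro L hadm hL
    rw [Nat.cast_zero, mul_zero, add_zero] at hL
    refine ⟨fun α hα => lerchRegular_of_re_pos hk hL hα hm, ?_⟩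
    -- The same E serves α and β and cancels.
    obtain ⟨E, hE⟩ := exists_lerchPhi_eq_integral hk hL hm hmk
    have e : ∫ x : ℝ, expMulCpow m k L x * (fermi α x - fermi β x) =
        (∫ x : ℝ, expMulCpow m k L x * (fermi α x - negStep x)) -
          ∫ x : ℝ, expMulCpow m k L x * (fermi β x - negStep x) := by
      rw [← integral_sub (hadm.integrable_mul_fermi_sub_negStep hα hm)
        (hadm.integrable_mul_fermi_sub_negStep hβ hm)]
      congr 1 with x; ring
    rw [e, mul_sub, hE α hα, hE β hβ]
    ring
  | succ N ih =>
    intro L hadm hL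
    have hadm' : LerchAdmissible (L + 2 * Real.pi) k := hadm.mono (by simp; positivity)
    obtain ⟨hreg, hint⟩ := ih (L + 2 * Real.pi) hadm' (by
      push_cast at hL; simp; linarith)
    -- This excludes the pole of the Hurwitz zeta function; |Im m| < 1 makes m = 0 the only preimage
    -- of z = 1.
    have hs1 : Complex.exp (2 * m * Real.pi) ≠ 1 ∨ -k ≠ 1 := by
      by_cases hk1 : k = -1
      · left
        intro h1
        refine (hmk.resolve_right (by simpa using hk1)) ?_
        by_contra hm0
        by_cases him : m.im = 0
        · have h2 := exp_two_mul_pi_norm m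
          rw [h1, norm_one, eq_comm, Real.exp_eq_one_iff] at h2
          exact hm0 (Complex.ext ((mul_eq_zero.1 h2).resolve_left Real.two_pi_pos.ne') him)
        · have := exp_two_mul_pi_mem_lerchCutPlane hm (Or.inl him)
          rw [h1] at this
          exact one_notMem_lerchCutPlane this
      · exact Or.inr fun h => hk1 (by rw [← neg_neg k, h])
    have hstep : ∀ α : ℂ, |α.re| < Real.pi →
        LerchRegular (-k) (lerchParam L α) (Complex.exp (2 * m * Real.pi)) ∧
        lerchPhi (Complex.exp (2 * m * Real.pi)) (-k) (lerchParam L α) =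
          1 / lerchParam L α ^ (-k) + Complex.exp (2 * m * Real.pi) *
            lerchPhi (Complex.exp (2 * m * Real.pi)) (-k) (lerchParam (L + 2 * Real.pi) α) := by
      intro α hα
      have hb : LerchAdmissible (lerchParam L α) k := by
        rcases hadm with h | ⟨h, -⟩ | h
        · exact Or.inl (lerchParam_re_pos h.le hα)
        · exact Or.inl (lerchParam_re_pos h.ge hα)
        · exact Or.inr (Or.inr h)
      have := hreg α hα
      rw [lerchParam_add_one] at this ⊢
      exact this.of_add_one (neg_ne_zero.2 hk) hs1 fun z hz => summable_lerch hb hz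
    refine ⟨fun α hα => (hstep α hα).1, ?_⟩
    have hsh := hadm.integral_mul_fermi_sub_fermi_shift hα hβ hm
    have hpow : ∀ α : ℂ, (-α + L + Real.pi) ^ k =
        (2 * Real.pi : ℂ) ^ k * (1 / lerchParam L α ^ (-k)) := fun α => by
      have := add_pi_cpow_eq hk L α 0
      rw [div_cpow_neg]
      simpa using this
    have hpi : (2 * Real.pi : ℂ) ≠ 0 := by exact_mod_cast Real.two_pi_pos.ne'
    have hpk : (2 * Real.pi : ℂ) ^ (k + 1) = (2 * Real.pi : ℂ) ^ k * (2 * Real.pi) := by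
      rw [Complex.cpow_add _ _ hpi, Complex.cpow_one]
    rw [(hstep α hα).2, (hstep β hβ).2]
    rw [hpow, hpow, sub_eq_iff_eq_add] at hsh
    rw [hsh]
    rw [hpk] at hint ⊢
    linear_combination Complex.exp (2 * m * Real.pi) * hint +
      (2 * Real.pi * (Complex.exp ((Real.pi - α) * m) * ((2 * Real.pi : ℂ) ^ k *
        (1 / lerchParam L α ^ (-k))) - Complex.exp ((Real.pi - β) * m) *
        ((2 * Real.pi : ℂ) ^ k * (1 / lerchParam L β ^ (-k))))) * Complex.I_sq

/-! ### The logarithm of the quotient -/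

theorem fermi_neg {α : ℂ} (hα : |α.re| < Real.pi) (x : ℝ) :
    fermi α ((-x : ℝ) : ℂ) = 1 - fermi (-α) x := by
  have h1 := one_add_exp_ne_zero hα (-x)
  have h2 := one_add_exp_ne_zero (α := -α) (by simpa using hα) x
  have h3 : Complex.exp (((-x : ℝ) : ℂ) - Complex.I * α) *
      Complex.exp (x - Complex.I * -α) = 1 := by
    rw [← Complex.exp_add, ← Complex.exp_zero]; congr 1; push_cast; ring
  rw [fermi, fermi, eq_sub_iff_add_eq, div_add_div _ _ h1 h2, div_eq_one_iff_eq (mul_ne_zero h1 h2)]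
  linear_combination -h3

/-- The combination of Fermi functions in the integral formula. -/
noncomputable def fermiQuad (α β x : ℂ) : ℂ :=
  (fermi α x - fermi β x) + (fermi (-α) x - fermi (-β) x)

theorem fermiQuad_neg {α β : ℂ} (hα : |α.re| < Real.pi) (hβ : |β.re| < Real.pi) (x : ℝ) :
    fermiQuad α β ((-x : ℝ) : ℂ) = -fermiQuad α β x := by
  rw [fermiQuad, fermiQuad, fermi_neg hα, fermi_neg hβ, fermi_neg (α := -α) (by simpa using hα),
    fermi_neg (α := -β) (by simpa using hβ), neg_neg, neg_neg]
  ring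

theorem one_add_exp_mul (α : ℂ) (x : ℂ) :
    (1 + Complex.exp (x - Complex.I * α)) * (1 + Complex.exp (x - Complex.I * -α)) =
      2 * Complex.exp x * (Complex.cos α + Complex.cosh x) := by
  rw [Complex.cos, Complex.cosh, Complex.exp_sub, Complex.exp_sub, Complex.exp_neg,
    show Complex.I * -α = -(α * Complex.I) by ring, mul_comm Complex.I α,
    show -α * Complex.I = -(α * Complex.I) by ring, Complex.exp_neg]
  have h1 := Complex.exp_ne_zero x
  have h2 := Complex.exp_ne_zero (α * Complex.I)
  field_simp
  ring

theorem cos_add_cosh_ne_zero {α : ℂ} (hα : |α.re| < Real.pi) (x : ℝ) :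
    Complex.cos α + Complex.cosh x ≠ 0 := fun h => by
  have := one_add_exp_mul α x
  rw [h, mul_zero] at this
  exact mul_ne_zero (one_add_exp_ne_zero hα x)
    (one_add_exp_ne_zero (α := -α) (by simpa using hα) x) this

/-- This is the logarithmic derivative of the factorization in `one_add_exp_mul`: each factor
contributes 1 minus a Fermi function, and exp(x) removes 1. -/
theorem sinh_div_cos_add_cosh {α : ℂ} (hα : |α.re| < Real.pi) (x : ℝ) :
    Complex.sinh x / (Complex.cos α + Complex.cosh x) = 1 - fermi α x - fermi (-α) x := by
  have h1 := one_add_exp_ne_zero hα x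
  have h2 := one_add_exp_ne_zero (α := -α) (by simpa using hα) x
  have h3 := one_add_exp_mul α x
  have h0 := cos_add_cosh_ne_zero hα x
  have h4 : Complex.exp (x - Complex.I * α) * Complex.exp (x - Complex.I * -α) =
      Complex.exp x * Complex.exp x := by
    rw [← Complex.exp_add, ← Complex.exp_add]; congr 1; ring
  have h5 : 2 * Complex.exp x * Complex.sinh x = Complex.exp x * Complex.exp x - 1 := by
    rw [Complex.sinh, Complex.exp_neg]
    field_simp [Complex.exp_ne_zero (x : ℂ)]
  have hx := Complex.exp_ne_zero (x : ℂ)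
  rw [fermi, fermi, div_eq_iff h0]
  refine mul_left_cancel₀ (mul_ne_zero two_ne_zero hx) ?_
  rw [h5, show 2 * Complex.exp x * ((1 - 1 / (1 + Complex.exp (x - Complex.I * α)) -
    1 / (1 + Complex.exp (x - Complex.I * -α))) * (Complex.cos α + Complex.cosh x)) =
    (1 - 1 / (1 + Complex.exp (x - Complex.I * α)) -
    1 / (1 + Complex.exp (x - Complex.I * -α))) *
    (2 * Complex.exp x * (Complex.cos α + Complex.cosh x)) by ring, ← h3, ← h4]
  clear h3 h4 h5
  generalize Complex.exp (x - Complex.I * α) = A at *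
  generalize Complex.exp (x - Complex.I * -α) = B at *
  field_simp
  ring

theorem IsLogQuotient.hasDerivAt {α β : ℂ} {ℓ : ℝ → ℂ} (h : IsLogQuotient α β ℓ)
    (hα : |α.re| < Real.pi) (hβ : |β.re| < Real.pi) {x : ℝ} (hx : 0 < x) :
    HasDerivAt ℓ (-fermiQuad α β x) x := by
  have hA := cos_add_cosh_ne_zero hα
  have hB := cos_add_cosh_ne_zero hβ
  set R : ℝ → ℂ := fun y =>
    (Complex.cos α + Complex.cosh y) / (Complex.cos β + Complex.cosh y) with hR
  have hRx : R x ≠ 0 := div_ne_zero (hA x) (hB x)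
  have hcosh : ∀ γ : ℂ, HasDerivAt (fun y : ℝ => Complex.cos γ + Complex.cosh y)
      (Complex.sinh x) x := fun γ =>
    ((Complex.hasDerivAt_cosh (x : ℂ)).const_add (Complex.cos γ)).comp_ofReal
  have hRd := (hcosh α).div (hcosh β) (hB x)
  have hlog := (hRd.div_const (R x)).clog_real (by
    change R x / R x ∈ _
    rw [div_self hRx]; exact Complex.one_mem_slitPlane)
  have hcont : ContinuousAt ℓ x := h.continuousOn.continuousAt (Ici_mem_nhds hx)
  -- Dividing by R x brings the quotient near 1, where the principal logarithm follows the
  -- continuous branch.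
  have hev : ℓ =ᶠ[𝓝 x] fun y => ℓ x + Complex.log (R y / R x) := by
    have h1 : Tendsto (fun y => (ℓ y - ℓ x).im) (𝓝 x) (𝓝 0) := by
      have := (Complex.continuous_im.tendsto _).comp (hcont.tendsto.sub_const (ℓ x))
      simpa [Function.comp_def] using this
    filter_upwards [h1.eventually (Ioo_mem_nhds (neg_neg_of_pos Real.pi_pos) Real.pi_pos),
      Ioi_mem_nhds hx] with y hy hy0
    have e : R y / R x = Complex.exp (ℓ y - ℓ x) := by
      rw [Complex.exp_sub, h.exp_eq y (le_of_lt hy0), h.exp_eq x hx.le]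
    rw [e, Complex.log_exp hy.1 hy.2.le]
    ring
  refine ((hlog.const_add (ℓ x)).congr_of_eventuallyEq hev).congr_deriv ?_
  have e1 := sinh_div_cos_add_cosh hα x
  have e2 := sinh_div_cos_add_cosh hβ x
  have e3 : fermiQuad α β x = Complex.sinh x / (Complex.cos β + Complex.cosh x) -
      Complex.sinh x / (Complex.cos α + Complex.cosh x) := by
    rw [e1, e2, fermiQuad]; ring
  rw [e3]
  have := hA x
  have := hB x
  change _ / R x / (R x / R x) = _
  rw [div_self hRx, div_one]
  simp only [hR]
  field_simp
  ring

theorem exists_norm_fermiQuad_le {α β : ℂ} (hα : |α.re| < Real.pi) (hβ : |β.re| < Real.pi) :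
    ∃ C > 0, ∀ x : ℝ, ‖fermiQuad α β x‖ ≤ C * Real.exp (-|x|) := by
  obtain ⟨C, hC, R, h⟩ := fermi_sub_fermi_bound hα hβ
  obtain ⟨C', hC', R', h'⟩ := fermi_sub_fermi_bound (α := -α) (β := -β)
    (by simpa using hα) (by simpa using hβ)
  refine ⟨C + C', by positivity, fun x => ?_⟩
  rw [fermiQuad, add_mul]
  exact (norm_add_le _ _).trans (add_le_add (h x (by simp)) (h' x (by simp)))

theorem continuous_fermiQuad {α β : ℂ} (hα : |α.re| < Real.pi) (hβ : |β.re| < Real.pi) :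
    Continuous fun x : ℝ => fermiQuad α β x :=
  ((continuous_fermi hα).sub (continuous_fermi hβ)).add
    ((continuous_fermi (by simpa using hα)).sub (continuous_fermi (by simpa using hβ)))

/-- The normalization at infinity gives ℓ(x) as the integral of `fermiQuad` over (x, ∞). -/
theorem IsLogQuotient.exists_norm_le {α β : ℂ} {ℓ : ℝ → ℂ} (h : IsLogQuotient α β ℓ)
    (hα : |α.re| < Real.pi) (hβ : |β.re| < Real.pi) :
    ∃ C > 0, ∀ x : ℝ, 0 ≤ x → ‖ℓ x‖ ≤ C * Real.exp (-x) := by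
  obtain ⟨C, hC, hb⟩ := exists_norm_fermiQuad_le hα hβ
  have hint : Integrable fun x : ℝ => -fermiQuad α β x := by
    refine Integrable.mono' ((integrable_exp_neg_mul_abs one_pos).const_mul C)
      (continuous_fermiQuad hα hβ).neg.aestronglyMeasurable (ae_of_all _ fun x => ?_)
    rw [norm_neg, one_mul]; exact hb x
  refine ⟨C, hC, fun x hx => ?_⟩
  have hftc := integral_Ioi_of_hasDerivAt_of_tendsto
    ((h.continuousOn x hx).mono (Ici_subset_Ici.2 hx))
    (fun y hy => h.hasDerivAt hα hβ (hx.trans_lt hy)) hint.integrableOn h.tendsto_zero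
  rw [zero_sub] at hftc
  rw [← norm_neg, ← hftc, ← integral_exp_neg_Ioi, ← integral_const_mul]
  refine norm_integral_le_of_norm_le ((by
    simpa using integrableOn_exp_mul_Ioi (a := -1) (by norm_num) x :
      IntegrableOn (fun y => Real.exp (-y)) (Ioi x)).const_mul C) ?_
  filter_upwards [ae_restrict_mem measurableSet_Ioi] with y hy
  rw [norm_neg]
  simpa [abs_of_pos (hx.trans_lt hy)] using hb y

/-! ### Integration by parts -/

theorem integrable_exp_neg_mul_abs_mul_rpow {δ p : ℝ} (hδ : 0 < δ) (hp : -1 < p) :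
    Integrable fun x : ℝ => Real.exp (-(δ * |x|)) * |x| ^ p := by
  have h1 : IntegrableOn (fun x : ℝ => Real.exp (-(δ * |x|)) * |x| ^ p) (Ioi 0) := by
    refine (integrableOn_rpow_mul_exp_neg_mul_rpow hp one_pos hδ).congr_fun (fun x hx => ?_)
      measurableSet_Ioi
    simp only [abs_of_pos (mem_Ioi.1 hx), Real.rpow_one]
    ring_nf
  have h2 : IntegrableOn (fun x : ℝ => Real.exp (-(δ * |x|)) * |x| ^ p) (Iic 0) := by
    have := integrableOn_Ici_iff_integrableOn_Ioi (f := fun x : ℝ => Real.exp (-(δ * |x|)) * |x| ^ p)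
      (by finiteness) |>.2 h1
    have := IntegrableOn.comp_neg_Iic (c := (0 : ℝ)) (by rwa [neg_zero])
    simpa using this
  rw [← integrableOn_univ, ← Iic_union_Ioi (a := (0 : ℝ))]
  exact h2.union h1

theorem measurable_add_I_mul_cpow (L k : ℂ) :
    Measurable fun x : ℝ => (L + Complex.I * x) ^ k := by
  refine Measurable.pow_const ?_ k
  fun_prop

theorem LerchAdmissible.integrable_exp_neg_mul_norm_cpow {L k : ℂ} (h : LerchAdmissible L k)
    {δ : ℝ} (hδ : 0 < δ) :
    Integrable fun x : ℝ => Real.exp (-(δ * |x|)) * ‖(L + Complex.I * x) ^ k‖ := by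
  obtain ⟨C, hC, hb⟩ := h.exists_norm_expMulCpow_real_le (ε := δ / 2) (half_pos hδ)
  refine ((integrable_exp_neg_mul_abs (half_pos hδ)).const_mul C).mono' ?_
    (ae_of_all _ fun x => ?_)
  · exact ((by fun_prop : Continuous fun x : ℝ => Real.exp (-(δ * |x|))).measurable.mul
      (measurable_add_I_mul_cpow L k).norm).aestronglyMeasurable
  · have := hb 0 x
    simp only [expMulCpow_zero_left, Complex.zero_im, zero_mul, neg_zero, zero_add] at this
    rw [Real.norm_of_nonneg (by positivity)]
    calc _ ≤ Real.exp (-(δ * |x|)) * (C * Real.exp (δ / 2 * |x|)) := by gcongr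
      _ = C * Real.exp (-(δ * |x|) + δ / 2 * |x|) := by rw [Real.exp_add]; ring
      _ = _ := by ring_nf

/-- The delicate case is Re L = 0: the base may vanish at x = -Im L, with a singularity |x + Im
L|^(Re k - 1), integrable because Re k > 0. For a positive integer k the exponent k - 1 is again a
natural number. -/
theorem LerchAdmissible.integrable_exp_neg_mul_norm_cpow_sub_one {L k : ℂ}
    (h : LerchAdmissible L k) (hk : k ≠ 0) {δ : ℝ} (hδ : 0 < δ) :
    Integrable fun x : ℝ => Real.exp (-(δ * |x|)) * ‖(L + Complex.I * x) ^ (k - 1)‖ := by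
  rcases h with h | ⟨hL, hk'⟩ | ⟨n, rfl⟩
  · exact LerchAdmissible.integrable_exp_neg_mul_norm_cpow (Or.inl h) hδ
  · have hint := ((integrable_exp_neg_mul_abs_mul_rpow (p := k.re - 1) hδ
      (by linarith)).comp_add_right L.im).const_mul
        (Real.exp (Real.pi * |k.im|) * Real.exp (δ * |L.im|))
    refine hint.mono' ?_ (ae_of_all _ fun x => ?_)
    · exact ((by fun_prop : Continuous fun x : ℝ => Real.exp (-(δ * |x|))).measurable.mul
        (measurable_add_I_mul_cpow L (k - 1)).norm).aestronglyMeasurable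
    · have hn : ‖L + Complex.I * x‖ = |x + L.im| := by
        have : L + Complex.I * x = Complex.I * ((x + L.im : ℝ) : ℂ) := by
          apply Complex.ext <;> simp [hL, add_comm]
        rw [this, norm_mul, Complex.norm_I, one_mul, Complex.norm_real, Real.norm_eq_abs]
      have h1 := norm_cpow_le_exp_mul_rpow (L + Complex.I * x) (k - 1)
      rw [hn, Complex.sub_im, Complex.sub_re, Complex.one_im, Complex.one_re, sub_zero] at h1
      rw [Real.norm_of_nonneg (by positivity)]
      have h2 : Real.exp (-(δ * |x|)) ≤ Real.exp (δ * |L.im|) * Real.exp (-(δ * |x + L.im|)) := by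
        rw [← Real.exp_add, Real.exp_le_exp]
        nlinarith [abs_add_le x L.im]
      calc _ ≤ Real.exp (δ * |L.im|) * Real.exp (-(δ * |x + L.im|)) *
            (Real.exp (Real.pi * |k.im|) * |x + L.im| ^ (k.re - 1)) :=
            mul_le_mul h2 h1 (norm_nonneg _) (by positivity)
        _ = _ := by ring
  · refine LerchAdmissible.integrable_exp_neg_mul_norm_cpow (Or.inr (Or.inr ⟨n - 1, ?_⟩)) hδ
    have hn : 1 ≤ n := Nat.one_le_iff_ne_zero.2 fun h => hk (by simp [h])
    push_cast [Nat.cast_sub hn]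
    ring

theorem LerchAdmissible.hasDerivAt_expMulCpow {L k m : ℂ} (h : LerchAdmissible L k) (hk : k ≠ 0)
    {x : ℝ} (hx : L + Complex.I * x ≠ 0) :
    HasDerivAt (fun x : ℝ => expMulCpow m k L x)
      (Complex.I * m * expMulCpow m k L x + Complex.I * k * expMulCpow m (k - 1) L x) x := by
  rcases h with h | ⟨hL, -⟩ | ⟨n, rfl⟩
  · exact _root_.hasDerivAt_expMulCpow (add_I_mul_mem_slitPlane h x)
  · refine _root_.hasDerivAt_expMulCpow (Or.inr fun him => hx (Complex.ext ?_ him))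
    simpa using hL
  · refine hasDerivAt_expMulCpow_of ?_
    have hn : 1 ≤ n := Nat.one_le_iff_ne_zero.2 fun h => hk (by simp [h])
    have e : (n : ℂ) - 1 = ((n - 1 : ℕ) : ℂ) := by push_cast [Nat.cast_sub hn]; rfl
    rw [e]
    simp only [Complex.cpow_natCast]
    exact hasDerivAt_pow n _

theorem IsLogQuotient.aestronglyMeasurable {α β : ℂ} {ℓ : ℝ → ℂ} (h : IsLogQuotient α β ℓ) :
    AEStronglyMeasurable ℓ (volume.restrict (Ioi 0)) :=
  (h.continuousOn.mono Ioi_subset_Ici_self).aestronglyMeasurable measurableSet_Ioi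

theorem measurable_expMulCpow (m k L : ℂ) : Measurable fun x : ℝ => expMulCpow m k L x := by
  refine Measurable.mul ?_ (measurable_add_I_mul_cpow L k)
  fun_prop

theorem integrableOn_expMulCpow_mul {m κ L : ℂ} {ℓ : ℝ → ℂ} {C : ℝ}
    (hκ : Integrable fun x : ℝ =>
      Real.exp (-((1 - |m.im|) * |x|)) * ‖(L + Complex.I * x) ^ κ‖)
    (hmeas : AEStronglyMeasurable ℓ (volume.restrict (Ioi 0)))
    (hℓ : ∀ x : ℝ, 0 ≤ x → ‖ℓ x‖ ≤ C * Real.exp (-x)) :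
    IntegrableOn (fun x : ℝ => expMulCpow m κ L x * ℓ x) (Ioi 0) ∧
      IntegrableOn (fun x : ℝ => expMulCpow m κ L ((-x : ℝ) : ℂ) * ℓ x) (Ioi 0) := by
  have key : ∀ x y : ℝ, 0 < x → |y| = x → ‖expMulCpow m κ L y * ℓ x‖ ≤
      C * (Real.exp (-((1 - |m.im|) * |y|)) * ‖(L + Complex.I * y) ^ κ‖) := by
    intro x y hx hy
    rw [norm_mul, expMulCpow, norm_mul, norm_exp_I_mul_mul, Complex.ofReal_re,
      Complex.ofReal_im, mul_zero, sub_zero]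
    have h1 : Real.exp (-(m.im * y)) ≤ Real.exp (|m.im| * |y|) := by
      rw [Real.exp_le_exp, ← abs_mul]; exact neg_le_abs _
    calc Real.exp (-(m.im * y)) * ‖(L + Complex.I * y) ^ κ‖ * ‖ℓ x‖
        ≤ Real.exp (|m.im| * |y|) * ‖(L + Complex.I * y) ^ κ‖ * (C * Real.exp (-x)) := by
          gcongr
          exact hℓ x hx.le
      _ = C * (Real.exp (|m.im| * |y| + -|y|) * ‖(L + Complex.I * y) ^ κ‖) := by
          rw [Real.exp_add, hy]; ring
      _ = _ := by ring_nf
  constructor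
  · refine Integrable.mono' (hκ.const_mul C).integrableOn
      ((measurable_expMulCpow m κ L).aestronglyMeasurable.mul hmeas) ?_
    filter_upwards [ae_restrict_mem measurableSet_Ioi] with x hx
    exact key x x hx (abs_of_pos hx)
  · refine Integrable.mono' (hκ.comp_neg.const_mul C).integrableOn
      (((measurable_expMulCpow m κ L).comp measurable_neg).aestronglyMeasurable.mul hmeas) ?_
    filter_upwards [ae_restrict_mem measurableSet_Ioi] with x hx
    exact key x (-x) hx (by rw [abs_neg, abs_of_pos hx])

theorem tendsto_expMulCpow_mul {m k L : ℂ} (h : LerchAdmissible L k) {ℓ : ℝ → ℂ} {C : ℝ}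
    (hm : |m.im| < 1) (hℓ : ∀ x : ℝ, 0 ≤ x → ‖ℓ x‖ ≤ C * Real.exp (-x)) :
    Tendsto (fun x : ℝ => (expMulCpow m k L x - expMulCpow m k L ((-x : ℝ) : ℂ)) * ℓ x)
      atTop (𝓝 0) := by
  obtain ⟨δ, hδ, hδm⟩ : ∃ δ > 0, |m.im| + 2 * δ = 1 := ⟨(1 - |m.im|) / 2, by linarith, by ring⟩
  obtain ⟨D, hD, hb⟩ := h.exists_norm_expMulCpow_real_le hδ
  have hb' : ∀ x y : ℝ, |y| = x → ‖expMulCpow m k L y‖ ≤ D * Real.exp ((|m.im| + δ) * x) := by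
    intro x y hy
    refine (hb m y).trans ?_
    gcongr
    rw [add_mul, ← hy, ← abs_mul]
    gcongr
    exact neg_le_abs _
  have hlim : Tendsto (fun x : ℝ => 2 * D * C * Real.exp (-(δ * x))) atTop (𝓝 0) := by
    have := Real.tendsto_exp_neg_atTop_nhds_zero.comp (tendsto_id.const_mul_atTop hδ)
    simpa using this.const_mul (2 * D * C)
  refine squeeze_zero_norm' ?_ hlim
  filter_upwards [eventually_ge_atTop 0] with x hx
  rw [norm_mul]
  have h1 := hb' x x (abs_of_nonneg hx)
  have h2 := hb' x (-x) (by rw [abs_neg, abs_of_nonneg hx])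
  calc _ ≤ (D * Real.exp ((|m.im| + δ) * x) + D * Real.exp ((|m.im| + δ) * x)) *
        (C * Real.exp (-x)) :=
        mul_le_mul ((norm_sub_le _ _).trans (add_le_add h1 h2)) (hℓ x hx) (norm_nonneg _)
          (by positivity)
    _ = 2 * D * C * Real.exp ((|m.im| + δ) * x + -x) := by rw [Real.exp_add]; ring
    _ = _ := by
      congr 2
      linear_combination x * hδm

/-- Exceptional points are allowed because (L ± ix)^k need not be differentiable where its base
vanishes. -/
theorem integral_Ioi_eq_neg_of_hasDerivAt_off_countable {f f' : ℝ → ℂ} {s : Set ℝ}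
    (hs : s.Countable) (hc : ContinuousOn f (Ici 0))
    (hd : ∀ x ∈ Ioi (0 : ℝ) \ s, HasDerivAt f (f' x) x) (hi : IntegrableOn f' (Ioi 0))
    (hf : Tendsto f atTop (𝓝 0)) : ∫ x in Ioi (0 : ℝ), f' x = -f 0 := by
  have h1 := intervalIntegral_tendsto_integral_Ioi 0 hi tendsto_id
  have h2 : Tendsto (fun R : ℝ => ∫ x in (0 : ℝ)..R, f' x) atTop (𝓝 (0 - f 0)) := by
    refine (hf.sub_const (f 0)).congr' ?_
    filter_upwards [eventually_ge_atTop 0] with R hR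
    refine (integral_eq_of_hasDerivAt_off_countable_of_le f f' hR hs
      (hc.mono Icc_subset_Ici_self) (fun x hx => hd x ⟨hx.1.1, hx.2⟩) ?_).symm
    rw [intervalIntegrable_iff_integrableOn_Ioc_of_le hR]
    exact hi.mono_set Ioc_subset_Ioi_self
  rw [zero_sub] at h2
  exact tendsto_nhds_unique h1 h2

theorem integral_Ioi_add_comp_neg {f : ℝ → ℂ} (hf : Integrable f) :
    ∫ x in Ioi (0 : ℝ), (f x + f (-x)) = ∫ x : ℝ, f x := by
  rw [integral_add hf.integrableOn hf.comp_neg.integrableOn, integral_comp_neg_Ioi, neg_zero,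
    add_comm, intervalIntegral.integral_Iic_add_Ioi hf.integrableOn hf.integrableOn]

/-- In this form ik times the integrand is visibly the derivative of H(x) - H(-x), times ℓ, where H
= `expMulCpow m k (log a)`. -/
theorem lerchIntegrand_eq {a m k : ℂ} (hk : k ≠ 0) (ℓ : ℝ → ℂ) (x : ℝ) :
    lerchIntegrand a m k ℓ x =
      m / k * (expMulCpow m k (Complex.log a) x * ℓ x) +
      expMulCpow m (k - 1) (Complex.log a) x * ℓ x +
      (m / k * (expMulCpow m k (Complex.log a) ((-x : ℝ) : ℂ) * ℓ x) +
      expMulCpow m (k - 1) (Complex.log a) ((-x : ℝ) : ℂ) * ℓ x) := by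
  have e1 : Complex.exp (2 * Complex.I * m * x) =
      Complex.exp (Complex.I * m * x) * Complex.exp (Complex.I * m * x) := by
    rw [← Complex.exp_add]; ring_nf
  have e2 : Complex.exp (Complex.I * m * ((-x : ℝ) : ℂ)) = (Complex.exp (Complex.I * m * x))⁻¹ := by
    rw [← Complex.exp_neg]; push_cast; ring_nf
  have e3 : Complex.log a + Complex.I * ((-x : ℝ) : ℂ) = Complex.log a - Complex.I * x := by
    push_cast; ring
  have hne := Complex.exp_ne_zero (Complex.I * m * x)
  rw [lerchIntegrand, expMulCpow, expMulCpow, expMulCpow, expMulCpow, e1, e2, e3, Complex.exp_neg]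
  field_simp
  ring

theorem countable_setOf_add_I_mul_eq_zero (L : ℂ) :
    {x : ℝ | L + Complex.I * x = 0}.Countable := by
  refine Set.Subsingleton.countable fun x hx y hy => ?_
  have h : L + Complex.I * x = L + Complex.I * y := Eq.trans hx (Eq.symm hy)
  exact_mod_cast mul_left_cancel₀ Complex.I_ne_zero (add_left_cancel h)

theorem integral_lerchIntegrand {a m k α β : ℂ} {ℓ : ℝ → ℂ}
    (h : LerchAdmissible (Complex.log a) k) (hk : k ≠ 0) (hm : |m.im| < 1)
    (hα : |α.re| < Real.pi) (hβ : |β.re| < Real.pi) (hℓ : IsLogQuotient α β ℓ) :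
    IntegrableOn (lerchIntegrand a m k ℓ) (Ioi 0) ∧
    ∫ x in Ioi (0 : ℝ), lerchIntegrand a m k ℓ x =
      -Complex.I / k * ∫ x : ℝ, expMulCpow m k (Complex.log a) x * fermiQuad α β x := by
  set L := Complex.log a
  have hm' : 0 < 1 - |m.im| := by linarith
  obtain ⟨C, hC, hb⟩ := hℓ.exists_norm_le hα hβ
  obtain ⟨i1, i2⟩ := integrableOn_expMulCpow_mul
    (h.integrable_exp_neg_mul_norm_cpow hm') hℓ.aestronglyMeasurable hb
  obtain ⟨i3, i4⟩ := integrableOn_expMulCpow_mul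
    (h.integrable_exp_neg_mul_norm_cpow_sub_one hk hm') hℓ.aestronglyMeasurable hb
  have hint : IntegrableOn (lerchIntegrand a m k ℓ) (Ioi 0) := by
    refine (((i1.const_mul (m / k)).add i3).add ((i2.const_mul (m / k)).add i4)).congr
      (ae_of_all _ fun x => ?_)
    rw [lerchIntegrand_eq hk]
    rfl
  refine ⟨hint, ?_⟩
  set f : ℝ → ℂ := fun x => expMulCpow m k L x * fermiQuad α β x with hf
  have hfi : Integrable f := by
    refine ((h.integrable_mul_fermi_sub_fermi hα hβ hm).add
      (h.integrable_mul_fermi_sub_fermi (α := -α) (β := -β) (by simpa using hα)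
        (by simpa using hβ) hm)).congr (ae_of_all _ fun x => ?_)
    simp only [hf, fermiQuad, Pi.add_apply]; ring
  have hfi' : IntegrableOn (fun x => f x + f (-x)) (Ioi 0) :=
    hfi.integrableOn.add hfi.comp_neg.integrableOn
  have hH := h.continuous_expMulCpow m
  -- The odd combination H(x) - H(-x) vanishes at 0, so there is no boundary term. As `fermiQuad` is
  -- odd as well, the remaining integrand is f(x) + f(-x), which unfolds to the whole line.
  have hparts := integral_Ioi_eq_neg_of_hasDerivAt_off_countable
    (f := fun x : ℝ => (expMulCpow m k L x - expMulCpow m k L ((-x : ℝ) : ℂ)) * ℓ x)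
    (f' := fun x : ℝ => Complex.I * k * lerchIntegrand a m k ℓ x - (f x + f (-x)))
    (s := {x : ℝ | L + Complex.I * x = 0} ∪ Neg.neg ⁻¹' {x : ℝ | L + Complex.I * x = 0})
    ((countable_setOf_add_I_mul_eq_zero L).union
      ((countable_setOf_add_I_mul_eq_zero L).preimage neg_injective))
    ((hH.sub (hH.comp continuous_neg)).continuousOn.mul hℓ.continuousOn)
    (fun x hx => ?_) ((hint.const_mul _).sub hfi') (tendsto_expMulCpow_mul h hm hb)
  · rw [integral_sub (hint.const_mul _) hfi', integral_const_mul, integral_Ioi_add_comp_neg hfi]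
      at hparts
    simp only [Complex.ofReal_zero, neg_zero, sub_self, zero_mul, sub_eq_zero] at hparts
    rw [← hparts]
    field_simp
    linear_combination ((∫ x in Ioi (0 : ℝ), lerchIntegrand a m k ℓ x)) * Complex.I_sq
  · obtain ⟨hx0, hxs⟩ := hx
    rw [mem_union, not_or] at hxs
    have d1 := h.hasDerivAt_expMulCpow (m := m) hk hxs.1
    have d2 := (h.hasDerivAt_expMulCpow (m := m) (x := -x) hk hxs.2).scomp x (hasDerivAt_neg x)
    have d3 := hℓ.hasDerivAt hα hβ hx0
    refine ((d1.sub d2).mul d3).congr_deriv ?_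
    rw [lerchIntegrand_eq hk]
    simp only [hf, fermiQuad_neg hα hβ, Pi.sub_apply, Function.comp_apply,
      neg_smul, one_smul]
    field_simp
    ring

/-! ### The integral formula. -/

theorem lerchAdmissible_log {a k : ℂ}
    (ha : 1 < ‖a‖ ∨ (‖a‖ = 1 ∧ 0 < k.re) ∨ (a ≠ 0 ∧ ∃ n : ℕ, k = n)) :
    LerchAdmissible (Complex.log a) k := by
  rw [LerchAdmissible, Complex.log_re]
  rcases ha with h | ⟨h, hk⟩ | ⟨-, h⟩
  · exact Or.inl (Real.log_pos h)
  · exact Or.inr (Or.inl ⟨by rw [h, Real.log_one], hk⟩)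
  · exact Or.inr (Or.inr h)

theorem theorem3p3 (a m k α β : ℂ) (ℓ : ℝ → ℂ)
    (hk : k ≠ 0) (hm : |m.im| < 1) (hmk : m ≠ 0 ∨ k ≠ -1)
    (hα : |α.re| < Real.pi) (hβ : |β.re| < Real.pi)
    (ha : 1 < ‖a‖ ∨ (‖a‖ = 1 ∧ 0 < k.re) ∨ (a ≠ 0 ∧ ∃ n : ℕ, k = n))
    (hℓ : IsLogQuotient α β ℓ) :
    IntegrableOn (lerchIntegrand a m k ℓ) (Ioi 0) ∧
    ∫ x in Ioi (0 : ℝ), lerchIntegrand a m k ℓ x =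
      (2 * (Real.pi : ℂ)) ^ (k + 1) / k *
        (Complex.exp ((Real.pi - α) * m) *
            lerchPhi (Complex.exp (2 * m * Real.pi)) (-k)
              ((-α + Complex.log a + Real.pi) / (2 * Real.pi))
          + Complex.exp ((α + Real.pi) * m) *
            lerchPhi (Complex.exp (2 * m * Real.pi)) (-k)
              ((α + Complex.log a + Real.pi) / (2 * Real.pi))
          - Complex.exp ((Real.pi - β) * m) *
            (lerchPhi (Complex.exp (2 * m * Real.pi)) (-k)
                ((-β + Complex.log a + Real.pi) / (2 * Real.pi))
              + Complex.exp (2 * β * m) *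
                lerchPhi (Complex.exp (2 * m * Real.pi)) (-k)
                  ((β + Complex.log a + Real.pi) / (2 * Real.pi)))) := by
  have hadm := lerchAdmissible_log ha
  have hα' : |(-α).re| < Real.pi := by simpa using hα
  have hβ' : |(-β).re| < Real.pi := by simpa using hβ
  obtain ⟨hint, heq⟩ := integral_lerchIntegrand hadm hk hm hα hβ hℓ
  refine ⟨hint, ?_⟩
  -- The four Lerch values are paired as (α, β) and (-α, -β), matching the two differences in
  -- `fermiQuad`.
  have h1 := lerchPhi_sub_eq_integral hadm hk hm hmk hα hβ
  have h2 := lerchPhi_sub_eq_integral hadm hk hm hmk hα' hβ'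
  have e : ∫ x : ℝ, expMulCpow m k (Complex.log a) x * fermiQuad α β x =
      (∫ x : ℝ, expMulCpow m k (Complex.log a) x * (fermi α x - fermi β x)) +
        ∫ x : ℝ, expMulCpow m k (Complex.log a) x * (fermi (-α) x - fermi (-β) x) := by
    rw [← integral_add (hadm.integrable_mul_fermi_sub_fermi hα hβ hm)
      (hadm.integrable_mul_fermi_sub_fermi hα' hβ' hm)]
    congr 1 with x
    rw [fermiQuad]; ring
  have e2 : Complex.exp ((Real.pi - β) * m) * Complex.exp (2 * β * m) =
      Complex.exp ((Real.pi - -β) * m) := by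
    rw [← Complex.exp_add]; ring_nf
  have e3 : Complex.exp ((α + Real.pi) * m) = Complex.exp ((Real.pi - -α) * m) := by ring_nf
  rw [heq, e, e3, mul_add (Complex.exp ((Real.pi - β) * m)), ← mul_assoc
    (Complex.exp ((Real.pi - β) * m)) (Complex.exp (2 * β * m)), e2]
  simp only [lerchParam, neg_neg] at h1 h2
  rw [neg_div, mul_add, neg_mul, neg_mul]
  simp only [neg_mul] at h1 h2
  rw [div_mul_eq_mul_div, div_mul_eq_mul_div, div_mul_eq_mul_div, ← neg_div, ← neg_div,
    ← add_div]
  congr 1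
  linear_combination -h1 - h2
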